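/- \textbf{Theorem (Connectivity threshold for the configuration model).} For every $n\ge 1$ let $\boldsymbol d=\boldsymbol d^{(n)}=(d_1,\dots,d_n)$ be a sequence of non-negative integers with even sum. The configuration model $\mathrm{CM}_n(\boldsymbol d)$ is the random (multi)graph on $[n]=\{1,\dots,n\}$ obtained by attaching $d_v$ half-edges to each vertex $v$ and pairing all half-edges uniformly at random, each pair forming an edge. Let $D_n$ be the degree of a uniformly chosen vertex of $[n]$, let $n_i$ be the number of vertices of degree $i$, and let $|\mathscr C_{\max}|$ be the number of vertices in a largest connected component of $\mathrm{CM}_n(\boldsymbol d)$. Assume that \begin{enumerate} \item $D_n$ converges in distribution to some random variable $D$; \item $n_0=0$ for every $n$; \item $n_1/\sqrt n\to\rho_1\in[0,\infty)$; \item $n_2/n\to p_2\in[0,1)$; \item $\mathbb E[D_n]\to d<\infty$. \end{enumerate} Then \[ \lim_{n\to\infty}\mathbb P(\mathrm{CM}_n(\boldsymbol d)\text{ is connected})=\Big(\frac{d-2p_2}{d}\Big)^{1/2}\exp\Big\{-\frac{\rho_1^2}{2(d-2p_2)}\Big\}. \] Moreover, \[ n-|\mathscr C_{\max}|\ \xrightarrow{\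 d\ }\ X=\sum_{k\ge1}k\,(C_k+L_k), \] where the series converges almost surely and $(C_k)_{k\ge1},(L_k)_{k\ge1}$ are (jointly) independent random variables with \[ C_k\sim\mathsf{Poi}\Big(\frac{(2p_2)^k}{2k\,d^k}\Big)\ (k\ge1),\qquad L_1=0 \text{ a.s.},\qquad L_k\sim\mathsf{Poi}\Big(\frac{\rho_1^2(2p_2)^{k-2}}{2d^{k-1}}\Big)\ (k\ge2), \] with the convention $0^0=1$. Finally, \[ \lim_{n\to\infty}\mathbb E\big[n-|\mathscr C_{\max}|\big]=\frac{\rho_1^2(d-p_2)}{(d-2p_2)^2}+\frac{p_2}{d-2p_2}. \] -/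

import Mathlib

open MeasureTheory ProbabilityTheory Filter Topology

noncomputable section

namespace ConfigModel

/-- A degree sequence on the vertex set `Fin n`, with even total degree. -/
structure DegreeSeq (n : ℕ) where
  deg : Fin n → ℕ
  even_total : Even (∑ v, deg v)

namespace DegreeSeq

variable {n : ℕ} (d : DegreeSeq n)

/-- `n_i`, the number of vertices of degree `i`. -/
def numDeg (i : ℕ) : ℕ := (Finset.univ.filter fun v : Fin n => d.deg v = i).card

/-- The half-edges: vertex `v` carries `d_v` of them. -/
abbrev HalfEdge : Type := Σ v : Fin n, Fin (d.deg v)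

/-- A pairing of the half-edges, i.e. a fixed-point-free involution of the set of half-edges
(each half-edge is sent to its partner). -/
def Pairing : Type :=
  {σ : Equiv.Perm d.HalfEdge // (∀ h, σ (σ h) = h) ∧ ∀ h, σ h ≠ h}

instance : Fintype d.Pairing :=
  inferInstanceAs (Fintype {σ : Equiv.Perm d.HalfEdge // (∀ h, σ (σ h) = h) ∧ ∀ h, σ h ≠ h})

instance : MeasurableSpace d.Pairing := ⊤

instance : DiscreteMeasurableSpace d.Pairing := ⟨fun _ => trivial⟩

/-- Since the total degree is even, the half-edges can be paired. -/
instance : Nonempty d.Pairing := by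
  obtain ⟨m, hm⟩ := d.even_total
  have hc : Fintype.card d.HalfEdge = Fintype.card (Fin m ⊕ Fin m) := by simp [hm]
  let e := Fintype.equivOfCardEq hc
  refine ⟨⟨(e.trans (Equiv.sumComm _ _)).trans e.symm, fun h => ?_, fun h hh => ?_⟩⟩
  · simp
  · have h2 : (e h).swap = e h := by
      have := congrArg e hh
      simpa using this
    cases hx : e h <;> simp [hx] at h2

/-- The law of the configuration model: a uniformly random pairing of the half-edges. -/
def cmMeasure : Measure d.Pairing := (PMF.uniformOfFintype d.Pairing).toMeasure

instance : IsProbabilityMeasure d.cmMeasure :=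
  inferInstanceAs (IsProbabilityMeasure (PMF.uniformOfFintype d.Pairing).toMeasure)

variable {d}

/-- The graph structure obtained from a pairing: `u` and `v` are adjacent if a half-edge of `u` is
paired to a half-edge of `v`. Self-loops and edge multiplicities, which affect neither
connectivity nor the vertex sets of the components, are forgotten. -/
def Pairing.graph (σ : d.Pairing) : SimpleGraph (Fin n) :=
  SimpleGraph.fromRel fun u v => ∃ h : d.HalfEdge, h.1 = u ∧ (σ.1 h).1 = v

/-- `|C_max|`, the number of vertices of a largest connected component. -/
def Pairing.maxComponentSize (σ : d.Pairing) : ℕ :=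
  Finset.univ.sup fun v : Fin n => (σ.graph.connectedComponentMk v).supp.ncard

end DegreeSeq

/-- The uniform distribution on the vertex set of size `n ≥ 1`. -/
def uniformVertex (n : ℕ+) : Measure (Fin n) := (PMF.uniformOfFintype (Fin n)).toMeasure

instance (n : ℕ+) : IsProbabilityMeasure (uniformVertex n) :=
  inferInstanceAs (IsProbabilityMeasure (PMF.uniformOfFintype (Fin n)).toMeasure)

/-- The critical window for connectivity. The degree `D_n` of a uniform vertex is the random
variable `(d n).deg` on the probability space `(Fin n, uniformVertex n)`, and `μ` is the law of the
limiting degree variable `D`. -/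
structure CriticalWindow (d : (n : ℕ+) → DegreeSeq n) (ρ₁ p₂ dbar : ℝ) : Prop where
  degree_tendsto : ∃ μ : ProbabilityMeasure ℕ,
    TendstoInDistribution (fun n : ℕ+ => (d n).deg) atTop (id : ℕ → ℕ)
      (fun n => uniformVertex n) (μ : Measure ℕ)
  numDeg_zero : ∀ n, (d n).numDeg 0 = 0
  numDeg_one : Tendsto (fun n : ℕ+ => ((d n).numDeg 1 : ℝ) / √(n : ℝ)) atTop (𝓝 ρ₁)
  rho_nonneg : 0 ≤ ρ₁
  numDeg_two : Tendsto (fun n : ℕ+ => ((d n).numDeg 2 : ℝ) / (n : ℝ)) atTop (𝓝 p₂)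
  p_nonneg : 0 ≤ p₂
  p_lt_one : p₂ < 1
  mean_tendsto :
    Tendsto (fun n : ℕ+ => ∫ v, ((d n).deg v : ℝ) ∂(uniformVertex n)) atTop (𝓝 dbar)

/-- The limiting rate of the number of cycle components with `k ≥ 1` vertices. -/
def cycleRate (p₂ dbar : ℝ) (k : ℕ) : ℝ := (2 * p₂) ^ k / (2 * k * dbar ^ k)

/-- The limiting rate of the number of line components with `k ≥ 1` vertices. There are no lines
with a single vertex. -/
def lineRate (ρ₁ p₂ dbar : ℝ) (k : ℕ) : ℝ :=
  if k = 1 then 0 else ρ₁ ^ 2 * (2 * p₂) ^ (k - 2) / (2 * dbar ^ (k - 1))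

end ConfigModel

end

/-! The obstructions to connectivity are small components all of whose vertices have degree one or
two: cycles (no vertex of degree one) and lines (exactly two). Every other small component contains
a vertex of degree at least three, and such components disappear in the limit. The proof therefore
computes the limit law of the cycles and lines and bounds the expected size of everything else.

Cycles and lines. A component is treated as a minimal nonempty set of vertices closed under the
pairing. Marking one component and cutting it out leaves a uniform pairing of the remaining
half-edges, so the expected elementary symmetric functions of the component weights `g |A|` satisfy
an exact recursion (`total_succ`, `total_eq`) whose coefficients are the expected numbers of cycles
and lines of each size (`cycCoef`, `lineCoef`). Degrees above two enter only through their total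
`c`, which the recursion never changes. The coefficients decay geometrically, so the `r`-th function
is at most `B ^ r / r!` (`norm_eps_le`), and dominated convergence gives the limit `lcExponent ^ r /
r!` (`Regime.tendsto_eps`). Summing over `r` yields `E ∏ (1 + g |A|) → exp (lcExponent g)`, the
transform of independent Poisson counts. Taking `g = -1` gives the probability of having no cycle or
line, `g k = exp (i t k) - 1` the characteristic function, and `g k = k` with `r = 1` the mean.

Everything else. A set with `2 t` of the `2 m` half-edges is closed with probability at most `1 /
C(m, t)`. A generating-function bound on the number of such sets that contain a vertex of degree at
least three shows that their expected total size is `O(1 / √m)` (`exists_sum_heavySize_le`). A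
deterministic inequality (`abs_sub_lcSize_le`) then makes `n - |C_max|` agree in mean, up to `o(1)`,
with the number of vertices on cycles and lines, and all three claims transfer.

For the limit variable, summability of the Poisson rates makes almost surely only finitely many
counts nonzero. Its characteristic function (`charFun_map_tsum`) equals the limit above, and Lévy's
continuity theorem concludes. -/

noncomputable section

/-! ### Pairings of a finite set: splitting along a preserved subset, and counting. -/

namespace ConfigModel

/-- The pairings of the points of `α`: fixed-point-free involutions. -/
def Matching (α : Type*) : Type _ :=
  {σ : Equiv.Perm α // (∀ h, σ (σ h) = h) ∧ ∀ h, σ h ≠ h}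

/-- The number of pairings of `n` points. -/
def numMatch : ℕ → ℕ
  | 0 => 1
  | 1 => 0
  | n + 2 => (n + 1) * numMatch n

namespace Matching

variable {α : Type*}

instance [Finite α] : Finite (Matching α) :=
  inferInstanceAs (Finite {σ : Equiv.Perm α // (∀ h, σ (σ h) = h) ∧ ∀ h, σ h ≠ h})

instance [Finite α] : Fintype (Matching α) := Fintype.ofFinite _

@[ext] lemma ext {σ τ : Matching α} (h : ∀ a, σ.1 a = τ.1 a) : σ = τ :=
  Subtype.ext (Equiv.ext h)

/-- A set of points is preserved by a pairing. -/
def Preserves (σ : Matching α) (p : α → Prop) : Prop := ∀ a, p a → p (σ.1 a)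

lemma Preserves.iff {σ : Matching α} {p : α → Prop} (h : σ.Preserves p) (a : α) :
    p a ↔ p (σ.1 a) :=
  ⟨h a, fun ha => by simpa [σ.2.1] using h _ ha⟩

lemma Preserves.not {σ : Matching α} {p : α → Prop} (h : σ.Preserves p) :
    σ.Preserves fun a => ¬ p a := fun a ha hb => ha ((h.iff a).2 hb)

/-- The restriction of a pairing to a preserved set. -/
def restrict (σ : Matching α) (p : α → Prop) (h : σ.Preserves p) : Matching {a // p a} :=
  ⟨σ.1.subtypePerm fun a => (h.iff a).symm, fun a => by ext; simp [σ.2.1], fun a ha => by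
    have := congrArg Subtype.val ha
    simp only [Equiv.Perm.subtypePerm_apply] at this
    exact σ.2.2 _ this⟩

@[simp] lemma restrict_apply (σ : Matching α) (p : α → Prop) (h : σ.Preserves p) (a : {a // p a}) :
    (((σ.restrict p h).1 a : {a // p a}) : α) = σ.1 a := rfl

open scoped Classical in
/-- Two pairings of complementary sets give a pairing of everything. -/
def glue (p : α → Prop) (τ : Matching {a // p a}) (ρ : Matching {a // ¬ p a}) : Matching α :=
  ⟨Equiv.Perm.subtypeCongr τ.1 ρ.1, fun a => by
    by_cases ha : p a
    · rw [Equiv.Perm.subtypeCongr.left_apply _ _ ha, Equiv.Perm.subtypeCongr.left_apply _ _ (τ.1 _).2]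
      simp [τ.2.1]
    · rw [Equiv.Perm.subtypeCongr.right_apply _ _ ha,
        Equiv.Perm.subtypeCongr.right_apply _ _ (ρ.1 _).2]
      simp [ρ.2.1], fun a => by
    by_cases ha : p a
    · rw [Equiv.Perm.subtypeCongr.left_apply _ _ ha]
      intro h
      exact τ.2.2 ⟨a, ha⟩ (Subtype.ext h)
    · rw [Equiv.Perm.subtypeCongr.right_apply _ _ ha]
      intro h
      exact ρ.2.2 ⟨a, ha⟩ (Subtype.ext h)⟩

open scoped Classical in
lemma glue_left {p : α → Prop} (τ : Matching {a // p a}) (ρ : Matching {a // ¬ p a}) {a : α}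
    (ha : p a) : (glue p τ ρ).1 a = τ.1 ⟨a, ha⟩ :=
  Equiv.Perm.subtypeCongr.left_apply _ _ ha

open scoped Classical in
lemma glue_right {p : α → Prop} (τ : Matching {a // p a}) (ρ : Matching {a // ¬ p a}) {a : α}
    (ha : ¬ p a) : (glue p τ ρ).1 a = ρ.1 ⟨a, ha⟩ :=
  Equiv.Perm.subtypeCongr.right_apply _ _ ha

lemma glue_preserves (p : α → Prop) (τ : Matching {a // p a}) (ρ : Matching {a // ¬ p a}) :
    (glue p τ ρ).Preserves p := fun a ha => by
  rw [glue_left τ ρ ha]; exact (τ.1 _).2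

/-- Pairings that preserve a set are pairs of pairings of the set and of its complement. -/
def splitEquiv (p : α → Prop) :
    {σ : Matching α // σ.Preserves p} ≃ Matching {a // p a} × Matching {a // ¬ p a} where
  toFun σ := (σ.1.restrict p σ.2, σ.1.restrict _ σ.2.not)
  invFun x := ⟨glue p x.1 x.2, glue_preserves p x.1 x.2⟩
  left_inv σ := by
    apply Subtype.ext
    ext a
    by_cases ha : p a
    · simp [glue_left _ _ ha]
    · simp [glue_right _ _ ha]
  right_inv x := by
    refine Prod.ext ?_ ?_
    · ext a; simp [glue_left _ _ a.2]
    · ext a; simp [glue_right _ _ a.2]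

section card

variable [Finite α]

lemma card_of_isEmpty [IsEmpty α] : Fintype.card (Matching α) = 1 := by
  rw [Fintype.card_eq_one_iff]
  exact ⟨⟨1, fun h => isEmptyElim h, fun h => isEmptyElim h⟩, fun σ => by
    ext a; exact isEmptyElim a⟩

lemma card_pair (a b : α) (hab : a ≠ b) :
    Fintype.card (Matching {x : α // x = a ∨ x = b}) = 1 := by
  classical
  let a' : {x : α // x = a ∨ x = b} := ⟨a, Or.inl rfl⟩
  let b' : {x : α // x = a ∨ x = b} := ⟨b, Or.inr rfl⟩
  have hne : a' ≠ b' := fun h => hab (congrArg Subtype.val h)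
  have hall : ∀ x : {x : α // x = a ∨ x = b}, x = a' ∨ x = b' := by
    rintro ⟨x, rfl | rfl⟩
    · exact Or.inl rfl
    · exact Or.inr rfl
  rw [Fintype.card_eq_one_iff]
  refine ⟨⟨Equiv.swap a' b', fun h => by simp, fun h => ?_⟩, fun σ => ?_⟩
  · rcases hall h with rfl | rfl
    · simpa using hne.symm
    · simpa using hne
  · ext x
    congr 1
    rcases hall x with rfl | rfl
    · rcases hall (σ.1 a') with h | h
      · exact absurd h (σ.2.2 _)
      · simp [h]
    · rcases hall (σ.1 b') with h | h
      · simp [h]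
      · exact absurd h (σ.2.2 _)

open scoped Classical in
lemma card_preserves (p : α → Prop) :
    Fintype.card {σ : Matching α // σ.Preserves p} =
      Fintype.card (Matching {a // p a}) * Fintype.card (Matching {a // ¬ p a}) := by
  rw [Fintype.card_congr (splitEquiv p), Fintype.card_prod]

/-- The number of pairings depends only on the number of points. -/
theorem card_eq : ∀ (n : ℕ) (α : Type*) [Fintype α], Fintype.card α = n →
    Fintype.card (Matching α) = numMatch n := by
  intro n
  induction n using Nat.strong_induction_on with
  | _ n ih =>
  intro α _ hα
  classical
  match n, hα, ih with
  | 0, hα, _ =>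
    have := Fintype.card_eq_zero_iff.1 hα
    exact card_of_isEmpty
  | 1, hα, _ =>
    obtain ⟨a, ha⟩ := Fintype.card_eq_one_iff.1 hα
    rw [numMatch, Fintype.card_eq_zero_iff]
    exact ⟨fun σ => σ.2.2 a (ha _)⟩
  | n + 2, hα, ih =>
    obtain ⟨a⟩ : Nonempty α := Fintype.card_pos_iff.1 (by omega)
    -- Classify pairings by the partner of a fixed point `a`: there are `n + 1` partners, each
    -- leaving `n` points to pair.
    have h1 : Fintype.card (Matching α) =
        ∑ b ∈ Finset.univ.erase a, Fintype.card {σ : Matching α // σ.1 a = b} := by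
      rw [← Finset.card_univ, Finset.card_eq_sum_card_fiberwise (f := fun σ : Matching α => σ.1 a)
        (s := Finset.univ) (t := Finset.univ.erase a) fun σ _ => by simpa using σ.2.2 a]
      exact Finset.sum_congr rfl fun b _ => (Fintype.card_subtype _).symm
    rw [h1, Finset.sum_congr rfl (g := fun _ => numMatch n)]
    · rw [Finset.sum_const, Finset.card_erase_of_mem (Finset.mem_univ _), Finset.card_univ, hα,
        smul_eq_mul, numMatch]
      rfl
    · intro b hb
      have hab : a ≠ b := fun h => by simp [h] at hb
      -- Having `b` as partner of `a` is the same as preserving `{a, b}`, so the splitting into a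
      -- pairing inside and one outside applies.
      have h2 : ∀ σ : Matching α, σ.1 a = b ↔ σ.Preserves fun x => x = a ∨ x = b := by
        intro σ
        constructor
        · rintro rfl x (rfl | rfl)
          · exact Or.inr rfl
          · exact Or.inl (σ.2.1 _)
        · intro h
          rcases h a (Or.inl rfl) with h | h
          · exact absurd h (σ.2.2 _)
          · exact h
      rw [Fintype.card_congr (Equiv.subtypeEquivRight h2), card_preserves, card_pair a b hab, one_mul]
      apply ih n (by omega)
      rw [Fintype.card_subtype_compl, hα, Fintype.card_subtype]
      have : (Finset.univ.filter fun x => x = a ∨ x = b) = {a, b} := by ext; simp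
      rw [this, Finset.card_pair hab]
      rfl

lemma card_eq_numMatch [Fintype α] : Fintype.card (Matching α) = numMatch (Fintype.card α) :=
  card_eq _ α rfl

end card

end Matching

lemma numMatch_odd (n : ℕ) : numMatch (2 * n + 1) = 0 := by
  induction n with
  | zero => rfl
  | succ n ih => rw [show 2 * (n + 1) + 1 = (2 * n + 1) + 2 by ring, numMatch, ih, mul_zero]

lemma numMatch_even_succ (n : ℕ) : numMatch (2 * (n + 1)) = (2 * n + 1) * numMatch (2 * n) := rfl

lemma numMatch_even_pos (n : ℕ) : 0 < numMatch (2 * n) := by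
  induction n with
  | zero => exact one_pos
  | succ n ih => rw [numMatch_even_succ]; positivity

lemma numMatch_even_mul (n : ℕ) : numMatch (2 * n) * (2 ^ n * n.factorial) = (2 * n).factorial := by
  induction n with
  | zero => rfl
  | succ n ih =>
    rw [numMatch_even_succ, show 2 * (n + 1) = 2 * n + 1 + 1 by ring, Nat.factorial_succ (2 * n + 1),
      Nat.factorial_succ (2 * n), Nat.factorial_succ n, ← ih]
    ring

end ConfigModel
end

/-! ### Components as minimal stable sets, and the recursion obtained by cutting one out. -/

noncomputable section

namespace ConfigModel

namespace Matching

variable {α V : Type*}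

/-- A set of vertices is stable if no half-edge in it is paired to a half-edge outside. -/
def Stable (σ : Matching α) (f : α → V) (A : Finset V) : Prop := σ.Preserves fun a => f a ∈ A

/-- The minimal nonempty stable sets are the connected components. -/
structure IsComp (σ : Matching α) (f : α → V) (A : Finset V) : Prop where
  nonempty : A.Nonempty
  stable : σ.Stable f A
  minimal : ∀ B ⊆ A, B.Nonempty → σ.Stable f B → B = A

/-- Being a component depends only on which subsets of `A` are stable. This moves components between
a pairing and its restrictions, although these live on different half-edge types. -/
lemma IsComp.congr_of_stable_iff {β : Type*} {σ : Matching α} {τ : Matching β} {f : α → V}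
    {g : β → V} {A : Finset V} (h : ∀ B ⊆ A, σ.Stable f B ↔ τ.Stable g B) :
    σ.IsComp f A ↔ τ.IsComp g A :=
  ⟨fun hA => ⟨hA.1, (h A subset_rfl).1 hA.2, fun B hB hn hs => hA.3 B hB hn ((h B hB).2 hs)⟩,
    fun hA => ⟨hA.1, (h A subset_rfl).2 hA.2, fun B hB hn hs => hA.3 B hB hn ((h B hB).1 hs)⟩⟩

lemma Stable.inter [DecidableEq V] {σ : Matching α} {f : α → V} {A B : Finset V}
    (hA : σ.Stable f A) (hB : σ.Stable f B) : σ.Stable f (A ∩ B) := fun a ha => by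
  exact Finset.mem_inter.2 ⟨hA a (Finset.mem_inter.1 ha).1, hB a (Finset.mem_inter.1 ha).2⟩

lemma IsComp.eq_of_mem {σ : Matching α} {f : α → V} {A B : Finset V} (hA : σ.IsComp f A)
    (hB : σ.IsComp f B) {v : V} (hvA : v ∈ A) (hvB : v ∈ B) : A = B := by
  classical
  have hn : (A ∩ B).Nonempty := ⟨v, Finset.mem_inter.2 ⟨hvA, hvB⟩⟩
  exact (hA.3 _ Finset.inter_subset_left hn (hA.2.inter hB.2)).symm.trans
    (hB.3 _ Finset.inter_subset_right hn (hA.2.inter hB.2))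

lemma IsComp.disjoint {σ : Matching α} {f : α → V} {A B : Finset V} (hA : σ.IsComp f A)
    (hB : σ.IsComp f B) (h : A ≠ B) : Disjoint A B :=
  Finset.disjoint_left.2 fun _ h1 h2 => h (hA.eq_of_mem hB h1 h2)

lemma stable_restrict_iff {σ : Matching α} {f : α → V} {A B : Finset V} (h : σ.Stable f A)
    (hB : B ⊆ A) : (σ.restrict _ h).Stable (fun a => f a) B ↔ σ.Stable f B :=
  ⟨fun hs a ha => hs ⟨a, hB ha⟩ ha, fun hs a ha => hs a.1 ha⟩

lemma stable_restrict_not_iff {σ : Matching α} {f : α → V} {A B : Finset V} (h : σ.Stable f A)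
    (hB : Disjoint B A) :
    (σ.restrict _ h.not).Stable (fun a => f a) B ↔ σ.Stable f B :=
  ⟨fun hs a ha => hs ⟨a, Finset.disjoint_left.1 hB ha⟩ ha, fun hs a ha => hs a.1 ha⟩

lemma isComp_restrict_iff {σ : Matching α} {f : α → V} {A B : Finset V} (h : σ.Stable f A)
    (hB : B ⊆ A) : (σ.restrict _ h).IsComp (fun a => f a) B ↔ σ.IsComp f B :=
  IsComp.congr_of_stable_iff fun _ hC => stable_restrict_iff h (hC.trans hB)

lemma isComp_restrict_not_iff {σ : Matching α} {f : α → V} {A B : Finset V} (h : σ.Stable f A)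
    (hB : Disjoint B A) :
    (σ.restrict _ h.not).IsComp (fun a => f a) B ↔ σ.IsComp f B :=
  IsComp.congr_of_stable_iff fun _ hC =>
    stable_restrict_not_iff h (Finset.disjoint_of_subset_left hC hB)

end Matching

open Matching

variable {α V : Type*}

/-- The number of half-edges at a vertex. -/
def vdeg (f : α → V) (v : V) : ℕ := Nat.card {a // f a = v}

/-- The number of half-edges at a set of vertices. -/
def tdeg (f : α → V) (A : Finset V) : ℕ := Nat.card {a // f a ∈ A}

lemma tdeg_eq_sum [Finite α] (f : α → V) (A : Finset V) : tdeg f A = ∑ v ∈ A, vdeg f v := by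
  classical
  have := Fintype.ofFinite α
  simp only [tdeg, vdeg, Nat.card_eq_fintype_card, Fintype.card_subtype]
  rw [Finset.card_eq_sum_card_fiberwise (f := f) (t := A) (fun a ha => by simpa using ha)]
  refine Finset.sum_congr rfl fun v hv => ?_
  rw [Finset.filter_filter]
  congr 1
  ext a
  simp only [Finset.mem_filter, Finset.mem_univ, true_and, and_iff_right_iff_imp]
  rintro rfl; exact hv

lemma tdeg_univ [Finite α] [Fintype V] (f : α → V) : tdeg f Finset.univ = Nat.card α := by
  simp only [tdeg, Finset.mem_univ]
  exact Nat.card_congr (Equiv.subtypeUnivEquiv fun _ => trivial)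

lemma card_not_mem [Finite α] (f : α → V) (A : Finset V) :
    Nat.card {a // ¬ f a ∈ A} = Nat.card α - tdeg f A := by
  classical
  have := Fintype.ofFinite α
  simp only [tdeg, Nat.card_eq_fintype_card]
  exact Fintype.card_subtype_compl _

lemma tdeg_le [Finite α] (f : α → V) (A : Finset V) : tdeg f A ≤ Nat.card α :=
  Finite.card_subtype_le _

lemma vdeg_not_mem (f : α → V) {A : Finset V} {v : V} (hv : v ∉ A) :
    vdeg (fun a : {a // ¬ f a ∈ A} => f a) v = vdeg f v :=
  Nat.card_congr ⟨fun a => ⟨a.1.1, a.2⟩, fun a => ⟨⟨a.1, fun h => hv (a.2 ▸ h)⟩, a.2⟩,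
    fun _ => rfl, fun _ => rfl⟩

lemma vdeg_of_mem (f : α → V) {A : Finset V} {v : V} (hv : v ∈ A) :
    vdeg (fun a : {a // ¬ f a ∈ A} => f a) v = 0 := by
  have : IsEmpty {a : {a // ¬ f a ∈ A} // f a = v} := ⟨fun a => a.1.2 (by rw [show f a.1 = v from a.2]; exact hv)⟩
  exact Nat.card_of_isEmpty

lemma vdeg_mem (f : α → V) {A : Finset V} {v : V} (hv : v ∈ A) :
    vdeg (fun a : {a // f a ∈ A} => f a) v = vdeg f v :=
  Nat.card_congr ⟨fun a => ⟨a.1.1, a.2⟩, fun a => ⟨⟨a.1, by rw [a.2]; exact hv⟩, a.2⟩,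
    fun _ => rfl, fun _ => rfl⟩

lemma card_stable [Finite α] (f : α → V) (A : Finset V) :
    Nat.card {σ : Matching α // σ.Stable f A} =
      numMatch (tdeg f A) * numMatch (Nat.card α - tdeg f A) := by
  classical
  have := Fintype.ofFinite α
  unfold Stable
  rw [Nat.card_congr (splitEquiv fun a => f a ∈ A), Nat.card_prod, Nat.card_eq_fintype_card,
    Nat.card_eq_fintype_card, card_eq_numMatch, card_eq_numMatch, ← card_not_mem]
  simp [tdeg]

/-- The `r`-th elementary symmetric function of the weights of the components in `S`. -/
def esum (g : ℕ → ℂ) (S : Finset (Finset V)) (r : ℕ) : ℂ :=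
  ∑ T ∈ S.powersetCard r, ∏ A ∈ T, g A.card

/-- Double counting of pairs `A ∈ T` with `|T| = r + 1`: erase the marked `A` from `T`. The marked
component is the one that will be cut out of the graph. -/
lemma esum_succ [DecidableEq V] (g : ℕ → ℂ) (S : Finset (Finset V)) (r : ℕ) :
    (r + 1) * esum g S (r + 1) = ∑ A ∈ S, g A.card * esum g (S.erase A) r := by
  have h1 : (r + 1) * esum g S (r + 1) = ∑ T ∈ S.powersetCard (r + 1), ∑ A ∈ T,
      g A.card * ∏ B ∈ T.erase A, g B.card := by
    rw [esum, Finset.mul_sum]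
    refine Finset.sum_congr rfl fun T hT => ?_
    rw [Finset.sum_congr rfl fun A hA => Finset.mul_prod_erase T (fun B => g B.card) hA,
      Finset.sum_const, (Finset.mem_powersetCard.1 hT).2, nsmul_eq_mul]
    push_cast; rfl
  simp only [esum] at h1 ⊢
  rw [h1]
  simp only [Finset.mul_sum]
  rw [Finset.sum_sigma', Finset.sum_sigma']
  refine Finset.sum_bij' (fun x _ => ⟨x.2, x.1.erase x.2⟩) (fun x _ => ⟨insert x.1 x.2, x.1⟩)
    ?_ ?_ ?_ ?_ ?_
  · rintro ⟨T, A⟩ h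
    simp only [Finset.mem_sigma, Finset.mem_powersetCard] at h ⊢
    refine ⟨h.1.1 h.2, Finset.erase_subset_erase _ h.1.1, ?_⟩
    rw [Finset.card_erase_of_mem h.2, h.1.2]; rfl
  · rintro ⟨A, T⟩ h
    simp only [Finset.mem_sigma, Finset.mem_powersetCard, Finset.subset_erase] at h ⊢
    refine ⟨⟨Finset.insert_subset h.1 h.2.1.1, ?_⟩, Finset.mem_insert_self _ _⟩
    rw [Finset.card_insert_of_notMem h.2.1.2, h.2.2]
  · rintro ⟨T, A⟩ h
    simp only [Finset.mem_sigma] at h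
    simp [Finset.insert_erase h.2]
  · rintro ⟨A, T⟩ h
    simp only [Finset.mem_sigma, Finset.mem_powersetCard, Finset.subset_erase] at h
    simp [Finset.erase_insert h.2.1.2]
  · rintro ⟨T, A⟩ h
    rfl

lemma prod_one_add_eq_sum_esum (g : ℕ → ℂ) (S : Finset (Finset V)) :
    ∏ A ∈ S, (1 + g A.card) = ∑ r ∈ Finset.range (S.card + 1), esum g S r := by
  rw [Finset.prod_one_add, Finset.sum_powerset]
  rfl

lemma esum_eq_zero (g : ℕ → ℂ) {S : Finset (Finset V)} {r : ℕ} (h : S.card < r) :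
    esum g S r = 0 := by
  rw [esum, Finset.powersetCard_eq_empty.2 h, Finset.sum_empty]

open scoped Classical in
lemma sum_eq_sum_split [Finite α] {M : Type*} [AddCommMonoid M] (f : α → V) (A : Finset V)
    (F : Matching α → M)
    (hF : ∀ σ, ¬ σ.Stable f A → F σ = 0) :
    ∑ σ, F σ = ∑ τ : Matching {a // f a ∈ A}, ∑ ρ : Matching {a // ¬ f a ∈ A},
      F (glue (fun a => f a ∈ A) τ ρ) := by
  rw [← Fintype.sum_prod_type', ← (splitEquiv fun a => f a ∈ A).sum_comp]
  rw [← Finset.sum_filter_of_ne (p := fun σ : Matching α => σ.Preserves fun a => f a ∈ A)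
    fun σ _ h => by_contra fun h' => h (hF σ h')]
  rw [← Finset.sum_subtype_eq_sum_filter]
  refine Finset.sum_bij' (fun x _ => x) (fun x _ => x) ?_ ?_ ?_ ?_ ?_ <;> try simp
  intro σ hσ
  exact congrArg F
    (congrArg Subtype.val ((splitEquiv fun a => f a ∈ A).symm_apply_apply ⟨σ, hσ⟩)).symm

section low

variable [Fintype V]

/-- The vertices of degree one. -/
def ones (f : α → V) : Finset V := Finset.univ.filter fun v => vdeg f v = 1

/-- The vertices of degree two. -/
def twos (f : α → V) : Finset V := Finset.univ.filter fun v => vdeg f v = 2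

/-- The vertices of degree one or two. -/
def low (f : α → V) : Finset V := Finset.univ.filter fun v => vdeg f v = 1 ∨ vdeg f v = 2

@[simp] lemma mem_ones {f : α → V} {v : V} : v ∈ ones f ↔ vdeg f v = 1 := by simp [ones]
@[simp] lemma mem_twos {f : α → V} {v : V} : v ∈ twos f ↔ vdeg f v = 2 := by simp [twos]
@[simp] lemma mem_low {f : α → V} {v : V} : v ∈ low f ↔ vdeg f v = 1 ∨ vdeg f v = 2 := by
  simp [low]

open scoped Classical in
/-- The components all of whose vertices have degree one or two: lines and cycles. -/
def lc (σ : Matching α) (f : α → V) : Finset (Finset V) :=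
  (low f).powerset.filter fun A => σ.IsComp f A

lemma mem_lc {σ : Matching α} {f : α → V} {A : Finset V} :
    A ∈ lc σ f ↔ A ⊆ low f ∧ σ.IsComp f A := by
  simp [lc]

/-- The number of pairings inside a vertex set that make it connected. -/
def conn (f : α → V) (A : Finset V) : ℕ :=
  Nat.card {τ : Matching {a // f a ∈ A} // τ.IsComp (fun a => f a) A}

variable [DecidableEq V]

lemma ones_not_mem (f : α → V) (A : Finset V) :
    ones (fun a : {a // ¬ f a ∈ A} => f a) = ones f \ A := by
  ext v
  by_cases hv : v ∈ A
  · simp [vdeg_of_mem f hv, hv]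
  · simp [vdeg_not_mem f hv, hv]

lemma twos_not_mem (f : α → V) (A : Finset V) :
    twos (fun a : {a // ¬ f a ∈ A} => f a) = twos f \ A := by
  ext v
  by_cases hv : v ∈ A
  · simp [vdeg_of_mem f hv, hv]
  · simp [vdeg_not_mem f hv, hv]

lemma low_not_mem (f : α → V) (A : Finset V) :
    low (fun a : {a // ¬ f a ∈ A} => f a) = low f \ A := by
  ext v
  by_cases hv : v ∈ A
  · simp [vdeg_of_mem f hv, hv]
  · simp [vdeg_not_mem f hv, hv]

/-- Cutting out `A` removes its half-edges but keeps the vertex type. The vertices of `A` then have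
degree zero, so they are no longer low, while the other components are disjoint from `A` and
unaffected. -/
lemma lc_restrict_not {σ : Matching α} {f : α → V} {A : Finset V} (h : σ.IsComp f A) :
    lc (σ.restrict _ h.stable.not) (fun a => f a) = (lc σ f).erase A := by
  ext B
  rw [mem_lc, Finset.mem_erase, mem_lc, low_not_mem, Finset.subset_sdiff]
  constructor
  · rintro ⟨⟨h1, h2⟩, h3⟩
    refine ⟨?_, h1, (isComp_restrict_not_iff h.stable h2).1 h3⟩
    rintro rfl
    exact h.nonempty.ne_empty (disjoint_self.1 h2)
  · rintro ⟨h1, h2, h3⟩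
    have hd := h3.disjoint h h1
    exact ⟨⟨h2, hd⟩, (isComp_restrict_not_iff h.stable hd).2 h3⟩

/-- The sum over all pairings of the `r`-th elementary symmetric function of the weights of the
line and cycle components. -/
def total [Finite α] (g : ℕ → ℂ) (f : α → V) (r : ℕ) : ℂ := ∑ σ : Matching α, esum g (lc σ f) r

/-- Mark a component by `esum_succ` and exchange the sums. A pairing with component `A` is a
connected pairing inside `A` together with an arbitrary pairing outside, and by `lc_restrict_not`
the outside pairing carries exactly the unmarked components. -/
theorem total_succ [Finite α] (g : ℕ → ℂ) (f : α → V) (r : ℕ) :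
    (r + 1) * total g f (r + 1) = ∑ A ∈ (low f).powerset,
      g A.card * conn f A * total g (fun a : {a // ¬ f a ∈ A} => f a) r := by
  classical
  simp only [total, Finset.mul_sum (s := Finset.univ), esum_succ]
  simp only [lc, Finset.sum_filter]
  rw [Finset.sum_comm]
  refine Finset.sum_congr rfl fun A hA => ?_
  rw [sum_eq_sum_split f A _ fun σ hσ => if_neg fun h => hσ h.stable]
  have key : ∀ (τ : Matching {a // f a ∈ A}) (ρ : Matching {a // ¬ f a ∈ A}),
      (if (glue (fun a => f a ∈ A) τ ρ).IsComp f A then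
        g A.card * esum g (((low f).powerset.filter fun B =>
          (glue (fun a => f a ∈ A) τ ρ).IsComp f B).erase A) r else 0) =
      if τ.IsComp (fun a => f a) A then g A.card * esum g (lc ρ fun a => f a) r else 0 := by
    intro τ ρ
    have hs : (glue (fun a => f a ∈ A) τ ρ).Stable f A := glue_preserves _ τ ρ
    have h1 := (splitEquiv fun a => f a ∈ A).apply_symm_apply (τ, ρ)
    have h2 : (glue (fun a => f a ∈ A) τ ρ).restrict _ hs = τ := congrArg Prod.fst h1
    have h3 : (glue (fun a => f a ∈ A) τ ρ).restrict _ hs.not = ρ := congrArg Prod.snd h1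
    have h4 := isComp_restrict_iff hs (subset_refl A)
    rw [h2] at h4
    rw [if_congr h4 rfl rfl]
    split_ifs with h
    · have h5 := lc_restrict_not h
      rw [h3] at h5
      rw [h5]
      rfl
    · rfl
  simp only [key]
  have : ∀ τ : Matching {a // f a ∈ A}, (∑ ρ : Matching {a // ¬ f a ∈ A},
      if τ.IsComp (fun a => f a) A then g A.card * esum g (lc ρ fun a => f a) r else 0) =
      if τ.IsComp (fun a => f a) A then
        ∑ ρ : Matching {a // ¬ f a ∈ A}, g A.card * esum g (lc ρ fun a => f a) r else 0 := by
    intro τ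
    split_ifs <;> simp
  simp only [this]
  rw [← Finset.sum_filter, Finset.sum_const, conn, Nat.card_eq_fintype_card, Fintype.card_subtype,
    nsmul_eq_mul, ← Finset.mul_sum, ← Finset.mul_sum]
  simp only [lc]
  ring

end low

end ConfigModel
end

/-! ### Counting connected pairings on vertices of degree one and two. -/

noncomputable section

namespace ConfigModel

open Matching

variable {α V : Type*}

namespace Matching

lemma Stable.sdiff [DecidableEq V] {σ : Matching α} {f : α → V} {A B : Finset V}
    (hA : σ.Stable f A) (hB : σ.Stable f B) : σ.Stable f (A \ B) := fun a ha =>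
  Finset.mem_sdiff.2 ⟨hA a (Finset.mem_sdiff.1 ha).1,
    fun h => (Finset.mem_sdiff.1 ha).2 ((Preserves.iff hB a).2 h)⟩

/-- Every vertex of a stable set lies in a component contained in that set. -/
lemma exists_isComp_mem {σ : Matching α} {f : α → V} {A : Finset V} (hA : σ.Stable f A) {v : V}
    (hv : v ∈ A) : ∃ B ⊆ A, v ∈ B ∧ σ.IsComp f B := by
  classical
  induction A using Finset.strongInduction with
  | H A ih =>
    by_cases h : σ.IsComp f A
    · exact ⟨A, subset_rfl, hv, h⟩
    · obtain ⟨B, hBA, hBn, hBs, hne⟩ : ∃ B ⊆ A, B.Nonempty ∧ σ.Stable f B ∧ B ≠ A := by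
        by_contra! h'
        exact h ⟨⟨v, hv⟩, hA, h'⟩
      by_cases hvB : v ∈ B
      · obtain ⟨C, hC, h2⟩ := ih B (hBA.ssubset_of_ne hne) hBs hvB
        exact ⟨C, hC.trans hBA, h2⟩
      · obtain ⟨C, hC, h2⟩ := ih (A \ B) (Finset.sdiff_ssubset hBA hBn) (hA.sdiff hBs)
          (Finset.mem_sdiff.2 ⟨hv, hvB⟩)
        exact ⟨C, hC.trans Finset.sdiff_subset, h2⟩

end Matching

section

variable [Finite α]

lemma card_isComp (f : α → V) (A : Finset V) :
    Nat.card {σ : Matching α // σ.IsComp f A} =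
      conn f A * numMatch (Nat.card α - tdeg f A) := by
  classical
  have h1 := sum_eq_sum_split f A (fun σ => if σ.IsComp f A then 1 else 0)
    fun σ hσ => if_neg fun h => hσ h.stable
  have h2 : ∀ (τ : Matching {a // f a ∈ A}) (ρ : Matching {a // ¬ f a ∈ A}),
      (if (glue (fun a => f a ∈ A) τ ρ).IsComp f A then 1 else 0) =
      if τ.IsComp (fun a => f a) A then 1 else 0 := by
    intro τ ρ
    have hs : (glue (fun a => f a ∈ A) τ ρ).Stable f A := glue_preserves _ τ ρ
    have h1 := (splitEquiv fun a => f a ∈ A).apply_symm_apply (τ, ρ)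
    have h2 : (glue (fun a => f a ∈ A) τ ρ).restrict _ hs = τ := congrArg Prod.fst h1
    have h4 := isComp_restrict_iff hs (subset_refl A)
    rw [h2] at h4
    rw [if_congr h4 rfl rfl]
  simp only [h2, Finset.sum_const, ← Finset.smul_sum] at h1
  rw [← Finset.card_filter, ← Finset.card_filter, ← Fintype.card_subtype,
    ← Fintype.card_subtype] at h1
  have := Fintype.ofFinite α
  rw [Nat.card_eq_fintype_card, h1, conn, Nat.card_eq_fintype_card, Finset.card_univ,
    card_eq_numMatch, ← card_not_mem, Nat.card_eq_fintype_card, smul_eq_mul, mul_comm]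

/-- Each pairing has exactly one component through `v`. The summand `B = A` counts the connected
pairings, so the identity determines that count from those of smaller sets. -/
lemma numMatch_eq_sum_isComp (f : α → V) (A : Finset V) (hA : ∀ a, f a ∈ A) {v : V} (hv : v ∈ A) :
    letI := Classical.decEq V
    numMatch (Nat.card α) =
      ∑ B ∈ A.powerset with v ∈ B, Nat.card {σ : Matching α // σ.IsComp f B} := by
  classical
  have := Fintype.ofFinite α
  rw [Nat.card_eq_fintype_card, ← card_eq_numMatch, ← Finset.card_univ]
  have hs : ∀ σ : Matching α, σ.Stable f A := fun σ a _ => hA _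
  have : ∀ σ : Matching α, ∃ B, B ⊆ A ∧ v ∈ B ∧ σ.IsComp f B := fun σ => exists_isComp_mem (hs σ) hv
  choose C hC1 hC2 hC3 using this
  rw [Finset.card_eq_sum_card_fiberwise (f := C) (t := A.powerset.filter fun B => v ∈ B)
    fun σ _ => by simp [hC1 σ, hC2 σ]]
  refine Finset.sum_congr (by congr) fun B hB => ?_
  rw [Nat.card_eq_fintype_card, Fintype.card_subtype]
  congr 1
  ext σ
  simp only [Finset.mem_filter, Finset.mem_univ, true_and]
  constructor
  · rintro rfl; exact hC3 σ
  · intro h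
    exact (hC3 σ).eq_of_mem h (hC2 σ) (Finset.mem_filter.1 hB).2

end

/-- The number of connected pairings on `a` vertices of degree one and `b` of degree two. -/
def connCount (a b : ℕ) : ℕ :=
  if a = 0 then (if b = 0 then 0 else 2 ^ (b - 1) * (b - 1).factorial)
  else if a = 2 then 2 ^ b * b.factorial else 0

/-- Explore the line starting at one of `a + 2` vertices of degree one: it has `a + 1` possible far
ends and `j` interior vertices out of `K`, in any order and orientation (`2 ^ j * j!`). The proof is
by induction on `K`: the terms `j ≥ 1` reproduce the sum for `K` with a factor `2 (K + 1)`. -/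
lemma sum_choose_numMatch (a K : ℕ) :
    (a + 1) * ∑ j ∈ Finset.range (K + 1),
      K.choose j * (2 ^ j * j.factorial * numMatch (a + 2 * (K - j))) = numMatch (a + 2 + 2 * K) := by
  induction K with
  | zero => simp [numMatch]
  | succ K ih =>
    rw [Finset.sum_range_succ']
    have : ∀ j ∈ Finset.range (K + 1), (K + 1).choose (j + 1) *
        (2 ^ (j + 1) * (j + 1).factorial * numMatch (a + 2 * (K + 1 - (j + 1)))) =
        2 * (K + 1) * (K.choose j * (2 ^ j * j.factorial * numMatch (a + 2 * (K - j)))) := by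
      intro j _
      have h := Nat.add_one_mul_choose_eq K j
      rw [Nat.factorial_succ, Nat.add_sub_add_right]
      calc _ = (K + 1).choose (j + 1) * (j + 1) *
            (2 ^ (j + 1) * j.factorial * numMatch (a + 2 * (K - j))) := by ring
        _ = _ := by rw [← h]; ring
    rw [Finset.sum_congr rfl this, ← Finset.mul_sum, mul_add,
      show (a + 1) * (2 * (K + 1) * ∑ j ∈ Finset.range (K + 1),
      K.choose j * (2 ^ j * j.factorial * numMatch (a + 2 * (K - j)))) = 2 * (K + 1) * ((a + 1) *
      ∑ j ∈ Finset.range (K + 1),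
      K.choose j * (2 ^ j * j.factorial * numMatch (a + 2 * (K - j)))) by ring, ih,
      show a + 2 + 2 * (K + 1) = (a + 2 + 2 * K) + 2 by ring, numMatch]
    simp only [Nat.choose_zero_right, pow_zero, Nat.factorial_zero, mul_one, one_mul, Nat.sub_zero]
    rw [show a + 2 * (K + 1) = a + 2 + 2 * K by ring]
    ring

lemma sum_powerset_union [DecidableEq V] {M : Type*} [AddCommMonoid M] {S T : Finset V}
    (hST : Disjoint S T) (h : Finset V → M) (G : ℕ → ℕ → M)
    (hG : ∀ B ⊆ S ∪ T, h B = G (B ∩ S).card (B ∩ T).card) :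
    ∑ B ∈ (S ∪ T).powerset, h B = ∑ i ∈ Finset.range (S.card + 1), S.card.choose i •
      ∑ j ∈ Finset.range (T.card + 1), T.card.choose j • G i j := by
  have h1 : ∑ B ∈ (S ∪ T).powerset, h B =
      ∑ x ∈ S.powerset ×ˢ T.powerset, G x.1.card x.2.card := by
    refine Finset.sum_bij' (fun B _ => (B ∩ S, B ∩ T)) (fun x _ => x.1 ∪ x.2) ?_ ?_ ?_ ?_ ?_
    · intro B _
      simp
    · rintro ⟨x, y⟩ hx
      simp only [Finset.mem_product, Finset.mem_powerset] at hx ⊢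
      exact Finset.union_subset_union hx.1 hx.2
    · intro B hB
      simp only [Finset.mem_powerset] at hB
      rw [← Finset.inter_union_distrib_left, Finset.inter_eq_left.2 hB]
    · rintro ⟨x, y⟩ hx
      simp only [Finset.mem_product, Finset.mem_powerset] at hx
      have h1 : Disjoint y S := Finset.disjoint_of_subset_left hx.2 hST.symm
      have h2 : Disjoint x T := Finset.disjoint_of_subset_left hx.1 hST
      rw [Finset.disjoint_iff_inter_eq_empty] at h1 h2
      simp only [Finset.union_inter_distrib_right, h1, h2, Finset.inter_eq_left.2 hx.1,
        Finset.inter_eq_left.2 hx.2, Finset.union_empty, Finset.empty_union]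
    · intro B hB
      exact hG B (Finset.mem_powerset.1 hB)
  rw [h1, Finset.sum_product, ← Finset.sum_powerset_apply_card fun i =>
    ∑ j ∈ Finset.range (T.card + 1), T.card.choose j • G i j]
  refine Finset.sum_congr rfl fun x _ => ?_
  rw [← Finset.sum_powerset_apply_card fun j => G x.card j]

/-- The number of vertices of degree `i` in a set. -/
def cnt (f : α → V) (i : ℕ) (A : Finset V) : ℕ := (A.filter fun v => vdeg f v = i).card

lemma tdeg_eq_cnt [Finite α] {f : α → V} {A : Finset V}
    (hA : ∀ v ∈ A, vdeg f v = 1 ∨ vdeg f v = 2) : tdeg f A = cnt f 1 A + 2 * cnt f 2 A := by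
  rw [tdeg_eq_sum, cnt, cnt, Finset.card_filter, Finset.card_filter, Finset.mul_sum,
    ← Finset.sum_add_distrib]
  refine Finset.sum_congr rfl fun v hv => ?_
  rcases hA v hv with h | h <;> simp [h]

lemma card_eq_cnt {f : α → V} {A : Finset V}
    (hA : ∀ v ∈ A, vdeg f v = 1 ∨ vdeg f v = 2) : A.card = cnt f 1 A + cnt f 2 A := by
  rw [cnt, cnt, Finset.card_filter, Finset.card_filter, ← Finset.sum_add_distrib,
    Finset.card_eq_sum_ones]
  refine Finset.sum_congr rfl fun v hv => ?_
  rcases hA v hv with h | h <;> simp [h]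

/-- The component of a vertex of degree one is a line with exactly one other end, so only `i = 1`
contributes. If there is no other end, the number of half-edges is odd and both sides vanish. -/
lemma sum_connCount (a b : ℕ) : ∑ i ∈ Finset.range (a + 1), a.choose i •
    ∑ j ∈ Finset.range (b + 1), b.choose j •
      (connCount (i + 1) j * numMatch (a + 1 + 2 * b - (i + 1 + 2 * j))) =
    numMatch (a + 1 + 2 * b) := by
  rcases a with _ | a
  · rw [show 0 + 1 + 2 * b = 2 * b + 1 by ring, numMatch_odd]
    simp [connCount]
  · rw [Finset.sum_eq_single 1]
    · rw [← show a + 2 + 2 * b = a + 1 + 1 + 2 * b by ring, ← sum_choose_numMatch]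
      simp only [Nat.choose_one_right, smul_eq_mul]
      congr 1
      refine Finset.sum_congr rfl fun j hj => ?_
      have : j ≤ b := by simpa [Nat.lt_succ_iff] using hj
      rw [show a + 2 + 2 * b - (1 + 1 + 2 * j) = a + 2 * (b - j) by omega]
      simp [connCount]
    · intro i _ hi
      simp [connCount, hi]
    · intro h
      simp at h

/-- Cutting a cycle open at the distinguished vertex turns it into a line between two fixed ends,
whence the case `a = 0` of `sum_choose_numMatch`. -/
lemma sum_connCount_zero (b : ℕ) : ∑ j ∈ Finset.range (b + 1), b.choose j •
      (connCount 0 (j + 1) * numMatch (2 * (b + 1) - 2 * (j + 1))) = numMatch (2 * (b + 1)) := by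
  rw [show 2 * (b + 1) = 0 + 2 + 2 * b by ring, ← sum_choose_numMatch]
  simp only [zero_add, one_mul]
  refine Finset.sum_congr rfl fun j hj => ?_
  rw [show 2 + 2 * b - 2 * (j + 1) = 2 * (b - j) by omega]
  simp [connCount]

lemma cnt_insert [DecidableEq V] (f : α → V) (i : ℕ) {A : Finset V} {v : V} (hv : v ∉ A) :
    cnt f i (insert v A) = cnt f i A + if vdeg f v = i then 1 else 0 := by
  rw [cnt, cnt, Finset.filter_insert]
  split_ifs with h
  · rw [Finset.card_insert_of_notMem (by simp [hv])]
  · rfl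

/-- The sum over all sets of low degree vertices through a given vertex. -/
lemma sum_connCount_cnt [DecidableEq V] [Finite α] {f : α → V} {A : Finset V}
    (hA : ∀ v ∈ A, vdeg f v = 1 ∨ vdeg f v = 2) {v : V} (hv : v ∈ A)
    (hv1 : vdeg f v = 1 ∨ cnt f 1 A = 0) :
    ∑ B ∈ A.powerset with v ∈ B, connCount (cnt f 1 B) (cnt f 2 B) *
      numMatch (cnt f 1 A + 2 * cnt f 2 A - (cnt f 1 B + 2 * cnt f 2 B)) =
    numMatch (cnt f 1 A + 2 * cnt f 2 A) := by
  set S := (A.erase v).filter fun u => vdeg f u = 1 with hS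
  set T := (A.erase v).filter fun u => vdeg f u = 2 with hT
  have hdisj : Disjoint S T := by
    rw [Finset.disjoint_filter]; intro u _ h1 h2; omega
  have hunion : S ∪ T = A.erase v := by
    rw [hS, hT, ← Finset.filter_or]
    exact Finset.filter_true_of_mem fun u hu => hA u (Finset.mem_of_mem_erase hu)
  have hcS : ∀ B ⊆ S ∪ T, cnt f 1 B = (B ∩ S).card := by
    intro B hB
    rw [cnt]; congr 1; ext u
    simp only [Finset.mem_filter, Finset.mem_inter, hS]
    refine ⟨fun h => ⟨h.1, ?_, h.2⟩, fun h => ⟨h.1, h.2.2⟩⟩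
    rw [← hunion]; exact hB h.1
  have hcT : ∀ B ⊆ S ∪ T, cnt f 2 B = (B ∩ T).card := by
    intro B hB
    rw [cnt]; congr 1; ext u
    simp only [Finset.mem_filter, Finset.mem_inter, hT]
    refine ⟨fun h => ⟨h.1, ?_, h.2⟩, fun h => ⟨h.1, h.2.2⟩⟩
    rw [← hunion]; exact hB h.1
  have hvn : ∀ B ⊆ S ∪ T, v ∉ B := fun B hB h => by
    have := hB h
    rw [hunion] at this
    simp at this
  have hsum : ∀ F : Finset V → ℕ, ∑ B ∈ A.powerset with v ∈ B, F B =
      ∑ B ∈ (S ∪ T).powerset, F (insert v B) := by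
    intro F
    refine Finset.sum_bij' (fun B _ => B.erase v) (fun B _ => insert v B) ?_ ?_ ?_ ?_ ?_
    · intro B hB
      simp only [Finset.mem_filter, Finset.mem_powerset] at hB ⊢
      rw [hunion]
      exact Finset.erase_subset_erase _ hB.1
    · intro B hB
      simp only [Finset.mem_filter, Finset.mem_powerset] at hB ⊢
      rw [hunion] at hB
      exact ⟨Finset.insert_subset hv (hB.trans (Finset.erase_subset _ _)),
        Finset.mem_insert_self _ _⟩
    · intro B hB
      simp only [Finset.mem_filter] at hB
      exact Finset.insert_erase hB.2
    · intro B hB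
      exact Finset.erase_insert (hvn B (Finset.mem_powerset.1 hB))
    · intro B hB
      simp only [Finset.mem_filter] at hB
      rw [Finset.insert_erase hB.2]
  have hAi : insert v (S ∪ T) = A := by rw [hunion, Finset.insert_erase hv]
  have hi := fun B hB => cnt_insert f 1 (hvn B hB)
  have hi2 := fun B hB => cnt_insert f 2 (hvn B hB)
  have hSc : cnt f 1 (S ∪ T) = S.card := by
    rw [hcS _ subset_rfl, Finset.inter_eq_right.2 Finset.subset_union_left]
  have hTc : cnt f 2 (S ∪ T) = T.card := by
    rw [hcT _ subset_rfl, Finset.inter_eq_right.2 Finset.subset_union_right]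
  have hA1 := hi _ subset_rfl
  have hA2 := hi2 _ subset_rfl
  rw [hAi, hSc] at hA1
  rw [hAi, hTc] at hA2
  rw [hsum]
  rcases hA v hv with h | h
  · simp only [h, if_true, OfNat.one_ne_ofNat, if_false, add_zero] at hi hi2 hA1 hA2
    rw [hA1, hA2, sum_powerset_union hdisj _ (fun i j => connCount (i + 1) j *
      numMatch (S.card + 1 + 2 * T.card - (i + 1 + 2 * j))), sum_connCount]
    intro B hB
    rw [hi B hB, hi2 B hB, hcS B hB, hcT B hB]
  · simp only [h, if_true, OfNat.ofNat_ne_one, if_false, add_zero] at hi hi2 hA1 hA2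
    have h0 : S.card = 0 := by omega
    rw [hA1, hA2, h0, sum_powerset_union hdisj _ (fun i j => connCount i (j + 1) *
      numMatch (0 + 2 * (T.card + 1) - (i + 2 * (j + 1)))), h0]
    · simp only [zero_add, Finset.sum_range_one, Nat.choose_self, one_smul]
      exact sum_connCount_zero T.card
    · intro B hB
      rw [hi B hB, hi2 B hB, hcS B hB, hcT B hB]

/-- The true count and `connCount` satisfy the same recursion over the component of a vertex. By
strong induction on `|A|` all terms with `B ≠ A` agree, hence so do the terms `B = A`. No explicit
description of lines and cycles is needed. -/
theorem card_isComp_low (n : ℕ) : ∀ (α : Type*) [Finite α] (f : α → V) (A : Finset V),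
    A.card = n → (∀ a, f a ∈ A) → (∀ v ∈ A, vdeg f v = 1 ∨ vdeg f v = 2) →
    Nat.card {σ : Matching α // σ.IsComp f A} = connCount (cnt f 1 A) (cnt f 2 A) := by
  classical
  induction n using Nat.strong_induction_on with
  | _ n ih =>
  intro α _ f A hn hf hA
  rcases A.eq_empty_or_nonempty with rfl | hne
  · have : IsEmpty {σ : Matching α // σ.IsComp f ∅} := ⟨fun σ => by simpa using σ.2.nonempty⟩
    simp [cnt, connCount]
  -- Start from a vertex of degree one whenever there is one; otherwise every vertex has degree two
  -- and the component through `v` is a cycle.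
  obtain ⟨v, hv, hv1⟩ : ∃ v ∈ A, vdeg f v = 1 ∨ cnt f 1 A = 0 := by
    by_cases h : cnt f 1 A = 0
    · obtain ⟨v, hv⟩ := hne
      exact ⟨v, hv, Or.inr h⟩
    · obtain ⟨v, hv⟩ := Finset.card_ne_zero.1 h
      rw [Finset.mem_filter] at hv
      exact ⟨v, hv.1, Or.inl hv.2⟩
  have hcard : Nat.card α = cnt f 1 A + 2 * cnt f 2 A := by
    rw [← tdeg_eq_cnt hA, tdeg]
    exact (Nat.card_congr (Equiv.subtypeUnivEquiv hf)).symm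
  have h1 := numMatch_eq_sum_isComp f A hf hv
  have h2 := sum_connCount_cnt hA hv hv1
  rw [hcard, ← h2] at h1
  have hmem : A ∈ A.powerset.filter fun B => v ∈ B := by simp [hv]
  rw [← Finset.add_sum_erase _ _ hmem] at h1
  have h3 : ∑ B ∈ A.powerset with v ∈ B, Nat.card {σ : Matching α // σ.IsComp f B} =
      Nat.card {σ : Matching α // σ.IsComp f A} +
      ∑ B ∈ (A.powerset.filter fun B => v ∈ B).erase A, connCount (cnt f 1 B) (cnt f 2 B) *
      numMatch (cnt f 1 A + 2 * cnt f 2 A - (cnt f 1 B + 2 * cnt f 2 B)) := by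
    rw [← Finset.add_sum_erase _ _ hmem]
    congr 1
    refine Finset.sum_congr rfl fun B hB => ?_
    rw [Finset.mem_erase, Finset.mem_filter, Finset.mem_powerset] at hB
    obtain ⟨hBA, hsub, -⟩ := hB
    have hBdeg : ∀ v ∈ B, vdeg f v = 1 ∨ vdeg f v = 2 := fun v hv => hA v (hsub hv)
    rw [card_isComp, hcard, tdeg_eq_cnt hBdeg]
    congr 1
    have hvd : ∀ v ∈ B, vdeg (fun a : {a // f a ∈ B} => f a) v = vdeg f v :=
      fun v hv => vdeg_mem f hv
    rw [conn, ih B.card (hn ▸ Finset.card_lt_card (hsub.ssubset_of_ne hBA)) _ _ B rfl (fun a => a.2)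
      fun v hv => by rw [hvd v hv]; exact hBdeg v hv]
    have : ∀ i, cnt (fun a : {a // f a ∈ B} => f a) i B = cnt f i B := fun i => by
      rw [cnt, cnt]
      congr 1
      exact Finset.filter_congr fun v hv => by rw [hvd v hv]
    rw [this, this]
  have h4 : Nat.card {σ : Matching α // σ.IsComp f A} +
      ∑ B ∈ (A.powerset.filter fun B => v ∈ B).erase A, connCount (cnt f 1 B) (cnt f 2 B) *
      numMatch (cnt f 1 A + 2 * cnt f 2 A - (cnt f 1 B + 2 * cnt f 2 B)) = 
      connCount (cnt f 1 A) (cnt f 2 A) +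
      ∑ B ∈ (A.powerset.filter fun B => v ∈ B).erase A, connCount (cnt f 1 B) (cnt f 2 B) *
      numMatch (cnt f 1 A + 2 * cnt f 2 A - (cnt f 1 B + 2 * cnt f 2 B)) := by
    rw [← h3]
    refine Eq.trans ?_ (h1.symm.trans ?_)
    · refine Finset.sum_congr ?_ fun _ _ => rfl
      congr
    · simp [numMatch]
  exact Nat.add_right_cancel h4

theorem conn_low [Finite α] {f : α → V} {A : Finset V}
    (hA : ∀ v ∈ A, vdeg f v = 1 ∨ vdeg f v = 2) :
    conn f A = connCount (cnt f 1 A) (cnt f 2 A) := by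
  have hvd : ∀ v ∈ A, vdeg (fun a : {a // f a ∈ A} => f a) v = vdeg f v :=
    fun v hv => vdeg_mem f hv
  rw [conn, card_isComp_low A.card _ _ A rfl (fun a => a.2)
    fun v hv => by rw [hvd v hv]; exact hA v hv]
  have : ∀ i, cnt (fun a : {a // f a ∈ A} => f a) i A = cnt f i A := fun i => by
    rw [cnt, cnt]
    congr 1
    exact Finset.filter_congr fun v hv => by rw [hvd v hv]
  rw [this, this]

end ConfigModel
end

/-! ### Exact expectations for the line and cycle components. -/

noncomputable section

namespace ConfigModel

open Matching

variable {α V : Type*}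

/-- The probability factor of a path of `j` vertices of degree two. Here `a` and `b` are the numbers
of vertices of degree one and two and `c` is the number of half-edges at all other vertices. -/
def rateProd (a b c j : ℕ) : ℝ :=
  ∏ i ∈ Finset.range j, 2 * ((b : ℝ) - i) / (((a + 2 * b + c : ℕ) : ℝ) - 1 - 2 * i)

/-- The expected number of cycle components with `j + 1` vertices. -/
def cycCoef (a b c j : ℕ) : ℝ := rateProd a b c (j + 1) / (2 * (j + 1))

/-- The expected number of line components with `j + 2` vertices. -/
def lineCoef (a b c j : ℕ) : ℝ :=
  (a : ℝ) * (a - 1) / 2 * (rateProd a b c j / (((a + 2 * b + c : ℕ) : ℝ) - 1 - 2 * j))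

/-- The expectation of the `r`-th elementary symmetric function of the weights of the line and cycle
components. -/
def eps (g : ℕ → ℂ) (c : ℕ) : ℕ → ℕ → ℕ → ℂ
  | 0, _, _ => 1
  | r + 1, a, b => (1 / ((r : ℂ) + 1)) *
      (∑ j ∈ Finset.range b, g (j + 1) * cycCoef a b c j * eps g c r a (b - (j + 1)) +
      ∑ j ∈ Finset.range (b + 1), g (j + 2) * lineCoef a b c j * eps g c r (a - 2) (b - j))

/-- Each factor of `rateProd` selects one more vertex of degree two with an orientation, and its
denominator cancels the leading factor of the double factorial `numMatch`. -/
lemma rateProd_mul_numMatch (a b c : ℕ) {j : ℕ} (hj : j ≤ b) :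
    rateProd a b c j * numMatch (a + 2 * b + c) =
      b.choose j * (2 ^ j * j.factorial) * numMatch (a + 2 * b + c - 2 * j) := by
  induction j with
  | zero => simp [rateProd]
  | succ j ih =>
    have h1 : rateProd a b c (j + 1) = rateProd a b c j *
      (2 * ((b : ℝ) - j) / (((a + 2 * b + c : ℕ) : ℝ) - 1 - 2 * j)) := Finset.prod_range_succ _ _
    rw [h1, mul_right_comm, ih (by omega)]
    obtain ⟨m, hm⟩ : ∃ m, a + 2 * b + c = m + 2 * (j + 1) := ⟨a + 2 * b + c - 2 * (j + 1), by omega⟩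
    have h2 : ((b.choose (j + 1) : ℕ) : ℝ) * (j + 1) = b.choose j * ((b : ℝ) - j) := by
      have := Nat.choose_succ_right_eq b j
      rw [← Nat.cast_sub (by omega : j ≤ b)]
      exact_mod_cast this
    rw [hm, show m + 2 * (j + 1) - 2 * j = m + 2 by omega,
      show m + 2 * (j + 1) - 2 * (j + 1) = m by omega, numMatch, Nat.factorial_succ]
    push_cast
    rw [show (m : ℝ) + 2 * (j + 1) - 1 - 2 * j = m + 1 by ring]
    have : (m : ℝ) + 1 ≠ 0 := by positivity
    field_simp
    linear_combination (-(2 : ℝ) ^ (j + 1) * numMatch m) * h2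

lemma cycCoef_mul_numMatch (a b c : ℕ) {j : ℕ} (hj : j < b) :
    cycCoef a b c j * numMatch (a + 2 * b + c) =
      b.choose (j + 1) * (connCount 0 (j + 1)) * numMatch (a + 2 * b + c - 2 * (j + 1)) := by
  have h := rateProd_mul_numMatch a b c (Nat.succ_le_of_lt hj)
  rw [Nat.succ_eq_add_one] at h
  rw [cycCoef, div_mul_eq_mul_div, h, Nat.factorial_succ, connCount]
  simp only [if_true, Nat.add_eq_zero_iff, one_ne_zero, and_false, if_false, Nat.add_sub_cancel]
  push_cast
  field_simp
  ring

lemma lineCoef_mul_numMatch (a b c : ℕ) {j : ℕ} (hj : j ≤ b) :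
    lineCoef a b c j * numMatch (a + 2 * b + c) =
      a.choose 2 * (b.choose j * connCount 2 j * numMatch (a + 2 * b + c - (2 + 2 * j))) := by
  have h := rateProd_mul_numMatch a b c hj
  rcases Nat.lt_or_ge a 2 with ha | ha
  · interval_cases a <;> simp [lineCoef]
  obtain ⟨m, hm⟩ : ∃ m, a + 2 * b + c = m + 2 * (j + 1) := ⟨a + 2 * b + c - 2 * (j + 1), by omega⟩
  rw [lineCoef, mul_assoc, div_mul_eq_mul_div (rateProd a b c j), h, Nat.cast_choose_two, hm,
    show m + 2 * (j + 1) - 2 * j = m + 2 by omega,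
    show m + 2 * (j + 1) - (2 + 2 * j) = m by omega, numMatch, connCount]
  push_cast
  rw [show (m : ℝ) + 2 * (j + 1) - 1 - 2 * j = m + 1 by ring]
  have : (m : ℝ) + 1 ≠ 0 := by positivity
  field_simp

/-- A line or cycle has zero or two vertices of degree one, so the sum over their number collapses
to these two cases. -/
lemma sum_choose_eq_add {M : Type*} [AddCommMonoid M] (a : ℕ) (h : ℕ → M)
    (hh : ∀ i, i ≠ 0 → i ≠ 2 → h i = 0) :
    ∑ i ∈ Finset.range (a + 1), a.choose i • h i = h 0 + a.choose 2 • h 2 := by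
  -- Padding the range to `a + 3` puts the index `2` in it even when `a < 2`; the added binomials
  -- vanish.
  have h1 : ∑ i ∈ Finset.range (a + 1), a.choose i • h i =
      ∑ i ∈ Finset.range (a + 3), a.choose i • h i := by
    refine Finset.sum_subset (Finset.range_mono (by omega)) fun i _ hi => ?_
    rw [Nat.choose_eq_zero_of_lt (by simpa using hi), zero_smul]
  have h2 : ∑ i ∈ ({0, 2} : Finset ℕ), a.choose i • h i =
      ∑ i ∈ Finset.range (a + 3), a.choose i • h i := by
    refine Finset.sum_subset (fun i hi => ?_) fun i _ hi => ?_
    · simp only [Finset.mem_insert, Finset.mem_singleton] at hi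
      simp only [Finset.mem_range]; omega
    · simp only [Finset.mem_insert, Finset.mem_singleton, not_or] at hi
      rw [hh i hi.1 hi.2, smul_zero]
  rw [h1, ← h2, Finset.sum_pair (by norm_num)]
  simp

/-- Induction on `r` over all half-edge types at once, since deleting a component changes the type.
A deletion lowers `a` and `b` and leaves `c` fixed, which is what the recursion of `eps` records. -/
theorem total_eq [Fintype V] (g : ℕ → ℂ) (r : ℕ) : ∀ (α : Type*) [Finite α] (f : α → V)
    (a b c : ℕ), Nat.card α = a + 2 * b + c → (ones f).card = a → (twos f).card = b →
    total g f r = numMatch (Nat.card α) * eps g c r a b := by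
  classical
  induction r with
  | zero =>
    intro α _ f a b c _ _ _
    have := Fintype.ofFinite α
    simp [total, esum, eps, Finset.card_univ, card_eq_numMatch]
  | succ r ih =>
    intro α _ f a b c hc ha hb
    have hdisj : Disjoint (ones f) (twos f) := by
      rw [Finset.disjoint_left]; intro v h1 h2
      rw [mem_ones] at h1; rw [mem_twos] at h2; omega
    have hlow : low f = ones f ∪ twos f := by ext v; simp
    have h1 := total_succ g f r
    rw [hlow, sum_powerset_union hdisj _ fun i j => g (i + j) * connCount i j *
      (numMatch (a + 2 * b + c - (i + 2 * j)) * eps g c r (a - i) (b - j)), ha, hb,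
      sum_choose_eq_add] at h1
    · have h2 : ∀ j, j < b → (b.choose (j + 1) : ℂ) * (connCount 0 (j + 1)) *
          numMatch (a + 2 * b + c - 2 * (j + 1)) = cycCoef a b c j * numMatch (a + 2 * b + c) :=
        fun j hj => by exact_mod_cast congrArg (fun x : ℝ => (x : ℂ)) (cycCoef_mul_numMatch a b c hj).symm
      have h3 : ∀ j, j ≤ b → (a.choose 2 : ℂ) * (b.choose j * connCount 2 j *
          numMatch (a + 2 * b + c - (2 + 2 * j))) = lineCoef a b c j * numMatch (a + 2 * b + c) :=
        fun j hj => by exact_mod_cast congrArg (fun x : ℝ => (x : ℂ)) (lineCoef_mul_numMatch a b c hj).symm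
      have hr : (r : ℂ) + 1 ≠ 0 := by exact_mod_cast Nat.succ_ne_zero r
      apply mul_left_cancel₀ hr
      -- Splitting off `j = 0` from the cycle sum isolates the empty vertex set, which is not
      -- connected (`connCount 0 0 = 0`). The remaining indices shift to cycles with `j + 1`
      -- vertices.
      rw [h1, eps, hc, Finset.sum_range_succ']
      simp only [nsmul_eq_mul]
      rw [show (connCount 0 0) = 0 from rfl]
      simp only [Nat.cast_zero, mul_zero, zero_mul, add_zero, zero_add]
      field_simp
      rw [Finset.mul_sum, mul_add, Finset.mul_sum, Finset.mul_sum]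
      congr 1
      · refine Finset.sum_congr rfl fun j hj => ?_
        rw [Nat.sub_zero]
        linear_combination (g (j + 1) * eps g c r a (b - (j + 1))) * h2 j (Finset.mem_range.1 hj)
      · refine Finset.sum_congr rfl fun j hj => ?_
        rw [add_comm 2 j]
        linear_combination (g (j + 2) * eps g c r (a - 2) (b - j)) *
          h3 j (Nat.lt_succ_iff.1 (Finset.mem_range.1 hj))
    · intro i hi hi2
      simp [connCount, hi, hi2]
    · intro B hB
      have hdeg : ∀ v ∈ B, vdeg f v = 1 ∨ vdeg f v = 2 := fun v hv => by
        have := hB hv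
        rw [← hlow] at this
        simpa using this
      have e1 : cnt f 1 B = (B ∩ ones f).card := by rw [cnt]; congr 1; ext v; simp
      have e2 : cnt f 2 B = (B ∩ twos f).card := by rw [cnt]; congr 1; ext v; simp
      have l1 : (B ∩ ones f).card ≤ a := ha ▸ Finset.card_le_card Finset.inter_subset_right
      have l2 : (B ∩ twos f).card ≤ b := hb ▸ Finset.card_le_card Finset.inter_subset_right
      rw [conn_low hdeg, card_eq_cnt hdeg, ih _ _ (a - (B ∩ ones f).card) (b - (B ∩ twos f).card) c,
        card_not_mem, tdeg_eq_cnt hdeg, e1, e2, hc]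
      · rw [card_not_mem, tdeg_eq_cnt hdeg, e1, e2, hc]
        omega
      · rw [ones_not_mem, Finset.card_sdiff, ha]
      · rw [twos_not_mem, Finset.card_sdiff, hb]

end ConfigModel
end

/-! ### Uniform geometric bounds, and the limit of the expectations. -/

noncomputable section

namespace ConfigModel

open Matching

lemma rateProd_succ (a b c j : ℕ) : rateProd a b c (j + 1) = rateProd a b c j *
    (2 * ((b : ℝ) - j) / (((a + 2 * b + c : ℕ) : ℝ) - 1 - 2 * j)) := Finset.prod_range_succ _ _

lemma rateProd_eq_zero (a c : ℕ) {b j : ℕ} (h : b < j) : rateProd a b c j = 0 :=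
  Finset.prod_eq_zero (Finset.mem_range.2 h) (by simp)

lemma cycCoef_eq_zero (a c : ℕ) {b j : ℕ} (h : b ≤ j) : cycCoef a b c j = 0 := by
  rw [cycCoef, rateProd_eq_zero a c (by omega), zero_div]

lemma lineCoef_eq_zero (a c : ℕ) {b j : ℕ} (h : b < j) : lineCoef a b c j = 0 := by
  rw [lineCoef, rateProd_eq_zero a c h, zero_div, mul_zero]

/-- The degree counts `a`, `b`, `c` satisfy the bounds that make the expected numbers of lines and
cycles decay geometrically with ratio `q`. -/
structure RateBound (q A : ℝ) (a b c : ℕ) : Prop where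
  q_nonneg : 0 ≤ q
  q_lt_one : q < 1
  A_nonneg : 0 ≤ A
  two_le : 2 ≤ c
  two_mul_le : (1 - q) * (2 * b) ≤ q * (c - 1)
  sq_le : (a : ℝ) ^ 2 ≤ 2 * A * (c - 1)

/-- Deleting components keeps `c` and lowers `a` and `b`, so the same constants serve throughout the
recursion. -/
lemma RateBound.mono {q A : ℝ} {a b c a' b' : ℕ} (h : RateBound q A a b c) (ha : a' ≤ a)
    (hb : b' ≤ b) : RateBound q A a' b' c where
  q_nonneg := h.q_nonneg
  q_lt_one := h.q_lt_one
  A_nonneg := h.A_nonneg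
  two_le := h.two_le
  two_mul_le := by
    refine le_trans ?_ h.two_mul_le
    have := h.q_lt_one
    have : 0 ≤ 1 - q := by linarith
    gcongr
  sq_le := by
    refine le_trans ?_ h.sq_le
    gcongr

section bounds

variable {q A : ℝ} {a b c : ℕ}

/-- For `j ≤ b`, each factor is at most `2 b / (2 b + c - 1)`, which `two_mul_le` bounds by `q`. For
`j > b`, the product contains a zero factor. -/
lemma RateBound.rateProd_mem (h : RateBound q A a b c) (j : ℕ) :
    0 ≤ rateProd a b c j ∧ rateProd a b c j ≤ q ^ j := by
  rcases Nat.lt_or_ge b j with hj | hj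
  · rw [rateProd_eq_zero a c hj]
    exact ⟨le_rfl, pow_nonneg h.q_nonneg _⟩
  have hc : (2 : ℝ) ≤ c := by exact_mod_cast h.two_le
  have key : ∀ i ∈ Finset.range j, 0 ≤ 2 * ((b : ℝ) - i) / (((a + 2 * b + c : ℕ) : ℝ) - 1 - 2 * i) ∧
      2 * ((b : ℝ) - i) / (((a + 2 * b + c : ℕ) : ℝ) - 1 - 2 * i) ≤ q := by
    intro i hi
    have hi' : (i : ℝ) ≤ b := by
      have := Finset.mem_range.1 hi
      exact_mod_cast (by omega : i ≤ b)
    have hi0 : (0 : ℝ) ≤ i := Nat.cast_nonneg i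
    have ha0 : (0 : ℝ) ≤ a := Nat.cast_nonneg a
    push_cast
    have hpos : 0 < (a : ℝ) + 2 * b + c - 1 - 2 * i := by linarith
    refine ⟨div_nonneg (by linarith) hpos.le, ?_⟩
    rw [div_le_iff₀ hpos]
    have h1 := h.two_mul_le
    have h2 := h.q_nonneg
    have h3 := h.q_lt_one
    nlinarith [mul_nonneg h2 ha0, mul_nonneg (by linarith : 0 ≤ 1 - q) hi0]
  refine ⟨Finset.prod_nonneg fun i hi => (key i hi).1, ?_⟩
  refine (Finset.prod_le_prod (fun i hi => (key i hi).1) fun i hi => (key i hi).2).trans ?_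
  simp

lemma RateBound.cycCoef_le (h : RateBound q A a b c) (j : ℕ) : |cycCoef a b c j| ≤ q ^ j := by
  have h1 := h.rateProd_mem (j + 1)
  rw [cycCoef, abs_of_nonneg (div_nonneg h1.1 (by positivity)), div_le_iff₀ (by positivity)]
  have h2 : q ^ (j + 1) ≤ q ^ j := pow_le_pow_of_le_one h.q_nonneg h.q_lt_one.le (by omega)
  have h3 : 0 ≤ q ^ j := pow_nonneg h.q_nonneg _
  have h4 : (0 : ℝ) ≤ j := Nat.cast_nonneg j
  nlinarith [mul_nonneg h3 h4]

/-- The pairs of ends number at most `a ^ 2 / 2 ≤ A (c - 1)`, and for `j ≤ b` the remaining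
denominator is at least `c - 1`. -/
lemma RateBound.lineCoef_le (h : RateBound q A a b c) (j : ℕ) :
    |lineCoef a b c j| ≤ A * q ^ j := by
  rcases Nat.lt_or_ge b j with hj | hj
  · rw [lineCoef_eq_zero a c hj, abs_zero]
    exact mul_nonneg h.A_nonneg (pow_nonneg h.q_nonneg _)
  have hc : (2 : ℝ) ≤ c := by exact_mod_cast h.two_le
  have hjb : (j : ℝ) ≤ b := by exact_mod_cast hj
  have h1 := h.rateProd_mem j
  have ha0 : (0 : ℝ) ≤ a := Nat.cast_nonneg a
  have ha : 0 ≤ (a : ℝ) * (a - 1) := by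
    rcases Nat.eq_zero_or_pos a with rfl | ha
    · simp
    · have : (1 : ℝ) ≤ a := by exact_mod_cast ha
      exact mul_nonneg ha0 (by linarith)
  have hden : (c : ℝ) - 1 ≤ ((a + 2 * b + c : ℕ) : ℝ) - 1 - 2 * j := by
    push_cast; linarith
  have hpos : 0 < (c : ℝ) - 1 := by linarith
  rw [lineCoef, abs_of_nonneg (mul_nonneg (by linarith) (div_nonneg h1.1 (by linarith)))]
  have hq : rateProd a b c j / (((a + 2 * b + c : ℕ) : ℝ) - 1 - 2 * j) ≤ q ^ j / (c - 1) :=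
    div_le_div₀ (pow_nonneg h.q_nonneg _) h1.2 hpos hden
  calc _ ≤ A * (c - 1) * (q ^ j / (c - 1)) := by
        apply mul_le_mul _ hq (div_nonneg h1.1 (by linarith))
          (mul_nonneg h.A_nonneg hpos.le)
        have := h.sq_le
        nlinarith
    _ = A * q ^ j := by field_simp

end bounds

lemma summable_sq_mul_pow {q : ℝ} (h0 : 0 ≤ q) (h1 : q < 1) :
    Summable fun j : ℕ => ((j : ℝ) + 2) ^ 2 * q ^ j := by
  have hq : ‖q‖ < 1 := by rwa [Real.norm_of_nonneg h0]
  have h2 := summable_pow_mul_geometric_of_norm_lt_one 2 hq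
  have h3 := summable_pow_mul_geometric_of_norm_lt_one 1 hq
  have h4 := summable_pow_mul_geometric_of_norm_lt_one 0 hq
  refine ((h2.add (h3.mul_left 4)).add (h4.mul_left 4)).congr fun j => ?_
  ring

/-- The term of size `j` in the recursion for `eps`. -/
def epsTerm (g : ℕ → ℂ) (c r a b j : ℕ) : ℂ :=
  g (j + 1) * cycCoef a b c j * eps g c r a (b - (j + 1)) +
    g (j + 2) * lineCoef a b c j * eps g c r (a - 2) (b - j)

/-- The coefficients vanish beyond `b`, so the finite sums become series over an index set
independent of `a` and `b`, as dominated convergence requires. -/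
lemma eps_succ (g : ℕ → ℂ) (c r a b : ℕ) :
    eps g c (r + 1) a b = (1 / ((r : ℂ) + 1)) * ∑' j, epsTerm g c r a b j := by
  rw [eps, tsum_eq_sum (s := Finset.range (b + 1))]
  · simp only [epsTerm]
    rw [Finset.sum_add_distrib]
    congr 2
    rw [Finset.sum_range_succ, cycCoef_eq_zero a c le_rfl]
    simp
  · intro j hj
    have : b < j := by simpa using hj
    rw [epsTerm, cycCoef_eq_zero a c this.le, lineCoef_eq_zero a c this]
    simp

/-- The base of the factorial bound on `eps`. -/
def epsBase (G q A : ℝ) : ℝ := ∑' j : ℕ, G * (1 + A) * (((j : ℝ) + 2) ^ 2 * q ^ j)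

lemma norm_epsTerm_le {g : ℕ → ℂ} {G q A K : ℝ} (hg : ∀ k, ‖g k‖ ≤ G * (k : ℝ) ^ 2) (hG : 0 ≤ G)
    {a b c r : ℕ} (h : RateBound q A a b c)
    (h1 : ∀ j, ‖eps g c r a (b - (j + 1))‖ ≤ K) (h2 : ∀ j, ‖eps g c r (a - 2) (b - j)‖ ≤ K) (j : ℕ) :
    ‖epsTerm g c r a b j‖ ≤ G * (1 + A) * (((j : ℝ) + 2) ^ 2 * q ^ j) * K := by
  have hA := h.A_nonneg
  have hq : 0 ≤ q ^ j := pow_nonneg h.q_nonneg j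
  have e1 : ‖g (j + 1)‖ ≤ G * ((j : ℝ) + 2) ^ 2 := (hg _).trans (by
    push_cast
    gcongr
    norm_num)
  have e2 : ‖g (j + 2)‖ ≤ G * ((j : ℝ) + 2) ^ 2 := (hg _).trans (by push_cast; rfl)
  calc ‖epsTerm g c r a b j‖ ≤ ‖g (j + 1)‖ * |cycCoef a b c j| * ‖eps g c r a (b - (j + 1))‖ +
      ‖g (j + 2)‖ * |lineCoef a b c j| * ‖eps g c r (a - 2) (b - j)‖ := by
        refine (norm_add_le _ _).trans_eq ?_
        simp [Complex.norm_real]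
    _ ≤ G * ((j : ℝ) + 2) ^ 2 * q ^ j * K + G * ((j : ℝ) + 2) ^ 2 * (A * q ^ j) * K := by
        gcongr
        · exact h.cycCoef_le j
        · exact h1 j
        · exact h.lineCoef_le j
        · exact h2 j
    _ = _ := by ring

/-- Every application of the recursion costs a factor `epsBase` and gains `1 / (r + 1)`, which
builds up the factorial. -/
lemma norm_eps_le {g : ℕ → ℂ} {G q A : ℝ} (hg : ∀ k, ‖g k‖ ≤ G * (k : ℝ) ^ 2) (hG : 0 ≤ G)
    (r : ℕ) : ∀ {a b c : ℕ}, RateBound q A a b c →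
    ‖eps g c r a b‖ ≤ epsBase G q A ^ r / r.factorial := by
  induction r with
  | zero => intro a b c _; simp [eps]
  | succ r ih =>
    intro a b c h
    have hA := h.A_nonneg
    have hq := h.q_nonneg
    have hs := ((summable_sq_mul_pow h.q_nonneg h.q_lt_one).mul_left (G * (1 + A)))
    have hB : 0 ≤ epsBase G q A := tsum_nonneg fun j => by positivity
    have hterm := norm_epsTerm_le hg hG h
      (fun j => ih (h.mono le_rfl (Nat.sub_le _ _)))
      (fun j => ih (h.mono (Nat.sub_le _ _) (Nat.sub_le _ _)))
    have h1 := tsum_of_norm_bounded (hs.mul_right _).hasSum hterm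
    rw [tsum_mul_right] at h1
    rw [eps_succ, norm_mul, norm_div, norm_one,
      show ‖(r : ℂ) + 1‖ = r + 1 by exact_mod_cast Complex.norm_natCast (r + 1)]
    calc _ ≤ 1 / ((r : ℝ) + 1) * (epsBase G q A * (epsBase G q A ^ r / r.factorial)) := by gcongr; exact h1
      _ = _ := by
        rw [Nat.factorial_succ]
        push_cast
        field_simp
        ring

/-- Numbers of vertices of degree one (`a`), of degree two (`b`) and of half-edges at vertices of
higher degree (`c`) in the critical window. -/
structure Regime {ι : Type*} (l : Filter ι) (N : ι → ℝ) (a b c : ι → ℕ) (ρ p κ : ℝ) : Prop where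
  tendsto_N : Tendsto N l atTop
  tendsto_a : Tendsto (fun i => (a i : ℝ) / √(N i)) l (𝓝 ρ)
  tendsto_b : Tendsto (fun i => (b i : ℝ) / N i) l (𝓝 p)
  tendsto_c : Tendsto (fun i => (c i : ℝ) / N i) l (𝓝 κ)
  p_nonneg : 0 ≤ p
  κ_pos : 0 < κ

/-- The ratio of the limiting geometric rates. -/
def ratio (p κ : ℝ) : ℝ := 2 * p / (κ + 2 * p)

/-- The limiting expected number of cycles with `j + 1` vertices. -/
def cycLim (p κ : ℝ) (j : ℕ) : ℝ := ratio p κ ^ (j + 1) / (2 * (j + 1))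

/-- The limiting expected number of lines with `j + 2` vertices. -/
def lineLim (ρ p κ : ℝ) (j : ℕ) : ℝ := ρ ^ 2 / 2 * (ratio p κ ^ j / (κ + 2 * p))

/-- The exponent of the limiting compound Poisson transform. -/
def lcExponent (g : ℕ → ℂ) (ρ p κ : ℝ) : ℂ :=
  ∑' j, (g (j + 1) * cycLim p κ j + g (j + 2) * lineLim ρ p κ j)

namespace Regime

variable {ι : Type*} {l : Filter ι} {N : ι → ℝ} {a b c : ι → ℕ} {ρ p κ : ℝ}

lemma tendsto_const_div (h : Regime l N a b c ρ p κ) (x : ℝ) :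
    Tendsto (fun i => x / N i) l (𝓝 0) := h.tendsto_N.const_div_atTop x

/-- Deleting boundedly many vertices does not affect the limits, so the inductive hypothesis of
`tendsto_eps` applies to the graph left after cutting out a component of fixed size. -/
lemma shift (h : Regime l N a b c ρ p κ) (s t : ℕ) :
    Regime l N (fun i => a i - s) (fun i => b i - t) c ρ p κ where
  tendsto_N := h.tendsto_N
  tendsto_a := by
    have h0 : Tendsto (fun i => (s : ℝ) / √(N i)) l (𝓝 0) :=
      (Real.tendsto_sqrt_atTop.comp h.tendsto_N).const_div_atTop _
    have h1 := h.tendsto_a.sub h0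
    rw [sub_zero] at h1
    refine tendsto_of_tendsto_of_tendsto_of_le_of_le h1 h.tendsto_a (fun i => ?_) fun i => ?_
    · simp only
      rw [← sub_div]
      gcongr
      have : a i ≤ a i - s + s := by omega
      have : (a i : ℝ) ≤ (a i - s : ℕ) + s := by exact_mod_cast this
      linarith
    · simp only
      gcongr
      exact Nat.sub_le _ _
  tendsto_b := by
    have h1 := h.tendsto_b.sub (h.tendsto_const_div t)
    rw [sub_zero] at h1
    refine tendsto_of_tendsto_of_tendsto_of_le_of_le' h1 h.tendsto_b ?_ ?_
    · filter_upwards [h.tendsto_N.eventually_gt_atTop 0] with i hi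
      rw [← sub_div]
      gcongr
      have : b i ≤ b i - t + t := by omega
      have : (b i : ℝ) ≤ (b i - t : ℕ) + t := by exact_mod_cast this
      linarith
    · filter_upwards [h.tendsto_N.eventually_gt_atTop 0] with i hi
      gcongr
      exact Nat.sub_le _ _
  tendsto_c := h.tendsto_c
  p_nonneg := h.p_nonneg
  κ_pos := h.κ_pos

lemma tendsto_a_sq (h : Regime l N a b c ρ p κ) :
    Tendsto (fun i => (a i : ℝ) ^ 2 / N i) l (𝓝 (ρ ^ 2)) := by
  refine (h.tendsto_a.pow 2).congr' ?_
  filter_upwards [h.tendsto_N.eventually_gt_atTop 0] with i hi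
  rw [div_pow, Real.sq_sqrt hi.le]

lemma tendsto_a_div (h : Regime l N a b c ρ p κ) :
    Tendsto (fun i => (a i : ℝ) / N i) l (𝓝 0) := by
  have h0 : Tendsto (fun i => (1 : ℝ) / √(N i)) l (𝓝 0) :=
    (Real.tendsto_sqrt_atTop.comp h.tendsto_N).const_div_atTop _
  have h1 := h.tendsto_a.mul h0
  rw [mul_zero] at h1
  refine h1.congr' ?_
  filter_upwards [h.tendsto_N.eventually_gt_atTop 0] with i hi
  rw [div_mul_div_comm, mul_one, Real.mul_self_sqrt hi.le]

lemma ratio_nonneg (h : Regime l N a b c ρ p κ) : 0 ≤ ratio p κ := by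
  have := h.p_nonneg; have := h.κ_pos
  unfold ratio; positivity

lemma ratio_lt_one (h : Regime l N a b c ρ p κ) : ratio p κ < 1 := by
  have := h.p_nonneg; have := h.κ_pos
  unfold ratio
  rw [div_lt_one (by positivity)]
  linarith

lemma eventually_rateBound (h : Regime l N a b c ρ p κ) :
    ∀ᶠ i in l, RateBound ((1 + ratio p κ) / 2) ((ρ ^ 2 + 1) / κ) (a i) (b i) (c i) := by
  have hp := h.p_nonneg
  have hκ := h.κ_pos
  have hr0 := h.ratio_nonneg
  have hr1 := h.ratio_lt_one
  -- The midpoint between the limiting ratio and `1` leaves room for a strict inequality in the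
  -- limit; likewise `(ρ ^ 2 + 1) / κ` strictly exceeds the limiting requirement `ρ ^ 2 / (2 κ)`.
  set q := (1 + ratio p κ) / 2 with hq
  have hrq : ratio p κ < q := by rw [hq]; linarith
  have h1 : Tendsto (fun i => ((c i : ℝ) - 1) / N i) l (𝓝 κ) := by
    have := h.tendsto_c.sub (h.tendsto_const_div 1)
    rw [sub_zero] at this
    exact this.congr fun i => (sub_div _ _ _).symm
  have h2 : Tendsto (fun i => (1 - q) * (2 * ((b i : ℝ) / N i))) l (𝓝 ((1 - q) * (2 * p))) :=
    (h.tendsto_b.const_mul 2).const_mul _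
  have h3 : (1 - q) * (2 * p) < q * κ := by
    rw [ratio, div_lt_iff₀ (by positivity)] at hrq
    linarith
  have h4 : ρ ^ 2 < 2 * ((ρ ^ 2 + 1) / κ) * κ := by
    field_simp
    nlinarith [sq_nonneg ρ]
  filter_upwards [h2.eventually_lt (h1.const_mul q) h3,
    h.tendsto_a_sq.eventually_lt (h1.const_mul (2 * ((ρ ^ 2 + 1) / κ))) h4,
    (h.tendsto_const_div 2).eventually_lt h.tendsto_c hκ, h.tendsto_N.eventually_gt_atTop 0]
    with i e2 e3 e4 hN
  refine ⟨by linarith, by linarith, by positivity, ?_, ?_, ?_⟩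
  · have := (div_lt_div_iff_of_pos_right hN).1 e4
    exact_mod_cast this.le
  · rw [show (1 - q) * (2 * ((b i : ℝ) / N i)) = ((1 - q) * (2 * b i)) / N i by ring,
      ← mul_div_assoc] at e2
    exact ((div_lt_div_iff_of_pos_right hN).1 e2).le
  · rw [← mul_div_assoc] at e3
    exact ((div_lt_div_iff_of_pos_right hN).1 e3).le

lemma tendsto_den (h : Regime l N a b c ρ p κ) (j : ℕ) :
    Tendsto (fun i => (((a i + 2 * b i + c i : ℕ) : ℝ) - 1 - 2 * j) / N i) l (𝓝 (κ + 2 * p)) := by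
  have := ((h.tendsto_a_div.add (h.tendsto_b.const_mul 2)).add h.tendsto_c).sub
    (h.tendsto_const_div (1 + 2 * j))
  rw [show (0 : ℝ) + 2 * p + κ - 0 = κ + 2 * p by ring] at this
  refine this.congr fun i => ?_
  push_cast
  ring

lemma tendsto_rateProd (h : Regime l N a b c ρ p κ) (j : ℕ) :
    Tendsto (fun i => rateProd (a i) (b i) (c i) j) l (𝓝 (ratio p κ ^ j)) := by
  have hp := h.p_nonneg
  have hκ := h.κ_pos
  induction j with
  | zero => simp [rateProd, tendsto_const_nhds]
  | succ j ih =>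
    simp only [rateProd_succ, pow_succ]
    refine ih.mul ?_
    have h1 : Tendsto (fun i => 2 * ((b i : ℝ) / N i - j / N i)) l (𝓝 (2 * (p - 0))) :=
      (h.tendsto_b.sub (h.tendsto_const_div j)).const_mul 2
    rw [sub_zero] at h1
    refine (h1.div (h.tendsto_den j) (by positivity)).congr' ?_
    filter_upwards [h.tendsto_N.eventually_gt_atTop 0] with i hi
    simp only [Pi.div_apply]
    rw [← sub_div, ← mul_div_assoc, div_div_div_cancel_right₀ hi.ne']

lemma tendsto_cycCoef (h : Regime l N a b c ρ p κ) (j : ℕ) :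
    Tendsto (fun i => cycCoef (a i) (b i) (c i) j) l (𝓝 (cycLim p κ j)) :=
  (h.tendsto_rateProd (j + 1)).div_const _

lemma tendsto_lineCoef (h : Regime l N a b c ρ p κ) (j : ℕ) :
    Tendsto (fun i => lineCoef (a i) (b i) (c i) j) l (𝓝 (lineLim ρ p κ j)) := by
  have hp := h.p_nonneg
  have hκ := h.κ_pos
  have h1 := (h.tendsto_a_sq.sub h.tendsto_a_div).div_const 2
  rw [sub_zero] at h1
  have h2 := h1.mul ((h.tendsto_rateProd j).div (h.tendsto_den j) (by positivity))
  refine h2.congr' ?_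
  filter_upwards [h.tendsto_N.eventually_gt_atTop 0] with i hi
  simp only [lineCoef, Pi.div_apply]
  field_simp

/-- The factorial moments converge to those of the compound Poisson limit. -/
theorem tendsto_eps {g : ℕ → ℂ} {G : ℝ} (hg : ∀ k, ‖g k‖ ≤ G * (k : ℝ) ^ 2) (hG : 0 ≤ G)
    (r : ℕ) : ∀ {a b : ι → ℕ}, Regime l N a b c ρ p κ →
    Tendsto (fun i => eps g (c i) r (a i) (b i)) l (𝓝 (lcExponent g ρ p κ ^ r / r.factorial)) := by
  induction r with
  | zero => intro a b _; simp [eps, tendsto_const_nhds]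
  | succ r ih =>
    intro a b h
    have hr0 := h.ratio_nonneg
    have hr1 := h.ratio_lt_one
    have hκ := h.κ_pos
    have hs := (summable_sq_mul_pow (q := (1 + ratio p κ) / 2) (by linarith) (by linarith))
    simp only [eps_succ]
    have hlim : Tendsto (fun i => ∑' j, epsTerm g (c i) r (a i) (b i) j) l
        (𝓝 (∑' j, (g (j + 1) * cycLim p κ j + g (j + 2) * lineLim ρ p κ j) *
          (lcExponent g ρ p κ ^ r / r.factorial))) := by
      refine tendsto_tsum_of_dominated_convergence
        ((hs.mul_left (G * (1 + (ρ ^ 2 + 1) / κ))).mul_right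
          (epsBase G ((1 + ratio p κ) / 2) ((ρ ^ 2 + 1) / κ) ^ r / r.factorial)) (fun j => ?_) ?_
      · have e1 := ih (h.shift 0 (j + 1))
        have e2 := ih (h.shift 2 j)
        have f1 := (h.tendsto_cycCoef j).ofReal
        have f2 := (h.tendsto_lineCoef j).ofReal
        rw [add_mul]
        exact ((f1.const_mul _).mul e1).add ((f2.const_mul _).mul e2)
      · filter_upwards [h.eventually_rateBound] with i hi
        exact norm_epsTerm_le hg hG hi
          (fun j => norm_eps_le hg hG r (hi.mono le_rfl (Nat.sub_le _ _)))
          (fun j => norm_eps_le hg hG r (hi.mono (Nat.sub_le _ _) (Nat.sub_le _ _)))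
    rw [tsum_mul_right] at hlim
    have := hlim.const_mul (1 / ((r : ℂ) + 1))
    convert this using 2
    have hr : (r : ℂ) + 1 ≠ 0 := by exact_mod_cast Nat.succ_ne_zero r
    rw [Nat.factorial_succ]
    push_cast
    change _ = 1 / ((r : ℂ) + 1) * (lcExponent g ρ p κ * _)
    field_simp
    ring

/-- Dominated convergence in `r`, with the summable majorant `epsBase ^ r / r!`, turns the limits
into the exponential series. -/
theorem tendsto_tsum_eps {g : ℕ → ℂ} {G : ℝ} (hg : ∀ k, ‖g k‖ ≤ G * (k : ℝ) ^ 2) (hG : 0 ≤ G)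
    (h : Regime l N a b c ρ p κ) :
    Tendsto (fun i => ∑' r, eps g (c i) r (a i) (b i)) l (𝓝 (Complex.exp (lcExponent g ρ p κ))) := by
  rw [Complex.exp_eq_exp_ℂ, NormedSpace.exp_eq_tsum_div]
  refine tendsto_tsum_of_dominated_convergence
    (Real.summable_pow_div_factorial (epsBase G ((1 + ratio p κ) / 2) ((ρ ^ 2 + 1) / κ)))
    (fun r => tendsto_eps hg hG r h) ?_
  filter_upwards [h.eventually_rateBound] with i hi r
  exact norm_eps_le hg hG r hi

end Regime

end ConfigModel
end

/-! ### First-moment bound for small stable sets with a vertex of degree at least three. -/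

noncomputable section

namespace ConfigModel

open Matching

variable {α V : Type*}

/-- A fixed set with `2 t` half-edges is stable with probability `C(m, t) / C(2m, 2t)`, and a single
term of Vandermonde's identity gives `C(2m, 2t) ≥ C(m, t) ^ 2`. -/
lemma numMatch_mul_numMatch_mul_choose_le {m t : ℕ} (h : t ≤ m) :
    numMatch (2 * t) * numMatch (2 * (m - t)) * m.choose t ≤ numMatch (2 * m) := by
  have h1 := numMatch_even_mul t
  have h2 := numMatch_even_mul (m - t)
  have h3 := numMatch_even_mul m
  have h4 := Nat.choose_mul_factorial_mul_factorial h
  have h5 := Nat.choose_mul_factorial_mul_factorial (show 2 * t ≤ 2 * m by omega)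
  rw [show 2 * m - 2 * t = 2 * (m - t) by omega, ← h1, ← h2, ← h3, ← h4] at h5
  have h6 : m.choose t * m.choose t ≤ (2 * m).choose (2 * t) := by
    rw [two_mul m, Nat.add_choose_eq]
    exact Finset.single_le_sum (f := fun ij : ℕ × ℕ => m.choose ij.1 * m.choose ij.2)
      (fun _ _ => Nat.zero_le _) (a := (t, t)) (Finset.HasAntidiagonal.mem_antidiagonal.2 (two_mul t).symm)
  have hpos : 0 < 2 ^ m * (t.factorial * (m - t).factorial) * m.choose t := by
    have := Nat.choose_pos h
    positivity
  have hpow : 2 ^ m = 2 ^ t * 2 ^ (m - t) := by rw [← pow_add]; congr 1; omega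
  refine Nat.le_of_mul_le_mul_right ?_ hpos
  calc numMatch (2 * t) * numMatch (2 * (m - t)) * m.choose t *
        (2 ^ m * (t.factorial * (m - t).factorial) * m.choose t)
      = (m.choose t * m.choose t) * (numMatch (2 * t) * (2 ^ t * t.factorial)) *
        (numMatch (2 * (m - t)) * (2 ^ (m - t) * (m - t).factorial)) := by rw [hpow]; ring
    _ ≤ (2 * m).choose (2 * t) * (numMatch (2 * t) * (2 ^ t * t.factorial)) *
        (numMatch (2 * (m - t)) * (2 ^ (m - t) * (m - t).factorial)) := by gcongr
    _ = _ := by rw [h5]; ring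

/-- The binomial sum is controlled by its largest term. -/
lemma one_add_pow_le {m t : ℕ} (h : 2 * t ≤ m) (ht : 1 ≤ t) :
    (1 + (t : ℝ) / (m - t)) ^ m ≤ (2 * t + 2) * (m.choose t * ((t : ℝ) / (m - t)) ^ t) := by
  set u : ℝ := (t : ℝ) / (m - t) with hu
  have hmt : (2 * t : ℝ) ≤ m := by exact_mod_cast h
  have ht0 : (1 : ℝ) ≤ t := by exact_mod_cast ht
  have hden : (0 : ℝ) < m - t := by linarith
  have hu0 : 0 < u := div_pos (by linarith) hden
  have hut : u * (m - t) = t := by rw [hu]; field_simp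
  set T : ℕ → ℝ := fun j => m.choose j * u ^ j with hT
  have hT0 : ∀ j, 0 ≤ T j := fun j => by simp only [hT]; positivity
  have hrec : ∀ j, j ≤ m → T (j + 1) * (j + 1) = T j * ((m - j) * u) := by
    intro j hj
    have := Nat.choose_succ_right_eq m j
    have h1 : ((m.choose (j + 1) : ℕ) : ℝ) * (j + 1) = m.choose j * ((m : ℝ) - j) := by
      rw [← Nat.cast_sub hj]
      exact_mod_cast this
    simp only [hT, pow_succ]
    linear_combination (u ^ j * u) * h1
  -- Consecutive terms have ratio `(m - j) u / (j + 1)`; the choice `u = t / (m - t)` places the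
  -- maximum at `j = t`.
  have hup : ∀ j, j < t → T j ≤ T (j + 1) := by
    intro j hj
    have h1 := hrec j (by omega)
    have hj' : (j : ℝ) + 1 ≤ t := by exact_mod_cast hj
    have h2 : (j : ℝ) + 1 ≤ (m - j) * u := by nlinarith
    have hj0 : (0 : ℝ) < (j : ℝ) + 1 := by positivity
    refine le_of_mul_le_mul_right ?_ hj0
    rw [h1]
    exact mul_le_mul_of_nonneg_left h2 (hT0 j)
  have hdown : ∀ j, t ≤ j → j ≤ m → T (j + 1) ≤ T j := by
    intro j hj hjm
    have h1 := hrec j hjm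
    have hj' : (t : ℝ) ≤ j := by exact_mod_cast hj
    have h2 : (m - j) * u ≤ (j : ℝ) + 1 := by nlinarith
    have hj0 : (0 : ℝ) < (j : ℝ) + 1 := by positivity
    refine le_of_mul_le_mul_right ?_ hj0
    rw [h1]
    exact mul_le_mul_of_nonneg_left h2 (hT0 j)
  -- From `2 t` on the ratio is at most one half, so the whole tail is dominated by `T (2 t)`.
  have hhalf : ∀ j, 2 * t ≤ j → j ≤ m → 2 * T (j + 1) ≤ T j := by
    intro j hj hjm
    have h1 := hrec j hjm
    have hj' : (2 * t : ℝ) ≤ j := by exact_mod_cast hj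
    have h2 : 2 * ((m - j) * u) ≤ (j : ℝ) + 1 := by nlinarith
    have hj0 : (0 : ℝ) < (j : ℝ) + 1 := by positivity
    refine le_of_mul_le_mul_right ?_ hj0
    rw [mul_assoc, h1]
    nlinarith [hT0 j]
  have hle : ∀ j, j ≤ m → T j ≤ T t := by
    intro j hj
    rcases le_total j t with hjt | hjt
    · exact Nat.decreasingInduction' (P := fun k => T k ≤ T t)
        (fun k hk _ hk2 => (hup k hk).trans hk2) hjt le_rfl
    · induction j, hjt using Nat.le_induction with
      | base => exact le_rfl
      | succ k hk ih => exact (hdown k hk (by omega)).trans (ih (by omega))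
  -- Counting the last term twice makes the left side nonincreasing in `k`, by the halving.
  have hsum : ∀ k, 2 * t ≤ k → k ≤ m →
      ∑ j ∈ Finset.range (k + 1), T j + T k ≤ (2 * t + 2) * T t := by
    intro k hk
    induction k, hk using Nat.le_induction with
    | base =>
      intro _
      have : ∑ j ∈ Finset.range (2 * t + 1), T j ≤ ∑ j ∈ Finset.range (2 * t + 1), T t :=
        Finset.sum_le_sum fun j hj => hle j (by have := Finset.mem_range.1 hj; omega)
      rw [Finset.sum_const, Finset.card_range, nsmul_eq_mul] at this
      push_cast at this
      linarith [hle (2 * t) h]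
    | succ k hk ih =>
      intro hkm
      rw [Finset.sum_range_succ]
      linarith [ih (by omega), hhalf k hk (by omega)]
  have hfin := hsum m h le_rfl
  have hbin : (1 + u) ^ m = ∑ j ∈ Finset.range (m + 1), T j := by
    rw [add_comm, add_pow]
    refine Finset.sum_congr rfl fun j _ => ?_
    simp [hT, mul_comm]
  rw [hbin]
  have : ((t : ℝ) / (m - t)) ^ t = u ^ t := rfl
  linarith [hT0 m]

/-- The vertices of degree at least three. -/
def heavy [Fintype V] (f : α → V) : Finset V := Finset.univ.filter fun v => 3 ≤ vdeg f v

@[simp] lemma mem_heavy [Fintype V] {f : α → V} {v : V} : v ∈ heavy f ↔ 3 ≤ vdeg f v := by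
  simp [heavy]

lemma sum_mem_prod_le [Fintype V] [DecidableEq V] (w : V → ℝ) (hw : ∀ v, 0 ≤ w v) (v : V) :
    ∑ A : Finset V with v ∈ A, ∏ u ∈ A, w u ≤ w v * ∏ u, (1 + w u) := by
  rw [Finset.prod_one_add, Finset.mul_sum]
  have h1 : ∑ A : Finset V with v ∈ A, ∏ u ∈ A, w u =
      ∑ A : Finset V with v ∈ A, w v * ∏ u ∈ A.erase v, w u :=
    Finset.sum_congr rfl fun A hA =>
      (Finset.mul_prod_erase A w (by simpa using hA)).symm
  rw [h1, ← Finset.sum_image (g := fun A : Finset V => A.erase v)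
    (f := fun B => w v * ∏ u ∈ B, w u)]
  · refine Finset.sum_le_sum_of_subset_of_nonneg (fun B _ => by simp) fun B _ _ =>
      mul_nonneg (hw v) (Finset.prod_nonneg fun u _ => hw u)
  · intro A hA B hB hAB
    have hA : v ∈ A := by simpa using hA
    have hB : v ∈ B := by simpa using hB
    rw [← Finset.insert_erase hA, ← Finset.insert_erase hB]
    exact congrArg _ hAB

/-- A union bound over a heavy vertex `v` in `A`. Its weight is at most `y ^ 3`, and the rest of `A`
ranges over subsets whose weights sum to at most the product. The exponent three is what later makes
the total vanish. -/
lemma sum_heavy_pow_le [Finite α] [Fintype V] (f : α → V) {y : ℝ} (hy0 : 0 ≤ y) (hy1 : y ≤ 1)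
    (S : Finset (Finset V)) (hS : ∀ A ∈ S, ∃ v ∈ A, 3 ≤ vdeg f v) :
    ∑ A ∈ S, y ^ tdeg f A ≤ (heavy f).card * y ^ 3 * ∏ v, (1 + y ^ vdeg f v) := by
  classical
  have hp : 0 ≤ ∏ v, (1 + y ^ vdeg f v) := Finset.prod_nonneg fun v _ => by positivity
  calc ∑ A ∈ S, y ^ tdeg f A
      ≤ ∑ A ∈ S, ∑ v ∈ heavy f, if v ∈ A then y ^ tdeg f A else 0 := by
        refine Finset.sum_le_sum fun A hA => ?_
        obtain ⟨v, hv, h3⟩ := hS A hA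
        refine le_trans (by rw [if_pos hv]) (Finset.single_le_sum
          (f := fun v => if v ∈ A then y ^ tdeg f A else 0) (fun u _ => ?_) (mem_heavy.2 h3))
        split_ifs <;> positivity
    _ ≤ ∑ A : Finset V, ∑ v ∈ heavy f, if v ∈ A then y ^ tdeg f A else 0 := by
        refine Finset.sum_le_sum_of_subset_of_nonneg (Finset.subset_univ _) fun A _ _ =>
          Finset.sum_nonneg fun u _ => ?_
        split_ifs <;> positivity
    _ = ∑ v ∈ heavy f, ∑ A : Finset V with v ∈ A, y ^ tdeg f A := by
        rw [Finset.sum_comm]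
        simp only [Finset.sum_filter]
    _ ≤ ∑ v ∈ heavy f, y ^ 3 * ∏ v, (1 + y ^ vdeg f v) := by
        refine Finset.sum_le_sum fun v hv => ?_
        simp only [tdeg_eq_sum, ← Finset.prod_pow_eq_pow_sum]
        refine (sum_mem_prod_le (fun v => y ^ vdeg f v) (fun v => by positivity) v).trans ?_
        exact mul_le_mul_of_nonneg_right (pow_le_pow_of_le_one hy0 hy1 (mem_heavy.1 hv)) hp
    _ = _ := by rw [Finset.sum_const, nsmul_eq_mul, mul_assoc]

/-- Relative to its share `(1 + y ^ 2) ^ (d / 2)`, a vertex of degree two is exactly neutral and one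
of degree at least three gains. The constant comes from `(1 + y ^ 3) ^ 2 ≤ (1 + y ^ 2) ^ 3 * (1 - y
^ 2 / 8)` by taking square roots. -/
lemma one_add_pow_le_heavy {y : ℝ} (hy0 : 0 ≤ y) (hy1 : y ≤ 1) {d : ℕ} (hd : 3 ≤ d) :
    1 + y ^ d ≤ √(1 + y ^ 2) ^ d * Real.exp (-(y ^ 2 / 16)) := by
  have hs1 : 1 ≤ √(1 + y ^ 2) := Real.one_le_sqrt.2 (by nlinarith)
  have hs2 : √(1 + y ^ 2) ^ 2 = 1 + y ^ 2 := Real.sq_sqrt (by positivity)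
  have h3 : 1 + y ^ 3 ≤ √(1 + y ^ 2) ^ 3 * Real.exp (-(y ^ 2 / 16)) := by
    refine le_of_sq_le_sq ?_ (by positivity)
    have he : 1 - y ^ 2 / 8 ≤ Real.exp (-(y ^ 2 / 16)) ^ 2 := by
      rw [← Real.exp_nat_mul]
      have := Real.add_one_le_exp (((2 : ℕ) : ℝ) * -(y ^ 2 / 16))
      push_cast at this ⊢
      linarith
    calc (1 + y ^ 3) ^ 2 ≤ (1 + y ^ 2) ^ 3 * (1 - y ^ 2 / 8) := by
          have hu1 : y ^ 2 ≤ 1 := pow_le_one₀ hy0 hy1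
          have hu0 : 0 ≤ y ^ 2 := by positivity
          have h32 : y ^ 3 ≤ y ^ 2 := pow_le_pow_of_le_one hy0 hy1 (by norm_num)
          have h4 : y ^ 6 ≤ y ^ 2 := pow_le_pow_of_le_one hy0 hy1 (by norm_num)
          have h5 : y ^ 8 ≤ y ^ 2 := pow_le_pow_of_le_one hy0 hy1 (by norm_num)
          have h6 : 0 ≤ y ^ 4 := by positivity
          nlinarith
      _ ≤ (1 + y ^ 2) ^ 3 * Real.exp (-(y ^ 2 / 16)) ^ 2 := by gcongr
      _ = (√(1 + y ^ 2) ^ 2) ^ 3 * Real.exp (-(y ^ 2 / 16)) ^ 2 := by rw [hs2]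
      _ = _ := by ring
  calc 1 + y ^ d ≤ 1 + y ^ 3 := by
        have := pow_le_pow_of_le_one hy0 hy1 hd
        linarith
    _ ≤ _ := h3
    _ ≤ _ := by gcongr

/-- Each vertex of degree one costs a factor `exp y`, each heavy vertex gains `exp (-y ^ 2 / 16)`,
and the neutral shares multiply to `(1 + y ^ 2) ^ m` because the degrees sum to `2 m`. -/
lemma prod_one_add_pow_le [Finite α] [Fintype V] (f : α → V) (hf : ∀ v, vdeg f v ≠ 0) {m : ℕ}
    (hm : Nat.card α = 2 * m) {y : ℝ} (hy0 : 0 ≤ y) (hy1 : y ≤ 1) :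
    ∏ v, (1 + y ^ vdeg f v) ≤ (1 + y ^ 2) ^ m *
      Real.exp ((ones f).card * y - (heavy f).card * (y ^ 2 / 16)) := by
  have hs1 : 1 ≤ √(1 + y ^ 2) := Real.one_le_sqrt.2 (by nlinarith)
  have hs2 : √(1 + y ^ 2) ^ 2 = 1 + y ^ 2 := Real.sq_sqrt (by positivity)
  have h1 : ∀ v, 1 + y ^ vdeg f v ≤ √(1 + y ^ 2) ^ vdeg f v *
      Real.exp ((if vdeg f v = 1 then y else 0) - if 3 ≤ vdeg f v then y ^ 2 / 16 else 0) := by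
    intro v
    obtain h | h | h : vdeg f v = 1 ∨ vdeg f v = 2 ∨ 3 ≤ vdeg f v := by
      have := hf v; omega
    · simp only [h, if_true, pow_one, show ¬ 3 ≤ 1 by norm_num, if_false, sub_zero]
      have := Real.add_one_le_exp y
      nlinarith [Real.exp_pos y]
    · simp [h, hs2]
    · rw [if_neg (by omega), if_pos h, zero_sub]
      exact one_add_pow_le_heavy hy0 hy1 h
  refine (Finset.prod_le_prod (fun v _ => by positivity) fun v _ => h1 v).trans_eq ?_
  rw [Finset.prod_mul_distrib, Finset.prod_pow_eq_pow_sum, ← tdeg_eq_sum, tdeg_univ, hm, pow_mul,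
    hs2, ← Real.exp_sum, Finset.sum_sub_distrib, ← Finset.sum_filter, ← Finset.sum_filter,
    Finset.sum_const, Finset.sum_const, nsmul_eq_mul, nsmul_eq_mul]
  rfl

/-- The number of vertices in stable sets that contain a vertex of degree at least three and at
most half of the half-edges. -/
def heavySize [Fintype V] (σ : Matching α) (f : α → V) : ℕ :=
  open scoped Classical in
  ∑ A : Finset V with (∃ v ∈ A, 3 ≤ vdeg f v) ∧ 2 * tdeg f A ≤ Nat.card α ∧ σ.Stable f A, A.card

/-- The bound on the contribution of the sets with `2 t` half-edges. -/
def heavyBound (n₁ h m t : ℕ) : ℝ :=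
  2 * t * (2 * t + 2) * (h * √((t : ℝ) / (m - t)) ^ 3 *
    Real.exp (n₁ * √((t : ℝ) / (m - t)) - h * (((t : ℝ) / (m - t)) / 16)))

/-- With `y ^ 2 = t / (m - t)`, `one_add_pow_le` bounds the number of sets by `C(m, t)` times
lower-order factors, and this binomial cancels against the bound on the probability of being stable.
-/
lemma sum_heavy_tdeg_le [Finite α] [Fintype V] (f : α → V) (hf : ∀ v, vdeg f v ≠ 0) {m t : ℕ}
    (hm : Nat.card α = 2 * m) (ht : 1 ≤ t) (htm : 2 * t ≤ m) (S : Finset (Finset V))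
    (hS : ∀ A ∈ S, (∃ v ∈ A, 3 ≤ vdeg f v) ∧ tdeg f A = 2 * t) :
    (∑ A ∈ S, (A.card : ℝ) * (numMatch (tdeg f A) * numMatch (2 * m - tdeg f A) : ℕ)) ≤
      numMatch (2 * m) * heavyBound (ones f).card (heavy f).card m t := by
  have hmt : (2 * t : ℝ) ≤ m := by exact_mod_cast htm
  have ht0 : (1 : ℝ) ≤ t := by exact_mod_cast ht
  have hden : (0 : ℝ) < m - t := by linarith
  set u : ℝ := (t : ℝ) / (m - t) with hu
  have hu0 : 0 < u := div_pos (by linarith) hden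
  have hu1 : u ≤ 1 := by rw [hu, div_le_one hden]; linarith
  set y : ℝ := √u with hy
  have hy0 : 0 < y := Real.sqrt_pos.2 hu0
  have hy1 : y ≤ 1 := Real.sqrt_le_one.2 hu1
  have hy2 : y ^ 2 = u := Real.sq_sqrt hu0.le
  set E : ℝ := Real.exp ((ones f).card * y - (heavy f).card * (u / 16)) with hE
  have hchoose : (0 : ℝ) < m.choose t := by exact_mod_cast Nat.choose_pos (by omega)
  have h1 : (S.card : ℝ) ≤ (heavy f).card * y ^ 3 * E * ((2 * t + 2) * m.choose t) := by
    have a1 := sum_heavy_pow_le f hy0.le hy1 S fun A hA => (hS A hA).1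
    rw [Finset.sum_congr rfl fun A hA => by rw [(hS A hA).2], Finset.sum_const, nsmul_eq_mul,
      pow_mul, hy2] at a1
    have a2 := prod_one_add_pow_le f hf hm hy0.le hy1
    rw [hy2] at a2
    have a3 := one_add_pow_le htm ht
    refine le_of_mul_le_mul_right ?_ (pow_pos hu0 t)
    calc (S.card : ℝ) * u ^ t ≤ _ := a1
      _ ≤ (heavy f).card * y ^ 3 * ((1 + u) ^ m * E) := by gcongr
      _ ≤ (heavy f).card * y ^ 3 * (((2 * t + 2) * (m.choose t * u ^ t)) * E) := by gcongr
      _ = _ := by ring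
  have h2 : ∀ A ∈ S, (A.card : ℝ) * (numMatch (tdeg f A) * numMatch (2 * m - tdeg f A) : ℕ) ≤
      2 * t * (numMatch (2 * m) / m.choose t) := by
    intro A hA
    have b1 : A.card ≤ 2 * t := by
      rw [← (hS A hA).2, tdeg_eq_sum, Finset.card_eq_sum_ones]
      exact Finset.sum_le_sum fun v _ => Nat.one_le_iff_ne_zero.2 (hf v)
    have b2 := numMatch_mul_numMatch_mul_choose_le (show t ≤ m by omega)
    rw [(hS A hA).2, show 2 * m - 2 * t = 2 * (m - t) by omega]
    refine mul_le_mul (by exact_mod_cast b1) ?_ (by positivity) (by positivity)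
    rw [le_div_iff₀ hchoose]
    exact_mod_cast b2
  refine (Finset.sum_le_card_nsmul _ _ _ h2).trans ?_
  rw [nsmul_eq_mul]
  calc (S.card : ℝ) * (2 * t * (numMatch (2 * m) / m.choose t))
      ≤ (heavy f).card * y ^ 3 * E * ((2 * t + 2) * m.choose t) *
        (2 * t * (numMatch (2 * m) / m.choose t)) := by gcongr
    _ = _ := by
      rw [heavyBound]
      change _ = (numMatch (2 * m) : ℝ) * (2 * t * (2 * t + 2) * ((heavy f).card * y ^ 3 * E))
      field_simp

lemma sum_heavySize_le [Finite α] [Fintype V] (f : α → V) (hf : ∀ v, vdeg f v ≠ 0) {m : ℕ}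
    (hm : Nat.card α = 2 * m) :
    ((∑ σ : Matching α, heavySize σ f : ℕ) : ℝ) ≤ numMatch (2 * m) *
      ∑ t ∈ (Finset.range (m + 1)).filter (fun t => 1 ≤ t ∧ 2 * t ≤ m),
        heavyBound (ones f).card (heavy f).card m t := by
  classical
  set S : Finset (Finset V) := Finset.univ.filter fun A =>
    (∃ v ∈ A, 3 ≤ vdeg f v) ∧ 2 * tdeg f A ≤ Nat.card α with hS
  have h1 : ((∑ σ : Matching α, heavySize σ f : ℕ) : ℝ) =
      ∑ A ∈ S, (A.card : ℝ) * (numMatch (tdeg f A) * numMatch (2 * m - tdeg f A) : ℕ) := by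
    have : ∀ σ : Matching α, heavySize σ f = ∑ A ∈ S, if σ.Stable f A then A.card else 0 := by
      intro σ
      rw [heavySize, ← Finset.sum_filter, hS, Finset.filter_filter]
      exact Finset.sum_congr (Finset.filter_congr fun A _ => by rw [and_assoc]) fun _ _ => rfl
    simp only [this]
    rw [Finset.sum_comm]
    push_cast
    refine Finset.sum_congr rfl fun A _ => ?_
    rw [← Nat.cast_mul, ← hm, ← card_stable f A, Nat.card_eq_fintype_card, Fintype.card_subtype,
      ← Finset.sum_filter, Finset.sum_const, nsmul_eq_mul, mul_comm]
  rw [h1, Finset.mul_sum]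
  set R := (Finset.range (m + 1)).filter (fun t => 1 ≤ t ∧ 2 * t ≤ m) with hR
  -- A set with an odd number of half-edges is never stable.
  have h2 : ∑ A ∈ S, (A.card : ℝ) * (numMatch (tdeg f A) * numMatch (2 * m - tdeg f A) : ℕ) =
      ∑ A ∈ S with Even (tdeg f A),
        (A.card : ℝ) * (numMatch (tdeg f A) * numMatch (2 * m - tdeg f A) : ℕ) := by
    refine (Finset.sum_filter_of_ne fun A _ h => ?_).symm
    by_contra ho
    obtain ⟨k, hk⟩ := Nat.not_even_iff_odd.1 ho
    rw [hk, numMatch_odd] at h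
    simp at h
  rw [h2, ← Finset.sum_fiberwise_of_maps_to (t := R) (g := fun A => tdeg f A / 2)]
  · refine Finset.sum_le_sum fun t ht => ?_
    rw [hR, Finset.mem_filter] at ht
    refine sum_heavy_tdeg_le f hf hm ht.2.1 ht.2.2 _ fun A hA => ?_
    rw [Finset.mem_filter, Finset.mem_filter, hS, Finset.mem_filter] at hA
    obtain ⟨⟨hA1, k, hk⟩, hA2⟩ := hA
    exact ⟨hA1.2.1, by omega⟩
  · intro A hA
    rw [Finset.mem_filter, hS, Finset.mem_filter] at hA
    obtain ⟨⟨-, ⟨v, hv, h3⟩, h4⟩, k, hk⟩ := hA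
    have : vdeg f v ≤ tdeg f A := by
      rw [tdeg_eq_sum]
      exact Finset.single_le_sum (f := fun v => vdeg f v) (fun _ _ => Nat.zero_le _) hv
    rw [hR, Finset.mem_filter, Finset.mem_range]
    omega

/-- The cost of the vertices of degree one is at most `C √(2t)`, which the square inequality absorbs
into half of the gain `c₀ t / 16`. The prefactor `h u ^ (3/2)` is of order `m (t / m) ^ (3/2)`, the
source of `1 / √m`. -/
lemma heavyBound_le {C c₀ : ℝ} (hC : 0 ≤ C) (hc₀ : 0 < c₀) {n₁ h m t : ℕ} (ht : 1 ≤ t)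
    (htm : 2 * t ≤ m) (h1 : (n₁ : ℝ) ≤ C * √m) (h2 : c₀ * m ≤ h) (h3 : h ≤ 2 * m) :
    heavyBound n₁ h m t ≤
      (48 * Real.exp (32 * C ^ 2 * 2 / c₀) * ((t : ℝ) ^ 4 * Real.exp (-(c₀ / 32)) ^ t)) / √m := by
  have hmt : (2 * t : ℝ) ≤ m := by exact_mod_cast htm
  have ht0 : (1 : ℝ) ≤ t := by exact_mod_cast ht
  have hden : (0 : ℝ) < m - t := by linarith
  have hm0 : (0 : ℝ) < m := by linarith
  have h3' : (h : ℝ) ≤ 2 * m := by exact_mod_cast h3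
  have hh0 : (0 : ℝ) ≤ h := Nat.cast_nonneg h
  have hu1 : (t : ℝ) / m ≤ (t : ℝ) / (m - t) := by gcongr; linarith
  have hu2 : (t : ℝ) / (m - t) ≤ 2 * t / m := by
    rw [div_le_div_iff₀ hden hm0]; nlinarith
  set u : ℝ := (t : ℝ) / (m - t) with hu
  have hu0 : 0 < u := div_pos (by linarith) hden
  have hsm : 0 < √(m : ℝ) := Real.sqrt_pos.2 hm0
  have hsm2 : √(m : ℝ) ^ 2 = m := Real.sq_sqrt hm0.le
  have hy : √u ≤ √(2 * t) / √m := by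
    rw [← Real.sqrt_div (by positivity)]
    exact Real.sqrt_le_sqrt hu2
  have hst : √(2 * (t : ℝ)) ^ 2 = 2 * t := Real.sq_sqrt (by positivity)
  have hst0 : 0 ≤ √(2 * (t : ℝ)) := Real.sqrt_nonneg _
  have hexp : n₁ * √u - h * (u / 16) ≤ 32 * C ^ 2 * 2 / c₀ + t * -(c₀ / 32) := by
    have e1 : n₁ * √u ≤ C * √(2 * t) := by
      calc (n₁ : ℝ) * √u ≤ C * √m * (√(2 * t) / √m) := by gcongr
        _ = _ := by field_simp
    have e2 : c₀ * t / 16 ≤ h * (u / 16) := by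
      calc c₀ * t / 16 = (c₀ * m) * ((t / m) / 16) := by field_simp
        _ ≤ _ := by gcongr
    have e3 : C * √(2 * t) ≤ 32 * C ^ 2 * 2 / c₀ + c₀ * t / 32 := by
      have : C * √(2 * t) * c₀ ≤ 32 * C ^ 2 * 2 + c₀ * t / 32 * c₀ := by
        nlinarith [sq_nonneg (8 * C - c₀ * √(2 * t) / 16), sq_nonneg (c₀ * √(2 * t)), sq_nonneg C]
      rw [← sub_nonneg]
      have h' : 32 * C ^ 2 * 2 / c₀ + c₀ * t / 32 - C * √(2 * t) =
          (32 * C ^ 2 * 2 + c₀ * t / 32 * c₀ - C * √(2 * t) * c₀) / c₀ := by field_simp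
      rw [h']
      exact div_nonneg (by linarith) hc₀.le
    linarith
  have hcube : (h : ℝ) * √u ^ 3 ≤ 6 * t ^ 2 / √m := by
    have e1 : √(2 * (t : ℝ)) ≤ 3 / 2 * t := by
      rw [Real.sqrt_le_left (by positivity)]
      nlinarith
    calc (h : ℝ) * √u ^ 3 ≤ (2 * m) * (√(2 * t) / √m) ^ 3 := by gcongr
      _ = 2 * (√(2 * t) ^ 2 * √(2 * t)) / √m := by
        rw [div_pow, pow_succ (√(m : ℝ)) 2, hsm2]
        field_simp
      _ ≤ 2 * (2 * t * (3 / 2 * t)) / √m := by rw [hst]; gcongr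
      _ = _ := by ring
  calc heavyBound n₁ h m t
      ≤ 2 * t * (4 * t) * (6 * t ^ 2 / √m *
          Real.exp (32 * C ^ 2 * 2 / c₀ + t * -(c₀ / 32))) := by
        rw [heavyBound]
        gcongr
        linarith
    _ = _ := by
      rw [Real.exp_add, ← Real.exp_nat_mul]
      ring

theorem exists_sum_heavySize_le {C c₀ : ℝ} (hC : 0 ≤ C) (hc₀ : 0 < c₀) : ∃ K : ℝ,
    ∀ {α V : Type} [Finite α] [Fintype V] (f : α → V) (m : ℕ), (∀ v, vdeg f v ≠ 0) →
      Nat.card α = 2 * m → ((ones f).card : ℝ) ≤ C * √m → c₀ * m ≤ (heavy f).card →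
      ((∑ σ : Matching α, heavySize σ f : ℕ) : ℝ) ≤ numMatch (2 * m) * (K / √m) := by
  have hq : ‖Real.exp (-(c₀ / 32))‖ < 1 := by
    rw [Real.norm_of_nonneg (Real.exp_pos _).le, Real.exp_lt_one_iff]
    linarith
  have hs := (summable_pow_mul_geometric_of_norm_lt_one 4 hq).mul_left
    (48 * Real.exp (32 * C ^ 2 * 2 / c₀))
  refine ⟨∑' t : ℕ, 48 * Real.exp (32 * C ^ 2 * 2 / c₀) * ((t : ℝ) ^ 4 * Real.exp (-(c₀ / 32)) ^ t),
    fun f m hf hm h1 h2 => (sum_heavySize_le f hf hm).trans ?_⟩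
  gcongr
  have h3 : (heavy f).card ≤ 2 * m := by
    rw [← hm, ← tdeg_univ f, tdeg_eq_sum, Finset.card_eq_sum_ones]
    exact (Finset.sum_le_sum fun v _ => Nat.one_le_iff_ne_zero.2 (hf v)).trans
      (Finset.sum_le_sum_of_subset (Finset.subset_univ _))
  refine (Finset.sum_le_sum fun t ht => ?_).trans (?_ : ∑ t ∈ (Finset.range (m + 1)).filter
    (fun t => 1 ≤ t ∧ 2 * t ≤ m), (48 * Real.exp (32 * C ^ 2 * 2 / c₀) *
      ((t : ℝ) ^ 4 * Real.exp (-(c₀ / 32)) ^ t)) / √m ≤ _)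
  · rw [Finset.mem_filter] at ht
    exact heavyBound_le hC hc₀ ht.2.1 ht.2.2 h1 h2 h3
  · rw [← Finset.sum_div]
    gcongr
    exact hs.sum_le_tsum _ fun t _ => by positivity

end ConfigModel
end

/-! ### Components of the graph, and the deterministic comparison with lines and cycles. -/

noncomputable section

namespace ConfigModel

open Matching

/-- The total number of vertices in line and cycle components. -/
def lcSize {α V : Type*} [Fintype V] (σ : Matching α) (f : α → V) : ℕ := ∑ A ∈ lc σ f, A.card

namespace DegreeSeq

variable {n : ℕ} (d : DegreeSeq n)

/-- The vertex of a half-edge. -/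
abbrev vert : d.HalfEdge → Fin n := Sigma.fst

/-- A pairing of the half-edges as a fixed-point-free involution. -/
def toMatching : d.Pairing ≃ Matching d.HalfEdge := Equiv.refl _

lemma vdeg_vert (v : Fin n) : vdeg d.vert v = d.deg v := by
  rw [vdeg, Nat.card_congr (Equiv.sigmaSubtype v), Nat.card_fin]

lemma card_halfEdge : Nat.card d.HalfEdge = ∑ v, d.deg v := by
  rw [← tdeg_univ d.vert, tdeg_eq_sum]
  exact Finset.sum_congr rfl fun v _ => d.vdeg_vert v

variable {d}

lemma stable_of_adj {σ : d.Pairing} {A : Finset (Fin n)} (hA : (d.toMatching σ).Stable d.vert A)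
    {u v : Fin n} (h : σ.graph.Adj u v) (hu : u ∈ A) : v ∈ A := by
  rw [Pairing.graph, SimpleGraph.fromRel_adj] at h
  obtain ⟨-, ⟨a, rfl, rfl⟩ | ⟨a, rfl, rfl⟩⟩ := h
  · exact hA a hu
  · exact (hA.iff a).2 hu

lemma stable_of_reachable {σ : d.Pairing} {A : Finset (Fin n)}
    (hA : (d.toMatching σ).Stable d.vert A)
    {u v : Fin n} (h : σ.graph.Reachable u v) (hu : u ∈ A) : v ∈ A := by
  obtain ⟨w⟩ := h
  induction w with
  | nil => exact hu
  | cons h _ ih => exact ih (stable_of_adj hA h hu)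

lemma reachable_partner (σ : d.Pairing) (a : d.HalfEdge) : σ.graph.Reachable a.1 (σ.1 a).1 := by
  by_cases h : a.1 = (σ.1 a).1
  · rw [← h]
  · exact SimpleGraph.Adj.reachable ((SimpleGraph.fromRel_adj _ _ _).2 ⟨h, Or.inl ⟨a, rfl, rfl⟩⟩)

open scoped Classical in
/-- The vertex set of the component of a vertex. -/
def compOf (σ : d.Pairing) (v : Fin n) : Finset (Fin n) :=
  Finset.univ.filter fun u => σ.graph.Reachable v u

lemma mem_compOf {σ : d.Pairing} {u v : Fin n} : u ∈ compOf σ v ↔ σ.graph.Reachable v u := by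
  simp [compOf]

lemma self_mem_compOf (σ : d.Pairing) (v : Fin n) : v ∈ compOf σ v :=
  mem_compOf.2 (SimpleGraph.Reachable.refl v)

lemma isComp_compOf (σ : d.Pairing) (v : Fin n) :
    (d.toMatching σ).IsComp d.vert (compOf σ v) where
  nonempty := ⟨v, self_mem_compOf σ v⟩
  stable := fun a ha => mem_compOf.2 ((mem_compOf.1 ha).trans (reachable_partner σ a))
  minimal := fun _ hB ⟨_, hu⟩ hs => hB.antisymm fun _ hw =>
    stable_of_reachable hs ((mem_compOf.1 (hB hu)).symm.trans (mem_compOf.1 hw)) hu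

lemma compOf_eq_of_mem {σ : d.Pairing} {A : Finset (Fin n)}
    (hA : (d.toMatching σ).IsComp d.vert A) {v : Fin n} (hv : v ∈ A) : compOf σ v = A :=
  (isComp_compOf σ v).eq_of_mem hA (self_mem_compOf σ v) hv

lemma maxComponentSize_eq (σ : d.Pairing) :
    σ.maxComponentSize = Finset.univ.sup fun v => (compOf σ v).card := by
  rw [Pairing.maxComponentSize]
  congr 1
  ext v
  rw [← Set.ncard_coe_finset]
  congr 1
  ext u
  rw [SimpleGraph.ConnectedComponent.mem_supp_iff, SimpleGraph.ConnectedComponent.eq,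
    SimpleGraph.reachable_comm]
  simp [mem_compOf]

lemma maxComponentSize_le (σ : d.Pairing) : σ.maxComponentSize ≤ n := by
  rw [maxComponentSize_eq]
  refine Finset.sup_le fun v _ => (Finset.card_le_univ _).trans_eq (Fintype.card_fin n)

lemma card_compOf_le (σ : d.Pairing) (v : Fin n) : (compOf σ v).card ≤ σ.maxComponentSize := by
  rw [maxComponentSize_eq]
  exact Finset.le_sup (f := fun v => (compOf σ v).card) (Finset.mem_univ v)

lemma connected_iff (σ : d.Pairing) (hn : 0 < n) :
    σ.graph.Connected ↔ σ.maxComponentSize = n := by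
  constructor
  · intro h
    have h1 := card_compOf_le σ ⟨0, hn⟩
    have h2 : compOf σ ⟨0, hn⟩ = Finset.univ := by
      ext u; simp [mem_compOf, h.preconnected _ u]
    rw [h2, Finset.card_univ, Fintype.card_fin] at h1
    exact (maxComponentSize_le σ).antisymm h1
  · intro h
    have hne : (Finset.univ : Finset (Fin n)).Nonempty := ⟨⟨0, hn⟩, Finset.mem_univ _⟩
    rw [maxComponentSize_eq] at h
    obtain ⟨v, -, hv⟩ := Finset.exists_mem_eq_sup _ hne fun v => (compOf σ v).card
    rw [h] at hv
    have h2 : compOf σ v = Finset.univ := by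
      rw [← Finset.card_eq_iff_eq_univ, ← hv, Fintype.card_fin]
    have : Nonempty (Fin n) := ⟨v⟩
    refine SimpleGraph.Connected.mk fun a b => ?_
    have ha : a ∈ compOf σ v := h2 ▸ Finset.mem_univ a
    have hb : b ∈ compOf σ v := h2 ▸ Finset.mem_univ b
    exact (mem_compOf.1 ha).symm.trans (mem_compOf.1 hb)

open scoped Classical in
lemma lcSize_eq (σ : d.Pairing) : lcSize (d.toMatching σ) d.vert =
    (Finset.univ.filter fun v => compOf σ v ∈ lc (d.toMatching σ) d.vert).card := by
  rw [Finset.card_eq_sum_card_fiberwise (f := compOf σ) (t := lc (d.toMatching σ) d.vert)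
    fun v hv => by simpa using hv, lcSize]
  refine Finset.sum_congr rfl fun A hA => ?_
  congr 1
  ext v
  simp only [Finset.mem_filter, Finset.mem_univ, true_and]
  constructor
  · intro hv
    rw [compOf_eq_of_mem (mem_lc.1 hA).2 hv]
    exact ⟨hA, rfl⟩
  · rintro ⟨-, rfl⟩
    exact self_mem_compOf σ v

lemma exists_heavy_of_not_mem_lc (hd : ∀ v, d.deg v ≠ 0) {σ : d.Pairing} {v : Fin n}
    (h : compOf σ v ∉ lc (d.toMatching σ) d.vert) : ∃ u ∈ compOf σ v, 3 ≤ vdeg d.vert u := by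
  by_contra! h'
  refine h (mem_lc.2 ⟨fun u hu => ?_, isComp_compOf σ v⟩)
  have h1 := h' u hu
  have h2 := hd u
  rw [← d.vdeg_vert] at h2
  rw [mem_low]
  omega

open scoped Classical in
lemma card_heavy_small_le (hd : ∀ v, d.deg v ≠ 0) (σ : d.Pairing) :
    (Finset.univ.filter fun v => compOf σ v ∉ lc (d.toMatching σ) d.vert ∧
      2 * tdeg d.vert (compOf σ v) ≤ Nat.card d.HalfEdge).card ≤
    heavySize (d.toMatching σ) d.vert := by
  rw [heavySize]
  refine le_trans (Finset.card_le_card ?_) Finset.card_biUnion_le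
  intro v hv
  simp only [Finset.mem_filter, Finset.mem_univ, true_and] at hv
  refine Finset.mem_biUnion.2 ⟨compOf σ v, ?_, self_mem_compOf σ v⟩
  simp only [Finset.mem_filter, Finset.mem_univ, true_and]
  exact ⟨exists_heavy_of_not_mem_lc hd hv.1, hv.2, (isComp_compOf σ v).stable⟩

lemma tdeg_add_le {α V : Type*} [Finite α] [DecidableEq V] (f : α → V) {A B : Finset V}
    (h : Disjoint A B) : tdeg f A + tdeg f B ≤ Nat.card α := by
  have : tdeg f (A ∪ B) = tdeg f A + tdeg f B := by
    simp only [tdeg_eq_sum]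
    exact Finset.sum_union h
  rw [← this]
  exact tdeg_le f _

/-- The number of vertices outside the largest component is the number of vertices in line and cycle
components, up to a small error. -/
theorem abs_sub_lcSize_le (hn : 0 < n) (hd : ∀ v, d.deg v ≠ 0) (σ : d.Pairing) :
    |((n : ℝ) - σ.maxComponentSize) - lcSize (d.toMatching σ) d.vert| ≤
      5 * heavySize (d.toMatching σ) d.vert + 16 * ((lcSize (d.toMatching σ) d.vert : ℝ) ^ 2 / n) := by
  classical
  set τ := d.toMatching σ with hτ
  set f := d.vert with hf
  set Y := lcSize τ f with hY
  set H := heavySize τ f with hH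
  set M := σ.maxComponentSize with hM
  set W := Finset.univ.filter fun v => compOf σ v ∉ lc τ f ∧
    ¬ 2 * tdeg f (compOf σ v) ≤ Nat.card d.HalfEdge with hW
  set Z := Finset.univ.filter fun v => compOf σ v ∉ lc τ f ∧
    2 * tdeg f (compOf σ v) ≤ Nat.card d.HalfEdge with hZ
  have hZH : Z.card ≤ H := card_heavy_small_le hd σ
  have hsum : Y + (Z.card + W.card) = n := by
    rw [hY, lcSize_eq, hZ, hW, ← Finset.filter_filter, ← Finset.filter_filter,
      Finset.card_filter_add_card_filter_not, Finset.card_filter_add_card_filter_not,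
      Finset.card_univ, Fintype.card_fin]
  have hMn : M ≤ n := maxComponentSize_le σ
  -- Two distinct components cannot both carry more than half of the half-edges, so `W` is empty or
  -- a single component.
  have hWc : ∀ v ∈ W, W = compOf σ v := by
    intro v hv
    have hv' := (Finset.mem_filter.1 hv).2
    ext u
    constructor
    · intro hu
      have hu' := (Finset.mem_filter.1 hu).2
      by_contra hne
      have hne' : compOf σ v ≠ compOf σ u := fun h => hne (h ▸ self_mem_compOf σ u)
      have := tdeg_add_le f ((isComp_compOf σ v).disjoint (isComp_compOf σ u) hne')
      omega
    · intro hu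
      have : compOf σ u = compOf σ v := compOf_eq_of_mem (isComp_compOf σ v) hu
      rw [hW, Finset.mem_filter, this]
      exact ⟨Finset.mem_univ _, hv'⟩
  have hWM : W.card ≤ M := by
    rcases W.eq_empty_or_nonempty with h | ⟨v, hv⟩
    · rw [h]; simp
    · rw [hWc v hv]; exact card_compOf_le σ v
  have hMW : n < 2 * W.card → M ≤ W.card := by
    intro h
    obtain ⟨v, hv⟩ : W.Nonempty := Finset.card_pos.1 (by omega)
    rw [hM, maxComponentSize_eq]
    refine Finset.sup_le fun u _ => ?_
    by_cases hu : compOf σ v = compOf σ u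
    · rw [← hu, ← hWc v hv]
    · have h1 := Finset.card_union_of_disjoint
        ((isComp_compOf σ v).disjoint (isComp_compOf σ u) hu)
      have h2 := Finset.card_le_univ (compOf σ v ∪ compOf σ u)
      rw [h1, ← hWc v hv, Fintype.card_fin] at h2
      omega
  have hn' : (0 : ℝ) < n := by exact_mod_cast hn
  have hsq : 0 ≤ (Y : ℝ) ^ 2 / n := by positivity
  have e1 : (Y : ℝ) + (Z.card + W.card) = n := by exact_mod_cast hsum
  have e2 : (Z.card : ℝ) ≤ H := by exact_mod_cast hZH
  have e3 : (W.card : ℝ) ≤ M := by exact_mod_cast hWM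
  have e4 : (M : ℝ) ≤ n := by exact_mod_cast hMn
  have e5 : (0 : ℝ) ≤ Z.card := Nat.cast_nonneg _
  have e6 : (0 : ℝ) ≤ W.card := Nat.cast_nonneg _
  have e7 : (0 : ℝ) ≤ Y := Nat.cast_nonneg _
  rw [abs_le]
  refine ⟨?_, by linarith⟩
  -- If `W` has more than half of the vertices, it is a largest component. Otherwise `Z` or the
  -- lines and cycles occupy at least `n / 4` vertices, and then `Y ≤ 4 H` or `Y ≤ 4 Y ^ 2 / n`.
  by_cases hc : n < 2 * W.card
  · have e8 : (M : ℝ) ≤ W.card := by exact_mod_cast hMW hc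
    linarith
  · have e8 : 2 * (W.card : ℝ) ≤ n := by exact_mod_cast not_lt.1 hc
    by_cases hz : (n : ℝ) ≤ 4 * Z.card
    · linarith
    · have e9 : (n : ℝ) ≤ 4 * Y := by linarith
      have : (Y : ℝ) ≤ 4 * (Y ^ 2 / n) := by
        rw [← mul_div_assoc, le_div_iff₀ hn']
        nlinarith
      linarith

variable (d)

lemma integral_cmMeasure {E : Type*} [NormedAddCommGroup E] [NormedSpace ℝ E] [CompleteSpace E]
    (F : Matching d.HalfEdge → E) :
    ∫ σ, F (d.toMatching σ) ∂d.cmMeasure =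
      (numMatch (Nat.card d.HalfEdge) : ℝ)⁻¹ • ∑ σ, F σ := by
  have hc : Fintype.card d.Pairing = numMatch (Nat.card d.HalfEdge) := by
    rw [Nat.card_eq_fintype_card, ← card_eq_numMatch, Fintype.card_congr d.toMatching]
  rw [cmMeasure, PMF.integral_eq_sum, Finset.smul_sum, ← d.toMatching.sum_comp]
  refine Finset.sum_congr rfl fun σ _ => ?_
  rw [PMF.uniformOfFintype_apply, hc]
  simp

end DegreeSeq

section moments

variable {α V : Type*}

lemma esum_one (g : ℕ → ℂ) (S : Finset (Finset V)) : esum g S 1 = ∑ A ∈ S, g A.card := by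
  rw [esum, Finset.powersetCard_one, Finset.sum_map]
  simp

/-- Off-diagonal pairs give the second elementary symmetric function and the diagonal gives the sum
of squares, so second moments of `lcSize` follow from the convergence already proved. -/
lemma sum_sq_eq_esum (S : Finset (Finset V)) :
    ((∑ A ∈ S, A.card : ℕ) : ℂ) ^ 2 = 2 * esum (fun k => (k : ℂ)) S 2 +
      esum (fun k => (k : ℂ) ^ 2) S 1 := by
  classical
  have h := esum_succ (fun k => (k : ℂ)) S 1
  have h1 : ∀ A ∈ S, (A.card : ℂ) * esum (fun k => (k : ℂ)) (S.erase A) 1 =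
      (A.card : ℂ) * (∑ B ∈ S, (B.card : ℂ)) - (A.card : ℂ) ^ 2 := by
    intro A hA
    rw [esum_one, ← Finset.add_sum_erase S _ hA]
    ring
  rw [Finset.sum_congr rfl h1, Finset.sum_sub_distrib, ← Finset.sum_mul] at h
  rw [esum_one]
  push_cast at h ⊢
  rw [show (1 : ℂ) + 1 = 2 by norm_num] at h
  rw [h]
  ring

end moments

end ConfigModel
end

/-! ### Asymptotics in the critical window. -/

noncomputable section

namespace ConfigModel

open Matching

lemma tendsto_div_of_tendsto_div_sqrt {ι : Type*} {l : Filter ι} {a N : ι → ℝ} {ρ : ℝ}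
    (hN : Tendsto N l atTop) (ha : Tendsto (fun i => a i / √(N i)) l (𝓝 ρ)) :
    Tendsto (fun i => a i / N i) l (𝓝 0) := by
  have h0 : Tendsto (fun i => (1 : ℝ) / √(N i)) l (𝓝 0) :=
    (Real.tendsto_sqrt_atTop.comp hN).const_div_atTop _
  have h1 := ha.mul h0
  rw [mul_zero] at h1
  refine h1.congr' ?_
  filter_upwards [hN.eventually_gt_atTop 0] with i hi
  rw [div_mul_div_comm, mul_one, Real.mul_self_sqrt hi.le]

namespace DegreeSeq

variable {n : ℕ} (d : DegreeSeq n)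

lemma card_ones : (ones d.vert).card = d.numDeg 1 := by
  rw [ones, numDeg]
  congr 1
  ext v
  simp [vdeg_vert]

lemma card_twos : (twos d.vert).card = d.numDeg 2 := by
  rw [twos, numDeg]
  congr 1
  ext v
  simp [vdeg_vert]

/-- The number of half-edges at vertices of degree other than one and two. -/
def highDeg : ℕ := Nat.card d.HalfEdge - (d.numDeg 1 + 2 * d.numDeg 2)

variable {d}

lemma deg_ne_zero (h : d.numDeg 0 = 0) (v : Fin n) : d.deg v ≠ 0 := fun hv => by
  have : v ∈ Finset.univ.filter fun v : Fin n => d.deg v = 0 := by simp [hv]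
  rw [Finset.card_eq_zero.1 h] at this
  simp at this

lemma card_heavy_add (h : d.numDeg 0 = 0) :
    (heavy d.vert).card + d.numDeg 1 + d.numDeg 2 = n := by
  rw [← card_ones, ← card_twos, ones, twos, heavy, Finset.card_filter, Finset.card_filter,
    Finset.card_filter, ← Finset.sum_add_distrib, ← Finset.sum_add_distrib]
  conv_rhs => rw [← Fintype.card_fin n, ← Finset.card_univ, Finset.card_eq_sum_ones]
  refine Finset.sum_congr rfl fun v _ => ?_
  have := deg_ne_zero h v
  rw [← vdeg_vert] at this
  obtain h | h | h : vdeg d.vert v = 1 ∨ vdeg d.vert v = 2 ∨ 3 ≤ vdeg d.vert v := by omega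
  · simp [h]
  · simp [h]
  · rw [if_pos h, if_neg (by omega), if_neg (by omega)]

lemma le_card_halfEdge :
    3 * (heavy d.vert).card + d.numDeg 1 + 2 * d.numDeg 2 ≤ Nat.card d.HalfEdge := by
  rw [← card_ones, ← card_twos, ones, twos, heavy, Finset.card_filter, Finset.card_filter,
    Finset.card_filter, Finset.mul_sum, Finset.mul_sum, ← Finset.sum_add_distrib,
    ← Finset.sum_add_distrib, ← tdeg_univ d.vert, tdeg_eq_sum]
  refine Finset.sum_le_sum fun v _ => ?_
  split_ifs <;> omega

lemma card_halfEdge_eq :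
    Nat.card d.HalfEdge = d.numDeg 1 + 2 * d.numDeg 2 + d.highDeg := by
  have := d.le_card_halfEdge
  rw [highDeg]
  omega

lemma even_card_halfEdge : Even (Nat.card d.HalfEdge) := d.card_halfEdge ▸ d.even_total

lemma numMatch_card_pos : 0 < numMatch (Nat.card d.HalfEdge) := by
  obtain ⟨m, hm⟩ := d.even_card_halfEdge
  rw [hm, ← two_mul]
  exact numMatch_even_pos m

lemma integral_esum (g : ℕ → ℂ) (r : ℕ) :
    ∫ σ, esum g (lc (d.toMatching σ) d.vert) r ∂d.cmMeasure =
      eps g d.highDeg r (d.numDeg 1) (d.numDeg 2) := by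
  rw [d.integral_cmMeasure fun σ => esum g (lc σ d.vert) r]
  have h := total_eq g r d.HalfEdge d.vert _ _ _ d.card_halfEdge_eq d.card_ones d.card_twos
  rw [total] at h
  have hpos : (numMatch (Nat.card d.HalfEdge) : ℂ) ≠ 0 := by
    exact_mod_cast d.numMatch_card_pos.ne'
  rw [h, Complex.real_smul]
  push_cast
  field_simp

lemma integral_prod_one_add (g : ℕ → ℂ) :
    ∫ σ, ∏ A ∈ lc (d.toMatching σ) d.vert, (1 + g A.card) ∂d.cmMeasure =
      ∑' r, eps g d.highDeg r (d.numDeg 1) (d.numDeg 2) := by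
  -- A bound on the number of components uniform in the pairing makes the series finite, so it may
  -- be exchanged with the expectation.
  set R := Fintype.card (Finset (Fin n)) + 1
  have hle : ∀ σ : d.Pairing, (lc (d.toMatching σ) d.vert).card < R := fun σ =>
    Nat.lt_succ_of_le (Finset.card_le_univ _)
  rw [tsum_eq_sum (s := Finset.range R)]
  · simp only [← integral_esum]
    rw [← integral_finsetSum _ fun r _ => Integrable.of_finite]
    refine integral_congr_ae (ae_of_all _ fun σ => ?_)
    simp only
    rw [prod_one_add_eq_sum_esum]
    refine Finset.sum_subset (Finset.range_mono (hle σ)) fun r _ hr => esum_eq_zero g ?_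
    simpa using hr
  · intro r hr
    rw [← integral_esum]
    have hr : R ≤ r := by simpa using hr
    simp [fun σ => esum_eq_zero g ((hle σ).trans_le hr)]

end DegreeSeq

namespace CriticalWindow

variable {d : (n : ℕ+) → DegreeSeq n} {ρ₁ p₂ dbar : ℝ}

lemma tendsto_cast_atTop : Tendsto (fun n : ℕ+ => (n : ℝ)) atTop atTop :=
  tendsto_natCast_atTop_atTop.comp (tendsto_atTop_atTop.2 fun b => ⟨b.succPNat, fun _ ha =>
    (Nat.le_succ b).trans (PNat.coe_le_coe _ _ |>.2 ha)⟩)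

lemma tendsto_card (hd : CriticalWindow d ρ₁ p₂ dbar) :
    Tendsto (fun n : ℕ+ => (Nat.card (d n).HalfEdge : ℝ) / n) atTop (𝓝 dbar) := by
  refine hd.mean_tendsto.congr fun n => ?_
  rw [uniformVertex, PMF.integral_eq_sum, DegreeSeq.card_halfEdge]
  simp only [PMF.uniformOfFintype_apply, Fintype.card_fin, smul_eq_mul, ENNReal.toReal_inv,
    ENNReal.toReal_natCast]
  rw [← Finset.mul_sum]
  push_cast
  rw [div_eq_inv_mul]

lemma tendsto_heavy (hd : CriticalWindow d ρ₁ p₂ dbar) :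
    Tendsto (fun n : ℕ+ => ((heavy (d n).vert).card : ℝ) / n) atTop (𝓝 (1 - p₂)) := by
  have h1 := tendsto_div_of_tendsto_div_sqrt tendsto_cast_atTop hd.numDeg_one
  have h2 := (tendsto_const_nhds (x := (1 : ℝ))).sub (h1.add hd.numDeg_two)
  rw [zero_add] at h2
  refine h2.congr fun n => ?_
  have h3 := DegreeSeq.card_heavy_add (hd.numDeg_zero n)
  have h4 : ((heavy (d n).vert).card : ℝ) + (d n).numDeg 1 + (d n).numDeg 2 = n := by
    exact_mod_cast h3
  have hn : (n : ℝ) ≠ 0 := by exact_mod_cast n.ne_zero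
  field_simp
  linarith

/-- With no vertices of degree zero, asymptotically `(1 - p₂) n` vertices have degree at least
three. This yields `dbar - 2 * p₂ ≥ 3 (1 - p₂) > 0`. -/
lemma three_le (hd : CriticalWindow d ρ₁ p₂ dbar) : 3 - p₂ ≤ dbar := by
  have h1 := tendsto_div_of_tendsto_div_sqrt tendsto_cast_atTop hd.numDeg_one
  have h2 := ((hd.tendsto_heavy.const_mul 3).add h1).add (hd.numDeg_two.const_mul 2)
  rw [show 3 * (1 - p₂) + 0 + 2 * p₂ = 3 - p₂ by ring] at h2
  refine le_of_tendsto_of_tendsto' h2 hd.tendsto_card fun n => ?_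
  rw [← mul_div_assoc, ← mul_div_assoc, ← add_div, ← add_div]
  gcongr
  exact_mod_cast (d n).le_card_halfEdge

lemma κ_pos (hd : CriticalWindow d ρ₁ p₂ dbar) : 0 < dbar - 2 * p₂ := by
  have := hd.three_le
  have := hd.p_lt_one
  linarith

lemma dbar_pos (hd : CriticalWindow d ρ₁ p₂ dbar) : 0 < dbar := by
  have := hd.κ_pos
  have := hd.p_nonneg
  linarith

lemma regime (hd : CriticalWindow d ρ₁ p₂ dbar) :
    Regime atTop (fun n : ℕ+ => (n : ℝ)) (fun n => (d n).numDeg 1) (fun n => (d n).numDeg 2)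
      (fun n => (d n).highDeg) ρ₁ p₂ (dbar - 2 * p₂) where
  tendsto_N := tendsto_cast_atTop
  tendsto_a := hd.numDeg_one
  tendsto_b := hd.numDeg_two
  tendsto_c := by
    have h1 := tendsto_div_of_tendsto_div_sqrt tendsto_cast_atTop hd.numDeg_one
    have h2 := hd.tendsto_card.sub (h1.add (hd.numDeg_two.const_mul 2))
    rw [zero_add] at h2
    refine h2.congr fun n => ?_
    rw [(d n).card_halfEdge_eq]
    push_cast
    ring
  p_nonneg := hd.p_nonneg
  κ_pos := hd.κ_pos

/-- The expected number of vertices in small stable sets with a vertex of degree at least three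
vanishes. -/
lemma tendsto_integral_heavySize (hd : CriticalWindow d ρ₁ p₂ dbar) :
    Tendsto (fun n : ℕ+ => ∫ σ, (heavySize ((d n).toMatching σ) (d n).vert : ℝ) ∂(d n).cmMeasure)
      atTop (𝓝 0) := by
  have hdb := hd.dbar_pos
  have hp := hd.p_lt_one
  have hρ := hd.rho_nonneg
  have hs : 0 < √(dbar / 2) := Real.sqrt_pos.2 (by linarith)
  -- Since `m / n → dbar / 2`, these constants make `C √m / √n → ρ₁ + 1` and `c₀ m / n → (1 - p₂) /
  -- 2`, strictly on the required sides of the limits `ρ₁` and `1 - p₂`.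
  obtain ⟨K, hK⟩ := exists_sum_heavySize_le (C := (ρ₁ + 1) / √(dbar / 2)) (c₀ := (1 - p₂) / dbar)
    (by positivity) (div_pos (by linarith) hdb)
  have hm : Tendsto (fun n : ℕ+ => ((Nat.card (d n).HalfEdge : ℝ) / 2) / n) atTop
      (𝓝 (dbar / 2)) := by
    refine (hd.tendsto_card.div_const 2).congr fun n => ?_
    rw [div_right_comm]
  have hmtop : Tendsto (fun n : ℕ+ => (Nat.card (d n).HalfEdge : ℝ) / 2) atTop atTop := by
    refine (hm.pos_mul_atTop (by linarith) tendsto_cast_atTop).congr fun n => ?_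
    have hn : (n : ℝ) ≠ 0 := by exact_mod_cast n.ne_zero
    field_simp
  have hlim : Tendsto (fun n : ℕ+ => K / √((Nat.card (d n).HalfEdge : ℝ) / 2)) atTop (𝓝 0) :=
    (Real.tendsto_sqrt_atTop.comp hmtop).const_div_atTop K
  have h1 : Tendsto (fun n : ℕ+ => (ρ₁ + 1) / √(dbar / 2) *
      √(((Nat.card (d n).HalfEdge : ℝ) / 2) / n)) atTop (𝓝 (ρ₁ + 1)) := by
    have := (hm.sqrt).const_mul ((ρ₁ + 1) / √(dbar / 2))
    rwa [div_mul_cancel₀ _ hs.ne'] at this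
  have h2 : Tendsto (fun n : ℕ+ => (1 - p₂) / dbar * (((Nat.card (d n).HalfEdge : ℝ) / 2) / n))
      atTop (𝓝 ((1 - p₂) / 2)) := by
    have := hm.const_mul ((1 - p₂) / dbar)
    rwa [show (1 - p₂) / dbar * (dbar / 2) = (1 - p₂) / 2 by field_simp] at this
  refine tendsto_of_tendsto_of_tendsto_of_le_of_le' tendsto_const_nhds hlim
    (Eventually.of_forall fun n => integral_nonneg fun σ => Nat.cast_nonneg _) ?_
  filter_upwards [hd.numDeg_one.eventually_lt h1 (by linarith),
    h2.eventually_lt hd.tendsto_heavy (by linarith)] with n e1 e2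
  have hn : (0 : ℝ) < n := by exact_mod_cast n.pos
  have hsn : 0 < √(n : ℝ) := Real.sqrt_pos.2 hn
  obtain ⟨m, hm⟩ := (d n).even_card_halfEdge
  rw [← two_mul] at hm
  have hm' : (Nat.card (d n).HalfEdge : ℝ) / 2 = m := by rw [hm]; push_cast; ring
  rw [hm'] at e1 e2 ⊢
  have key := hK (d n).vert m (fun v => by
    rw [DegreeSeq.vdeg_vert]; exact DegreeSeq.deg_ne_zero (hd.numDeg_zero n) v) hm ?_ ?_
  · rw [(d n).integral_cmMeasure fun σ => (heavySize σ (d n).vert : ℝ), smul_eq_mul, hm,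
      inv_mul_le_iff₀ (by exact_mod_cast numMatch_even_pos m)]
    exact_mod_cast key
  · rw [DegreeSeq.card_ones]
    rw [Real.sqrt_div (Nat.cast_nonneg m), ← mul_div_assoc] at e1
    exact ((div_lt_div_iff_of_pos_right hsn).1 e1).le
  · rw [← mul_div_assoc] at e2
    exact ((div_lt_div_iff_of_pos_right hn).1 e2).le

lemma tendsto_integral_esum (hd : CriticalWindow d ρ₁ p₂ dbar) {g : ℕ → ℂ} {G : ℝ}
    (hg : ∀ k, ‖g k‖ ≤ G * (k : ℝ) ^ 2) (hG : 0 ≤ G) (r : ℕ) :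
    Tendsto (fun n => ∫ σ, esum g (lc ((d n).toMatching σ) (d n).vert) r ∂(d n).cmMeasure) atTop
      (𝓝 (lcExponent g ρ₁ p₂ (dbar - 2 * p₂) ^ r / r.factorial)) := by
  simp only [DegreeSeq.integral_esum]
  exact hd.regime.tendsto_eps hg hG r

lemma tendsto_integral_prod (hd : CriticalWindow d ρ₁ p₂ dbar) {g : ℕ → ℂ} {G : ℝ}
    (hg : ∀ k, ‖g k‖ ≤ G * (k : ℝ) ^ 2) (hG : 0 ≤ G) :
    Tendsto (fun n => ∫ σ, ∏ A ∈ lc ((d n).toMatching σ) (d n).vert, (1 + g A.card)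
      ∂(d n).cmMeasure) atTop (𝓝 (Complex.exp (lcExponent g ρ₁ p₂ (dbar - 2 * p₂)))) := by
  simp only [DegreeSeq.integral_prod_one_add]
  exact hd.regime.tendsto_tsum_eps hg hG

lemma norm_natCast_le_sq (k : ℕ) : ‖(k : ℂ)‖ ≤ 1 * (k : ℝ) ^ 2 := by
  rw [Complex.norm_natCast, one_mul]
  exact_mod_cast Nat.le_self_pow two_ne_zero k

lemma tendsto_integral_lcSize (hd : CriticalWindow d ρ₁ p₂ dbar) :
    Tendsto (fun n => ∫ σ, (lcSize ((d n).toMatching σ) (d n).vert : ℝ) ∂(d n).cmMeasure) atTop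
      (𝓝 (lcExponent (fun k => (k : ℂ)) ρ₁ p₂ (dbar - 2 * p₂)).re) := by
  have h := (hd.tendsto_integral_esum norm_natCast_le_sq zero_le_one 1)
  simp only [pow_one, Nat.factorial_one, Nat.cast_one, div_one] at h
  refine ((Complex.continuous_re.tendsto _).comp h).congr fun n => ?_
  simp only [Function.comp]
  have : ∀ σ : (d n).Pairing, esum (fun k => (k : ℂ)) (lc ((d n).toMatching σ) (d n).vert) 1 =
      ((lcSize ((d n).toMatching σ) (d n).vert : ℝ) : ℂ) := fun σ => by
    rw [esum_one, lcSize]; push_cast; rfl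
  simp only [this]
  rw [integral_complex_ofReal, Complex.ofReal_re]

/-- The second moment of `lcSize` converges, so dividing it by `n` sends it to zero. This is the
quadratic error term of `abs_sub_lcSize_le`. -/
lemma tendsto_integral_lcSize_sq (hd : CriticalWindow d ρ₁ p₂ dbar) :
    Tendsto (fun n : ℕ+ => ∫ σ, (lcSize ((d n).toMatching σ) (d n).vert : ℝ) ^ 2 / n
      ∂(d n).cmMeasure) atTop (𝓝 0) := by
  have h2 := (hd.tendsto_integral_esum norm_natCast_le_sq zero_le_one 2).const_mul 2
  have h1 := hd.tendsto_integral_esum (g := fun k => (k : ℂ) ^ 2) (G := 1)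
    (fun k => by rw [norm_pow, Complex.norm_natCast, one_mul]) zero_le_one 1
  have h3 := ((Complex.continuous_re.tendsto _).comp (h2.add h1)).div_atTop tendsto_cast_atTop
  refine h3.congr fun n => ?_
  rw [integral_div]
  congr 1
  simp only [Function.comp]
  rw [← integral_const_mul, ← integral_add Integrable.of_finite Integrable.of_finite]
  have : ∀ σ : (d n).Pairing, 2 * esum (fun k => (k : ℂ)) (lc ((d n).toMatching σ) (d n).vert) 2 +
      esum (fun k => (k : ℂ) ^ 2) (lc ((d n).toMatching σ) (d n).vert) 1 =
      (((lcSize ((d n).toMatching σ) (d n).vert : ℝ) ^ 2 : ℝ) : ℂ) := fun σ => by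
    rw [← sum_sq_eq_esum, lcSize]; push_cast; rfl
  simp only [this]
  rw [integral_complex_ofReal, Complex.ofReal_re]

/-- The number of vertices outside the largest component and the number of vertices in line and
cycle components are close in mean. -/
theorem tendsto_integral_abs_sub (hd : CriticalWindow d ρ₁ p₂ dbar) :
    Tendsto (fun n : ℕ+ => ∫ σ, |((n : ℝ) - (σ.maxComponentSize : ℝ)) -
      lcSize ((d n).toMatching σ) (d n).vert| ∂(d n).cmMeasure) atTop (𝓝 0) := by
  have h1 := (hd.tendsto_integral_heavySize.const_mul 5).add
    (hd.tendsto_integral_lcSize_sq.const_mul 16)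
  rw [mul_zero, mul_zero, add_zero] at h1
  refine squeeze_zero (fun n => integral_nonneg fun σ => abs_nonneg _) (fun n => ?_) h1
  rw [← integral_const_mul, ← integral_const_mul,
    ← integral_add Integrable.of_finite Integrable.of_finite]
  exact integral_mono Integrable.of_finite Integrable.of_finite fun σ =>
    DegreeSeq.abs_sub_lcSize_le n.pos (DegreeSeq.deg_ne_zero (hd.numDeg_zero n)) σ

end CriticalWindow

end ConfigModel
end

/-! ### Closed forms of the exponent; the connectivity, mean and characteristic function limits. -/

noncomputable section

namespace ConfigModel

open Matching

section closedForms

variable {ρ p κ : ℝ}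

lemma ratio_nonneg (hp : 0 ≤ p) (hκ : 0 < κ) : 0 ≤ ratio p κ := by
  unfold ratio; positivity

lemma one_sub_ratio (hp : 0 ≤ p) (hκ : 0 < κ) : 1 - ratio p κ = κ / (κ + 2 * p) := by
  unfold ratio
  have : κ + 2 * p ≠ 0 := by positivity
  field_simp
  ring

lemma ratio_lt_one (hp : 0 ≤ p) (hκ : 0 < κ) : ratio p κ < 1 := by
  have h := one_sub_ratio hp hκ
  have : 0 < κ / (κ + 2 * p) := by positivity
  linarith

/-- Half of the series of `-log (1 - x)` at `x = ratio p κ`; the half is the source of the exponent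
`1 / 2` in the connectivity probability. -/
lemma hasSum_cycLim (hp : 0 ≤ p) (hκ : 0 < κ) :
    HasSum (cycLim p κ) (-Real.log (κ / (κ + 2 * p)) / 2) := by
  have h := (Real.hasSum_pow_div_log_of_abs_lt_one (x := ratio p κ)
    (by rw [abs_of_nonneg (ratio_nonneg hp hκ)]; exact ratio_lt_one hp hκ)).div_const 2
  rw [one_sub_ratio hp hκ] at h
  refine h.congr_fun fun j => ?_
  rw [cycLim]
  field_simp

lemma hasSum_lineLim (hp : 0 ≤ p) (hκ : 0 < κ) :
    HasSum (lineLim ρ p κ) (ρ ^ 2 / (2 * κ)) := by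
  have h := ((hasSum_geometric_of_lt_one (ratio_nonneg hp hκ) (ratio_lt_one hp hκ)).div_const
    (κ + 2 * p)).mul_left (ρ ^ 2 / 2)
  rw [one_sub_ratio hp hκ] at h
  have e : ρ ^ 2 / (2 * κ) = ρ ^ 2 / 2 * ((κ / (κ + 2 * p))⁻¹ / (κ + 2 * p)) := by
    field_simp
  rw [e]
  exact h

lemma lcExponent_eq_of_neg_one {g : ℕ → ℂ} (hg : ∀ k, g (k + 1) = -1) (hp : 0 ≤ p) (hκ : 0 < κ) :
    lcExponent g ρ p κ =
      ((Real.log (κ / (κ + 2 * p)) / 2 - ρ ^ 2 / (2 * κ) : ℝ) : ℂ) := by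
  have h := Complex.hasSum_ofReal.2 (((hasSum_cycLim hp hκ).add (hasSum_lineLim (ρ := ρ) hp hκ)).neg)
  rw [lcExponent, show Real.log (κ / (κ + 2 * p)) / 2 - ρ ^ 2 / (2 * κ) =
    -(-Real.log (κ / (κ + 2 * p)) / 2 + ρ ^ 2 / (2 * κ)) by ring, ← h.tsum_eq]
  refine tsum_congr fun j => ?_
  rw [hg, hg (j + 1)]
  push_cast
  ring

lemma lcExponent_id (hp : 0 ≤ p) (hκ : 0 < κ) :
    lcExponent (fun k => (k : ℂ)) ρ p κ =
      ((ρ ^ 2 * (κ + p) / κ ^ 2 + p / κ : ℝ) : ℂ) := by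
  have h0 := ratio_nonneg hp hκ
  have h1 := ratio_lt_one hp hκ
  have hd : κ + 2 * p ≠ 0 := by positivity
  have hx := one_sub_ratio hp hκ
  have hx' : (1 : ℝ) - ratio p κ ≠ 0 := by linarith
  have e1 := hasSum_geometric_of_lt_one h0 h1
  have e2 := hasSum_coe_mul_geometric_of_norm_lt_one (r := ratio p κ)
    (by rwa [Real.norm_of_nonneg h0])
  have e3 := (e1.mul_left (ratio p κ / 2)).add
    ((e2.add (e1.mul_left 2)).mul_left (ρ ^ 2 / 2 / (κ + 2 * p)))
  rw [lcExponent]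
  have e4 : ρ ^ 2 * (κ + p) / κ ^ 2 + p / κ = ratio p κ / 2 * (1 - ratio p κ)⁻¹ +
      ρ ^ 2 / 2 / (κ + 2 * p) * (ratio p κ / (1 - ratio p κ) ^ 2 + 2 * (1 - ratio p κ)⁻¹) := by
    rw [hx, ratio]
    field_simp
    ring
  rw [e4, ← (Complex.hasSum_ofReal.2 e3).tsum_eq]
  refine tsum_congr fun j => ?_
  rw [cycLim, lineLim]
  have : (j : ℂ) + 1 ≠ 0 := by exact_mod_cast Nat.succ_ne_zero j
  have hd' : (κ : ℂ) + 2 * p ≠ 0 := by exact_mod_cast hd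
  push_cast
  field_simp
  ring

end closedForms

lemma lcSize_eq_zero_iff {α V : Type*} [Fintype V] (σ : Matching α) (f : α → V) :
    lcSize σ f = 0 ↔ lc σ f = ∅ := by
  rw [lcSize, Finset.sum_eq_zero_iff]
  constructor
  · intro h
    refine Finset.eq_empty_of_forall_notMem fun A hA => ?_
    exact (mem_lc.1 hA).2.nonempty.ne_empty (Finset.card_eq_zero.1 (h A hA))
  · intro h
    simp [h]

namespace CriticalWindow

variable {d : (n : ℕ+) → DegreeSeq n} {ρ₁ p₂ dbar : ℝ}

theorem tendsto_integral_sub (hd : CriticalWindow d ρ₁ p₂ dbar) :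
    Tendsto (fun n : ℕ+ => ∫ σ, ((n : ℝ) - (σ.maxComponentSize : ℝ)) ∂(d n).cmMeasure) atTop
      (𝓝 (ρ₁ ^ 2 * (dbar - p₂) / (dbar - 2 * p₂) ^ 2 + p₂ / (dbar - 2 * p₂))) := by
  have h1 := hd.tendsto_integral_lcSize
  rw [lcExponent_id hd.p_nonneg hd.κ_pos, Complex.ofReal_re,
    show dbar - 2 * p₂ + p₂ = dbar - p₂ by ring] at h1
  have h2 : Tendsto (fun n : ℕ+ => ∫ σ, (((n : ℝ) - (σ.maxComponentSize : ℝ)) -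
      lcSize ((d n).toMatching σ) (d n).vert) ∂(d n).cmMeasure) atTop (𝓝 0) :=
    squeeze_zero_norm (fun n => norm_integral_le_integral_norm _) hd.tendsto_integral_abs_sub
  have h3 := h2.add h1
  rw [zero_add] at h3
  refine h3.congr fun n => ?_
  rw [← integral_add Integrable.of_finite Integrable.of_finite]
  simp

theorem tendsto_connected (hd : CriticalWindow d ρ₁ p₂ dbar) :
    Tendsto (fun n : ℕ+ => (d n).cmMeasure.real {σ | σ.graph.Connected}) atTop
      (𝓝 (((dbar - 2 * p₂) / dbar) ^ (1 / 2 : ℝ) *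
        Real.exp (-(ρ₁ ^ 2 / (2 * (dbar - 2 * p₂)))))) := by
  classical
  -- The value at zero is only for the bound `‖g k‖ ≤ G * k ^ 2`. Components are nonempty, so every
  -- factor `1 + g |A|` is zero and the product is the indicator of no line or cycle.
  set g : ℕ → ℂ := fun k => if k = 0 then 0 else -1 with hg
  have h1 := hd.tendsto_integral_prod (g := g) (G := 1) (fun k => by
    rcases Nat.eq_zero_or_pos k with rfl | hk
    · simp [hg]
    · have : (1 : ℝ) ≤ k := by exact_mod_cast hk
      simp only [hg, hk.ne', if_false, norm_neg, norm_one, one_mul]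
      nlinarith) zero_le_one
  rw [lcExponent_eq_of_neg_one (fun k => by simp [hg]) hd.p_nonneg hd.κ_pos, ← Complex.ofReal_exp,
    sub_add_cancel] at h1
  have hpos : 0 < (dbar - 2 * p₂) / dbar := div_pos hd.κ_pos hd.dbar_pos
  rw [Real.rpow_def_of_pos hpos, ← Real.exp_add,
    show Real.log ((dbar - 2 * p₂) / dbar) * (1 / 2) + -(ρ₁ ^ 2 / (2 * (dbar - 2 * p₂))) =
      Real.log ((dbar - 2 * p₂) / dbar) / 2 - ρ₁ ^ 2 / (2 * (dbar - 2 * p₂)) by ring]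
  have h2 : Tendsto (fun n : ℕ+ => (d n).cmMeasure.real
      {σ | lcSize ((d n).toMatching σ) (d n).vert = 0}) atTop
      (𝓝 (Real.exp (Real.log ((dbar - 2 * p₂) / dbar) / 2 - ρ₁ ^ 2 / (2 * (dbar - 2 * p₂))))) := by
    have h3 := (Complex.continuous_re.tendsto _).comp h1
    rw [Complex.ofReal_re] at h3
    refine h3.congr fun n => ?_
    simp only [Function.comp]
    have : ∀ σ : (d n).Pairing, ∏ A ∈ lc ((d n).toMatching σ) (d n).vert, (1 + g A.card) =
        ((Set.indicator {σ | lcSize ((d n).toMatching σ) (d n).vert = 0} 1 σ : ℝ) : ℂ) := by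
      intro σ
      by_cases h : lc ((d n).toMatching σ) (d n).vert = ∅
      · rw [Set.indicator_of_mem (show σ ∈ {σ | lcSize ((d n).toMatching σ) (d n).vert = 0} from
          (lcSize_eq_zero_iff _ _).2 h), h]
        simp
      · rw [Set.indicator_of_notMem (show σ ∉ {σ | lcSize ((d n).toMatching σ) (d n).vert = 0} from
          fun h' => h ((lcSize_eq_zero_iff _ _).1 h'))]
        obtain ⟨A, hA⟩ := Finset.nonempty_iff_ne_empty.2 h
        rw [Finset.prod_eq_zero hA]
        · simp
        · have := Finset.card_ne_zero.2 (mem_lc.1 hA).2.nonempty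
          simp [hg, this]
    simp only [this]
    rw [integral_complex_ofReal, Complex.ofReal_re, integral_indicator_one (MeasurableSet.of_discrete)]
  have h4 : Tendsto (fun n : ℕ+ => (d n).cmMeasure.real {σ | σ.graph.Connected} -
      (d n).cmMeasure.real {σ | lcSize ((d n).toMatching σ) (d n).vert = 0}) atTop (𝓝 0) := by
    -- Both `n - |C_max|` and `lcSize` are natural numbers, so wherever the two zero events differ,
    -- the quantities differ by at least one.
    refine squeeze_zero_norm (fun n => ?_) hd.tendsto_integral_abs_sub
    rw [← integral_indicator_one (MeasurableSet.of_discrete),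
      ← integral_indicator_one (MeasurableSet.of_discrete),
      ← integral_sub Integrable.of_finite Integrable.of_finite]
    refine (norm_integral_le_integral_norm _).trans
      (integral_mono Integrable.of_finite Integrable.of_finite fun σ => ?_)
    have hc := DegreeSeq.connected_iff σ n.pos
    have hle := DegreeSeq.maxComponentSize_le σ
    simp only [Set.indicator_apply, Set.mem_ofPred_eq, hc, Pi.one_apply]
    set Y := lcSize ((d n).toMatching σ) (d n).vert
    have hcast : ((n : ℕ) : ℝ) - (σ.maxComponentSize : ℝ) = ((n - σ.maxComponentSize : ℕ) : ℝ) := by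
      rw [Nat.cast_sub hle]
    rw [hcast]
    by_cases e1 : σ.maxComponentSize = n <;> by_cases e2 : Y = 0
    · simp [e1, e2]
    · have : (1 : ℝ) ≤ Y := by exact_mod_cast Nat.one_le_iff_ne_zero.2 e2
      simp [e1, e2, this]
    · have : (1 : ℝ) ≤ (n - σ.maxComponentSize : ℕ) := by
        exact_mod_cast Nat.one_le_iff_ne_zero.2 (by omega)
      rw [if_neg e1, if_pos e2, e2]
      simp only [zero_sub, norm_neg, norm_one, Nat.cast_zero, sub_zero]
      rwa [Nat.abs_cast]
    · simp [e1, e2]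
  have h5 := h4.add h2
  rw [zero_add] at h5
  exact h5.congr fun n => by ring

/-- The characteristic function of the number of vertices outside the largest component. -/
theorem tendsto_charFun (hd : CriticalWindow d ρ₁ p₂ dbar) (t : ℝ) :
    Tendsto (fun n : ℕ+ => ∫ σ, Complex.exp (t * ((n : ℝ) - (σ.maxComponentSize : ℝ) : ℝ) *
      Complex.I) ∂(d n).cmMeasure) atTop
      (𝓝 (Complex.exp (lcExponent (fun k => Complex.exp (t * k * Complex.I) - 1) ρ₁ p₂
        (dbar - 2 * p₂)))) := by
  have h1 := hd.tendsto_integral_prod (g := fun k => Complex.exp (t * k * Complex.I) - 1) (G := 2)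
    (fun k => by
      rcases Nat.eq_zero_or_pos k with rfl | hk
      · simp
      · have hk' : (1 : ℝ) ≤ k := by exact_mod_cast hk
        have : ‖Complex.exp (t * k * Complex.I)‖ = 1 := by
          rw [show (t : ℂ) * k = ((t * k : ℝ) : ℂ) by push_cast; rfl]
          exact Complex.norm_exp_ofReal_mul_I _
        refine (norm_sub_le _ _).trans ?_
        rw [this, norm_one]
        nlinarith) zero_le_two
  have h2 : Tendsto (fun n : ℕ+ => ∫ σ, (Complex.exp (t * ((n : ℝ) - (σ.maxComponentSize : ℝ) : ℝ) *
      Complex.I) - ∏ A ∈ lc ((d n).toMatching σ) (d n).vert,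
        (1 + (Complex.exp (t * (A.card : ℕ) * Complex.I) - 1))) ∂(d n).cmMeasure) atTop (𝓝 0) := by
    have h3 := hd.tendsto_integral_abs_sub.const_mul |t|
    rw [mul_zero] at h3
    refine squeeze_zero_norm (fun n => ?_) h3
    rw [← integral_const_mul]
    refine (norm_integral_le_integral_norm _).trans
      (integral_mono Integrable.of_finite Integrable.of_finite fun σ => ?_)
    simp only [add_sub_cancel]
    set R : ℝ := (n : ℝ) - (σ.maxComponentSize : ℝ)
    set Y := lcSize ((d n).toMatching σ) (d n).vert with hY
    have hprod : ∏ A ∈ lc ((d n).toMatching σ) (d n).vert,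
        Complex.exp (t * (A.card : ℕ) * Complex.I) = Complex.exp ((t * Y : ℝ) * Complex.I) := by
      rw [← Complex.exp_sum, ← Finset.sum_mul, ← Finset.mul_sum, hY, lcSize]
      push_cast
      rfl
    -- Factor out a unimodular number and use `|exp (i x) - 1| ≤ |x|`.
    rw [hprod, show Complex.exp (t * R * Complex.I) - Complex.exp ((t * Y : ℝ) * Complex.I) =
      Complex.exp ((t * Y : ℝ) * Complex.I) *
        (Complex.exp (Complex.I * (t * (R - Y) : ℝ)) - 1) by
      rw [mul_sub, ← Complex.exp_add, mul_one]
      push_cast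
      ring_nf, norm_mul, Complex.norm_exp_ofReal_mul_I, one_mul]
    refine Real.norm_exp_I_mul_ofReal_sub_one_le.trans_eq ?_
    rw [Real.norm_eq_abs, abs_mul]
  have h3 := h2.add h1
  rw [zero_add] at h3
  refine h3.congr fun n => ?_
  rw [← integral_add Integrable.of_finite Integrable.of_finite]
  simp

end CriticalWindow

end ConfigModel
end

/-! ### Compound Poisson sums and convergence in distribution. -/

noncomputable section

namespace ConfigModel

section compoundPoisson

variable {ι Ω : Type*} [MeasurableSpace Ω] {P : Measure Ω}
  {N : ι → Ω → ℕ} {r : ι → NNReal}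

lemma measure_ne_zero_le (hN : ∀ i, HasLaw (N i) (poissonMeasure (r i)) P) (i : ι) :
    P {ω | N i ω ≠ 0} ≤ r i := by
  have h1 : P {ω | N i ω ≠ 0} = poissonMeasure (r i) {0}ᶜ := by
    rw [← (hN i).map_eq, Measure.map_apply_of_aemeasurable (hN i).aemeasurable
      (MeasurableSet.of_discrete)]
    rfl
  rw [h1, prob_compl_eq_one_sub (MeasurableSet.of_discrete), poissonMeasure_singleton]
  simp only [pow_zero, mul_one, Nat.factorial_zero, Nat.cast_one, div_one]
  rw [← ENNReal.ofReal_one, ← ENNReal.ofReal_sub _ (Real.exp_pos _).le, ← ENNReal.ofReal_coe_nnreal]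
  refine ENNReal.ofReal_le_ofReal ?_
  have := Real.add_one_le_exp (-(r i : ℝ))
  linarith

variable [Countable ι]

/-- Borel–Cantelli: a Poisson variable is nonzero with probability `1 - exp (-r) ≤ r`. Hence the
weighted series is almost surely a finite sum, whatever the weights. -/
lemma ae_finite_ne_zero (hN : ∀ i, HasLaw (N i) (poissonMeasure (r i)) P) (hr : Summable r) :
    ∀ᵐ ω ∂P, {i | N i ω ≠ 0}.Finite := by
  refine ae_finite_setOfPred_mem (s := fun i => {ω | N i ω ≠ 0}) (ne_of_lt ?_)
  exact (ENNReal.tsum_le_tsum (measure_ne_zero_le hN)).trans_lt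
    (ENNReal.tsum_coe_ne_top_iff_summable.2 hr).lt_top

lemma ae_summable (hN : ∀ i, HasLaw (N i) (poissonMeasure (r i)) P) (hr : Summable r)
    (w : ι → ℝ) : ∀ᵐ ω ∂P, Summable fun i => w i * N i ω := by
  filter_upwards [ae_finite_ne_zero hN hr] with ω hω
  refine summable_of_hasFiniteSupport (hω.subset fun i hi h => hi ?_)
  simp [h]

lemma aemeasurable_tsum (hN : ∀ i, HasLaw (N i) (poissonMeasure (r i)) P) (hr : Summable r)
    (w : ι → ℝ) : AEMeasurable (fun ω => ∑' i, w i * (N i ω : ℝ)) P := by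
  refine aemeasurable_of_tendsto_metrizable_ae (atTop : Filter (Finset ι))
    (f := fun s ω => ∑ i ∈ s, w i * (N i ω : ℝ)) (fun s => ?_) ?_
  · refine Finset.aemeasurable_fun_sum s fun i _ => ?_
    have h1 := (hN i).aemeasurable
    have h2 : Measurable (fun n : ℕ => (n : ℝ)) := Measurable.of_discrete
    exact (h2.comp_aemeasurable h1).const_mul _
  · filter_upwards [ae_summable hN hr w] with ω hω
    exact hω.hasSum

variable [IsProbabilityMeasure P]

/-- The characteristic function of a weighted sum of independent Poisson variables. -/
theorem charFun_map_tsum (hI : iIndepFun N P)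
    (hN : ∀ i, HasLaw (N i) (poissonMeasure (r i)) P) (hr : Summable r) (w : ι → ℝ) (t : ℝ) :
    charFun (P.map fun ω => ∑' i, w i * (N i ω : ℝ)) t =
      Complex.exp (∑' i, (r i : ℂ) * (Complex.exp (t * w i * Complex.I) - 1)) := by
  have hcast : Measurable (fun n : ℕ => (n : ℝ)) := Measurable.of_discrete
  have hm : ∀ i, AEMeasurable (fun ω => (N i ω : ℝ)) P := fun i =>
    hcast.comp_aemeasurable (hN i).aemeasurable
  have hmw : ∀ i, AEMeasurable (fun ω => w i * (N i ω : ℝ)) P := fun i => (hm i).const_mul _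
  have hfin : ∀ s : Finset ι, charFun (P.map fun ω => ∑ i ∈ s, w i * (N i ω : ℝ)) t =
      Complex.exp (∑ i ∈ s, (r i : ℂ) * (Complex.exp (t * w i * Complex.I) - 1)) := by
    intro s
    have hI' : iIndepFun (fun i ω => w i * (N i ω : ℝ)) P :=
      hI.comp (fun i n => w i * (n : ℝ)) fun i => Measurable.of_discrete
    rw [iIndepFun.charFun_map_fun_finsetSum_eq_prod (X := fun i ω => w i * (N i ω : ℝ))
      (fun i _ => hmw i) (hI'.restrict s), Finset.prod_apply, Complex.exp_sum]
    refine Finset.prod_congr rfl fun i _ => ?_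
    rw [charFun_map_mul_comp (hm i)]
    have : P.map (fun ω => (N i ω : ℝ)) = (poissonMeasure (r i)).map (Nat.cast : ℕ → ℝ) := by
      rw [← (hN i).map_eq, AEMeasurable.map_map_of_aemeasurable hcast.aemeasurable
        (hN i).aemeasurable]
      rfl
    rw [this, charFun_map_cast_poissonMeasure]
    push_cast
    rw [mul_comm (t : ℂ)]
  have hs : Summable fun i => (r i : ℂ) * (Complex.exp (t * w i * Complex.I) - 1) := by
    refine Summable.of_norm_bounded (g := fun i => (r i : ℝ) * 2)
      ((NNReal.summable_coe.2 hr).mul_right 2) fun i => ?_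
    rw [norm_mul]
    have h1 : ‖Complex.exp (t * w i * Complex.I)‖ = 1 := by
      rw [← Complex.ofReal_mul]
      exact Complex.norm_exp_ofReal_mul_I _
    have h2 : ‖Complex.exp (t * w i * Complex.I) - 1‖ ≤ 2 :=
      (norm_sub_le _ _).trans (by rw [h1, norm_one]; norm_num)
    have h3 : ‖((r i : NNReal) : ℂ)‖ = (r i : ℝ) := by
      simp
    rw [h3]
    gcongr
  have hlim1 : Tendsto (fun s : Finset ι => charFun (P.map fun ω => ∑ i ∈ s, w i * (N i ω : ℝ)) t)
      atTop (𝓝 (Complex.exp (∑' i, (r i : ℂ) * (Complex.exp (t * w i * Complex.I) - 1)))) := by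
    simp only [hfin]
    exact (Complex.continuous_exp.tendsto _).comp hs.hasSum
  have hexp : ∀ x : ℝ, ‖Complex.exp (t * x * Complex.I)‖ ≤ 1 := fun x => by
    rw [← Complex.ofReal_mul]
    exact (Complex.norm_exp_ofReal_mul_I _).le
  have hcont : Continuous fun x : ℝ => Complex.exp (t * x * Complex.I) := by fun_prop
  -- Partial sums converge almost surely and `exp (i t x)` is bounded, so their characteristic
  -- functions also converge to that of the full sum; uniqueness of limits then identifies it.
  have hlim2 : Tendsto (fun s : Finset ι => charFun (P.map fun ω => ∑ i ∈ s, w i * (N i ω : ℝ)) t)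
      atTop (𝓝 (charFun (P.map fun ω => ∑' i, w i * (N i ω : ℝ)) t)) := by
    have hms : ∀ s : Finset ι, AEMeasurable (fun ω => ∑ i ∈ s, w i * (N i ω : ℝ)) P := fun s =>
      Finset.aemeasurable_fun_sum s fun i _ => hmw i
    have hmt := aemeasurable_tsum hN hr w
    simp only [charFun_apply_real]
    rw [integral_map hmt hcont.aestronglyMeasurable]
    have : ∀ s : Finset ι, ∫ x, Complex.exp (t * x * Complex.I)
        ∂(P.map fun ω => ∑ i ∈ s, w i * (N i ω : ℝ)) =
        ∫ ω, Complex.exp (t * (∑ i ∈ s, w i * (N i ω : ℝ) : ℝ) * Complex.I) ∂P := fun s =>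
      integral_map (hms s) hcont.aestronglyMeasurable
    simp only [this]
    refine tendsto_integral_filter_of_dominated_convergence (fun _ => 1) ?_ ?_
      (integrable_const 1) ?_
    · exact Eventually.of_forall fun s =>
        (hcont.measurable.comp_aemeasurable (hms s)).aestronglyMeasurable
    · exact Eventually.of_forall fun s => ae_of_all _ fun ω => hexp _
    · filter_upwards [ae_summable hN hr w] with ω hω
      exact (hcont.tendsto _).comp hω.hasSum
  exact tendsto_nhds_unique hlim2 hlim1

end compoundPoisson

section rates

variable {ρ₁ p₂ dbar : ℝ}

lemma cycleRate_succ (j : ℕ) :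
    cycleRate p₂ dbar (j + 1) = cycLim p₂ (dbar - 2 * p₂) j := by
  rw [cycleRate, cycLim, ratio, sub_add_cancel, div_pow, div_div]
  push_cast
  ring

lemma lineRate_one : lineRate ρ₁ p₂ dbar 1 = 0 := by simp [lineRate]

lemma lineRate_succ_succ (j : ℕ) :
    lineRate ρ₁ p₂ dbar (j + 2) = lineLim ρ₁ p₂ (dbar - 2 * p₂) j := by
  rw [lineRate, if_neg (by omega), lineLim, ratio, sub_add_cancel, div_pow, div_div,
    show j + 2 - 2 = j by omega, show j + 2 - 1 = j + 1 by omega]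
  ring

lemma cycleRate_nonneg (hp : 0 ≤ p₂) (hd : 0 < dbar) (k : ℕ) : 0 ≤ cycleRate p₂ dbar k := by
  unfold cycleRate; positivity

lemma lineRate_nonneg (hp : 0 ≤ p₂) (hd : 0 < dbar) (k : ℕ) : 0 ≤ lineRate ρ₁ p₂ dbar k := by
  unfold lineRate
  split_ifs <;> positivity

lemma summable_cycleRate (hp : 0 ≤ p₂) (hκ : 0 < dbar - 2 * p₂) :
    Summable fun j : ℕ => cycleRate p₂ dbar (j + 1) := by
  simp only [cycleRate_succ]
  exact (hasSum_cycLim hp hκ).summable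

lemma summable_lineRate (hp : 0 ≤ p₂) (hκ : 0 < dbar - 2 * p₂) :
    Summable fun j : ℕ => lineRate ρ₁ p₂ dbar (j + 1) := by
  -- One further shift skips `k = 1`, whose rate is zero by definition and not the general
  -- expression.
  refine (summable_nat_add_iff 1).1 ?_
  simp only [add_assoc, one_add_one_eq_two, lineRate_succ_succ]
  exact (hasSum_lineLim hp hκ).summable

/-- The rates of the limiting Poisson variables. -/
def rate (ρ₁ p₂ dbar : ℝ) : ℕ+ ⊕ ℕ+ → NNReal :=
  Sum.elim (fun k => (cycleRate p₂ dbar k).toNNReal) fun k => (lineRate ρ₁ p₂ dbar k).toNNReal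

lemma summable_rate (hp : 0 ≤ p₂) (hκ : 0 < dbar - 2 * p₂) : Summable (rate ρ₁ p₂ dbar) := by
  have hd : 0 < dbar := by linarith
  rw [← NNReal.summable_coe]
  refine Summable.sum _ ?_ ?_
  · have := (summable_pnat_iff_summable_succ (f := fun k => cycleRate p₂ dbar k)).2
      (summable_cycleRate hp hκ)
    exact this.congr fun k => (Real.coe_toNNReal _ (cycleRate_nonneg hp hd k)).symm
  · have := (summable_pnat_iff_summable_succ (f := fun k => lineRate ρ₁ p₂ dbar k)).2
      (summable_lineRate hp hκ)
    exact this.congr fun k => (Real.coe_toNNReal _ (lineRate_nonneg hp hd k)).symm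

/-- The exponent pairs cycles of `j + 1` vertices with lines of `j + 2`. The zero rate at size one
lets the line series be shifted to match. -/
lemma tsum_rate (hp : 0 ≤ p₂) (hκ : 0 < dbar - 2 * p₂) {g : ℕ → ℂ} {G : ℝ} (hg : ∀ k, ‖g k‖ ≤ G) :
    ∑' i, (rate ρ₁ p₂ dbar i : ℂ) * g (Sum.elim (fun k : ℕ+ => (k : ℕ)) (fun k : ℕ+ => (k : ℕ)) i) =
      lcExponent g ρ₁ p₂ (dbar - 2 * p₂) := by
  have hd : 0 < dbar := by linarith
  have hG : 0 ≤ G := (norm_nonneg _).trans (hg 0)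
  have hs : Summable fun i => (rate ρ₁ p₂ dbar i : ℂ) *
      g (Sum.elim (fun k : ℕ+ => (k : ℕ)) (fun k : ℕ+ => (k : ℕ)) i) := by
    refine Summable.of_norm_bounded (g := fun i => (rate ρ₁ p₂ dbar i : ℝ) * G)
      ((NNReal.summable_coe.2 (summable_rate hp hκ)).mul_right G) fun i => ?_
    rw [norm_mul]
    have h3 : ‖((rate ρ₁ p₂ dbar i : NNReal) : ℂ)‖ = (rate ρ₁ p₂ dbar i : ℝ) := by simp
    rw [h3]
    gcongr
    exact hg _
  have hsc : Summable fun j : ℕ => (cycleRate p₂ dbar (j + 1) : ℂ) * g (j + 1) := by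
    refine Summable.of_norm_bounded (g := fun j => cycleRate p₂ dbar (j + 1) * G)
      ((summable_cycleRate hp hκ).mul_right G) fun j => ?_
    rw [norm_mul, Complex.norm_real, Real.norm_of_nonneg (cycleRate_nonneg hp hd _)]
    exact mul_le_mul_of_nonneg_left (hg _) (cycleRate_nonneg hp hd _)
  have hsl : Summable fun j : ℕ => (lineRate ρ₁ p₂ dbar (j + 1) : ℂ) * g (j + 1) := by
    refine Summable.of_norm_bounded (g := fun j => lineRate ρ₁ p₂ dbar (j + 1) * G)
      ((summable_lineRate hp hκ).mul_right G) fun j => ?_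
    rw [norm_mul, Complex.norm_real, Real.norm_of_nonneg (lineRate_nonneg hp hd _)]
    exact mul_le_mul_of_nonneg_left (hg _) (lineRate_nonneg hp hd _)
  have hc : ∀ k : ℕ+, (rate ρ₁ p₂ dbar (Sum.inl k) : ℂ) * g k = (cycleRate p₂ dbar k : ℂ) * g k := by
    intro k
    have : ((rate ρ₁ p₂ dbar (Sum.inl k) : NNReal) : ℝ) = cycleRate p₂ dbar k :=
      Real.coe_toNNReal _ (cycleRate_nonneg hp hd k)
    rw [← this]
  have hl : ∀ k : ℕ+, (rate ρ₁ p₂ dbar (Sum.inr k) : ℂ) * g k =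
      (lineRate ρ₁ p₂ dbar k : ℂ) * g k := by
    intro k
    have : ((rate ρ₁ p₂ dbar (Sum.inr k) : NNReal) : ℝ) = lineRate ρ₁ p₂ dbar k :=
      Real.coe_toNNReal _ (lineRate_nonneg hp hd k)
    rw [← this]
  rw [Summable.tsum_sum (hs.comp_injective Sum.inl_injective)
    (hs.comp_injective Sum.inr_injective)]
  simp only [Sum.elim_inl, Sum.elim_inr, hc, hl]
  rw [tsum_pnat_eq_tsum_succ (f := fun k => (cycleRate p₂ dbar k : ℂ) * g k),
    tsum_pnat_eq_tsum_succ (f := fun k => (lineRate ρ₁ p₂ dbar k : ℂ) * g k),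
    hsl.tsum_eq_zero_add, zero_add, lineRate_one, Complex.ofReal_zero, zero_mul, zero_add,
    ← hsc.tsum_add ((summable_nat_add_iff 1).2 hsl), lcExponent]
  refine tsum_congr fun j => ?_
  rw [cycleRate_succ, add_assoc, one_add_one_eq_two, lineRate_succ_succ]
  ring

end rates

section limit

variable {d : (n : ℕ+) → DegreeSeq n} {ρ₁ p₂ dbar : ℝ} {Ω : Type*} [MeasurableSpace Ω]
  {P : Measure Ω} {C L : ℕ+ → Ω → ℕ}

/-- The weight of a cycle or line is its number of vertices. -/
def weight : ℕ+ ⊕ ℕ+ → ℝ := Sum.elim (fun k => ((k : ℕ) : ℝ)) fun k => ((k : ℕ) : ℝ)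

lemma hasLaw_elim (hC : ∀ k, HasLaw (C k) (poissonMeasure (cycleRate p₂ dbar k).toNNReal) P)
    (hL : ∀ k, HasLaw (L k) (poissonMeasure (lineRate ρ₁ p₂ dbar k).toNNReal) P) (i : ℕ+ ⊕ ℕ+) :
    HasLaw (Sum.elim C L i) (poissonMeasure (rate ρ₁ p₂ dbar i)) P := by
  rcases i with k | k
  · exact hC k
  · exact hL k

lemma ae_summable_and_tsum_eq (hp : 0 ≤ p₂) (hκ : 0 < dbar - 2 * p₂)
    (hC : ∀ k, HasLaw (C k) (poissonMeasure (cycleRate p₂ dbar k).toNNReal) P)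
    (hL : ∀ k, HasLaw (L k) (poissonMeasure (lineRate ρ₁ p₂ dbar k).toNNReal) P) :
    ∀ᵐ ω ∂P, (Summable fun k : ℕ+ => ((k : ℕ) : ℝ) * ((C k ω : ℝ) + L k ω)) ∧
      ∑' i, weight i * (Sum.elim C L i ω : ℝ) =
        ∑' k : ℕ+, ((k : ℕ) : ℝ) * ((C k ω : ℝ) + L k ω) := by
  have hae := ae_summable (hasLaw_elim hC hL) (summable_rate hp hκ) weight
  refine hae.mono fun ω hω => ?_
  have h1 : Summable fun k : ℕ+ => ((k : ℕ) : ℝ) * (C k ω : ℝ) :=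
    (hω.comp_injective Sum.inl_injective).congr fun k => rfl
  have h2 : Summable fun k : ℕ+ => ((k : ℕ) : ℝ) * (L k ω : ℝ) :=
    (hω.comp_injective Sum.inr_injective).congr fun k => rfl
  have h3 := (h1.hasSum.add h2.hasSum).congr_fun fun k => (mul_add ((k : ℕ) : ℝ) _ _)
  refine ⟨h3.summable, ?_⟩
  rw [h3.tsum_eq]
  exact HasSum.tsum_eq (HasSum.sum h1.hasSum h2.hasSum)

variable [IsProbabilityMeasure P]

theorem tendstoInDistribution_sub (hd : CriticalWindow d ρ₁ p₂ dbar)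
    (hI : iIndepFun (Sum.elim C L) P)
    (hC : ∀ k, HasLaw (C k) (poissonMeasure (cycleRate p₂ dbar k).toNNReal) P)
    (hL : ∀ k, HasLaw (L k) (poissonMeasure (lineRate ρ₁ p₂ dbar k).toNNReal) P) :
    TendstoInDistribution
      (fun (n : ℕ+) (σ : (d n).Pairing) => ((n : ℕ) : ℝ) - (σ.maxComponentSize : ℝ)) atTop
      (fun ω => ∑' k : ℕ+, ((k : ℕ) : ℝ) * ((C k ω : ℝ) + L k ω))
      (fun n => (d n).cmMeasure) P := by
  have hr := summable_rate (ρ₁ := ρ₁) hd.p_nonneg hd.κ_pos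
  have hN := hasLaw_elim hC hL
  have hae := ae_summable_and_tsum_eq hd.p_nonneg hd.κ_pos hC hL
  refine TendstoInDistribution.congr (X := fun (n : ℕ+) (σ : (d n).Pairing) =>
    ((n : ℕ) : ℝ) - (σ.maxComponentSize : ℝ))
    (Z := fun ω => ∑' i, weight i * (Sum.elim C L i ω : ℝ)) (fun n => ae_eq_rfl)
    (hae.mono fun ω h => h.2) ?_
  have hmeas : ∀ n : ℕ+, AEMeasurable (fun σ : (d n).Pairing =>
    ((n : ℕ) : ℝ) - (σ.maxComponentSize : ℝ)) (d n).cmMeasure := fun n =>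
      Measurable.of_discrete.aemeasurable
  refine ⟨hmeas, aemeasurable_tsum hN hr weight, ?_⟩
  -- Reindexing by `ℕ` puts the convergence in the form of a sequence for Lévy's continuity theorem.
  have hmap : (atTop : Filter ℕ+) = Filter.map Nat.succPNat atTop :=
    (OrderIso.map_atTop OrderIso.pnatIsoNat.symm).symm
  rw [hmap]
  refine tendsto_map'_iff.2 (ProbabilityMeasure.tendsto_of_tendsto_charFun fun t => ?_)
  have h1 := hd.tendsto_charFun t
  rw [hmap, tendsto_map'_iff] at h1
  simp only [ProbabilityMeasure.coe_mk, Function.comp]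
  rw [charFun_map_tsum hI hN hr]
  have hexp : ∀ k : ℕ, ‖Complex.exp (t * k * Complex.I) - 1‖ ≤ 2 := fun k => by
    have h1 : ‖Complex.exp (t * k * Complex.I)‖ = 1 := by
      rw [show (t : ℂ) * k = ((t * k : ℝ) : ℂ) by push_cast; rfl]
      exact Complex.norm_exp_ofReal_mul_I _
    exact (norm_sub_le _ _).trans (by rw [h1, norm_one]; norm_num)
  have h2 := tsum_rate (ρ₁ := ρ₁) hd.p_nonneg hd.κ_pos hexp
  have h3 : ∀ i, (weight i : ℂ) =
      ((Sum.elim (fun k : ℕ+ => (k : ℕ)) (fun k : ℕ+ => (k : ℕ)) i : ℕ) : ℂ) := by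
    rintro (k | k) <;> simp [weight]
  simp only [h3, h2]
  refine h1.congr fun m => ?_
  rw [Function.comp, charFun_apply_real, integral_map (hmeas _) (by fun_prop)]

end limit

end ConfigModel
end

theorem mainTheorem1 (d : (n : ℕ+) → ConfigModel.DegreeSeq n) (ρ₁ p₂ dbar : ℝ)
    (hd : ConfigModel.CriticalWindow d ρ₁ p₂ dbar) :
    Tendsto (fun n : ℕ+ => (d n).cmMeasure.real {σ | σ.graph.Connected}) atTop
      (𝓝 (((dbar - 2 * p₂) / dbar) ^ (1 / 2 : ℝ) *
        Real.exp (-(ρ₁ ^ 2 / (2 * (dbar - 2 * p₂)))))) ∧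
    (∀ (Ω : Type*) [MeasurableSpace Ω] (P : Measure Ω) [IsProbabilityMeasure P]
      (C L : ℕ+ → Ω → ℕ),
      iIndepFun (Sum.elim C L) P →
      (∀ k, HasLaw (C k) (poissonMeasure (ConfigModel.cycleRate p₂ dbar k).toNNReal) P) →
      (∀ k, HasLaw (L k) (poissonMeasure (ConfigModel.lineRate ρ₁ p₂ dbar k).toNNReal) P) →
      (∀ᵐ ω ∂P, Summable fun k : ℕ+ => (k : ℝ) * ((C k ω : ℝ) + L k ω)) ∧
      TendstoInDistribution
        (fun (n : ℕ+) (σ : (d n).Pairing) => (n : ℝ) - (σ.maxComponentSize : ℝ)) atTop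
        (fun ω => ∑' k : ℕ+, (k : ℝ) * ((C k ω : ℝ) + L k ω))
        (fun n => (d n).cmMeasure) P) ∧
    Tendsto (fun n : ℕ+ => ∫ σ, ((n : ℝ) - (σ.maxComponentSize : ℝ)) ∂(d n).cmMeasure) atTop
      (𝓝 (ρ₁ ^ 2 * (dbar - p₂) / (dbar - 2 * p₂) ^ 2 + p₂ / (dbar - 2 * p₂))) := by
  exact ⟨hd.tendsto_connected, fun Ω _ P _ C L hI hC hL =>
    ⟨(ConfigModel.ae_summable_and_tsum_eq hd.p_nonneg hd.κ_pos hC hL).mono fun ω h => h.1,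
      ConfigModel.tendstoInDistribution_sub hd hI hC hL⟩, hd.tendsto_integral_sub⟩
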